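/- Let $G$ be a finite group, $A\trianglelefteq G$ a normal subgroup, $Q=G/A$ with projection $\pi:G\to Q$, and let $\rho:A\to U(V_\rho)$ be an irreducible finite-dimensional complex unitary representation whose isomorphism class is $G$-invariant: $g\cdot\rho\cong\rho$ for every $g\in G$, where $(g\cdot\rho)(a)=\rho(g^{-1}ag)$. *The cocycle.* There exist choices $(\sigma,M)$ consisting of a map $\sigma:Q\to G$ with $\pi\sigma=\mathrm{id}$, $\sigma(1)=1$, and elements $M_q\in U(V_\rho)$ $(q\in Q)$ with $M_1=1$ and $\rho(\sigma(q)^{-1}a\,\sigma(q))=M_q^{-1}\rho(a)M_q$ for all $a\in A$. Fix any such choice and put $\chi(q_1,q_2)=\sigma(q_1q_2)^{-1}\sigma(q_1)\sigma(q_2)\in A$. Then $$\alpha_\rho(q_1,q_2)=\rho(\chi(q_1,q_2))\,M_{q_2}^{-1}M_{q_1}^{-1}M_{q_1q_2}$$ is a scalar in $\mathbb S^1$, and $\alpha_\rho$ is a normalized 2-cocycle on $Q$ with values in $\mathbb S^1$. Let $\widetilde Q_{\alpha_\rho}=Q\times\mathbb S^1$ with product $(q_1,z_1)(q_2,z_2)=(q_1q_2,\alpha_\rho(q_1,q_2)z_1z_2)$,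 a central extension of $Q$ by $\mathbb S^1$. *The K-groups.* Let $X$ be a compact Hausdorff $G$-space on which $A$ acts trivially; it is then a $Q$-space and a $\widetilde Q_{\alpha_\rho}$-space. A $(G,\rho)$-equivariant vector bundle over $X$ is a $G$-equivariant complex vector bundle $E\to X$ for which the evaluation map $\mathbb V_\rho\otimes\mathrm{Hom}_A(\mathbb V_\rho,E)\to E$, $v\otimes f\mapsto f(v)$, is an isomorphism, where $\mathbb V_\rho=X\times V_\rho$. Let $K^0_{G,\rho}(X)$ be the Grothendieck group of isomorphism classes of $(G,\rho)$-equivariant vector bundles over $X$, and ${}^{\alpha_\rho}K^0_Q(X)$ that of $\widetilde Q_{\alpha_\rho}$-equivariant vector bundles over $X$ on which the central $\mathbb S^1$ acts by multiplication by scalars. For $n>0$ let $K^n_{G,\rho}(X)=\widetilde K^0_{G,\rho}(\Sigma^nX_+)$ and ${}^{\alpha_\rho}K^n_Q(X)={}^{\alpha_\rho}\widetilde K^0_Q(\Sigma^nX_+)$, where $\widetilde K^0$ of a pointed space is the kernel of restriction to the base point. All these groups are modules over the representation ring $R(Q)$ through the tensor product of bundles with representations of $Q$. *The statement.* For every $(G,\rho)$-equivariant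 vector bundle $E$ over $X$, the bundle $\mathrm{Hom}_A(\mathbb V_\rho,E)$ with the action $$((q,z)\cdot f)(v)=z\,\sigma(q)\cdot f(M_q^{-1}v)$$ is a $\widetilde Q_{\alpha_\rho}$-equivariant vector bundle on which the central $\mathbb S^1$ acts by multiplication by scalars, and the assignment $[E]\mapsto[\mathrm{Hom}_A(\mathbb V_\rho,E)]$ (applied to bundles over $X$ for $n=0$ and over $\Sigma^nX_+$ for $n>0$) induces isomorphisms of $R(Q)$-modules $$K^n_{G,\rho}(X)\;\xrightarrow{\ \cong\ }\;{}^{\alpha_\rho}K^n_Q(X)\qquad(n\ge 0),$$ natural with respect to continuous $G$-maps $X\to Y$ between compact Hausdorff $G$-spaces on which $A$ acts trivially. -/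

import Mathlib

universe u v w w'

noncomputable section

namespace EqK

open Topology TensorProduct

section Grothendieck

/-! Grothendieck groups of semirings and semimodules -/

open Algebra

variable {S : Type w} {M : Type u} [AddCommMonoid M]

/-- The class of an element in the Grothendieck group. -/
def gOf : M →+ GrothendieckAddGroup M := GrothendieckAddGroup.of

theorem groth_induction {P : GrothendieckAddGroup M → Prop}
    (of : ∀ m, P (gOf m)) (add : ∀ a b, P a → P b → P (a + b))
    (neg : ∀ a, P a → P (-a)) (x : GrothendieckAddGroup M) : P x := by
  induction x using AddLocalization.ind with
  | H y =>
    obtain ⟨m, s⟩ := y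
    have h : (AddLocalization.mk m s : GrothendieckAddGroup M)
        = gOf m + -gOf (s : M) := by
      rw [← sub_eq_add_neg, eq_sub_iff_add_eq, AddLocalization.mk_eq_addMonoidOf_mk']
      exact AddSubmonoid.LocalizationMap.mk'_spec _ _ _
    rw [h]
    exact add _ _ (of _) (neg _ (of _))

/-- The additive map of Grothendieck groups induced by an additive map. -/
def grothMap {N : Type v} [AddCommMonoid N] (f : M →+ N) :
    GrothendieckAddGroup M →+ GrothendieckAddGroup N :=
  GrothendieckAddGroup.lift (gOf.comp f)

@[simp] theorem groth_lift_of {H : Type v} [AddCommGroup H] (f : M →+ H) (m : M) :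
    GrothendieckAddGroup.lift f (gOf m) = f m :=
  DFunLike.congr_fun (GrothendieckAddGroup.lift.symm_apply_apply f) m

@[simp] theorem grothMap_of {N : Type v} [AddCommMonoid N] (f : M →+ N) (m : M) :
    grothMap f (gOf m) = gOf (f m) :=
  groth_lift_of _ _

/-- The biadditive extension of `s • m` to Grothendieck groups. -/
def grothSMul [Semiring S] [Module S M] :
    GrothendieckAddGroup S →+ GrothendieckAddGroup M →+ GrothendieckAddGroup M :=
  GrothendieckAddGroup.lift
    { toFun := fun s => grothMap (DistribSMul.toAddMonoidHom M s)
      map_zero' := by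
        ext x
        induction x using groth_induction with
        | of m => simp
        | add a b ha hb => rw [map_add, ha, hb, map_add]
        | neg a ha => rw [map_neg, ha, map_neg]
      map_add' := fun s t => by
        ext x
        induction x using groth_induction with
        | of m => simp [add_smul]
        | add a b ha hb => rw [map_add, ha, hb, map_add]
        | neg a ha => rw [map_neg, ha, map_neg] }

@[simp] theorem grothSMul_of [Semiring S] [Module S M] (s : S) (m : M) :
    grothSMul (gOf s) (gOf m)
      = gOf (s • m) := by
  simp [grothSMul]

theorem grothSMul_assoc [Semiring S] [Module S M] (a b : GrothendieckAddGroup S)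
    (x : GrothendieckAddGroup M) :
    grothSMul (grothSMul a b) x = grothSMul a (grothSMul b x) := by
  induction a using groth_induction with
  | add a a' h h' => simp only [map_add, AddMonoidHom.add_apply, h, h']
  | neg a h => simp only [map_neg, AddMonoidHom.neg_apply, h]
  | of s =>
    induction b using groth_induction with
    | add a a' h h' => simp only [map_add, AddMonoidHom.add_apply, h, h']
    | neg a h => simp only [map_neg, AddMonoidHom.neg_apply, h]
    | of t =>
      induction x using groth_induction with
      | add a a' h h' => simp only [map_add, h, h']
      | neg a h => simp only [map_neg, h]
      | of m => simp [mul_smul]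

theorem grothMap_smul [Semiring S] [Module S M] {N : Type v} [AddCommMonoid N] [Module S N]
    (f : M →ₗ[S] N) (r : GrothendieckAddGroup S) (x : GrothendieckAddGroup M) :
    grothMap f.toAddMonoidHom (grothSMul r x) = grothSMul r (grothMap f.toAddMonoidHom x) := by
  induction r using groth_induction with
  | add a a' h h' => simp only [map_add, AddMonoidHom.add_apply, h, h']
  | neg a h => simp only [map_neg, AddMonoidHom.neg_apply, h]
  | of s =>
    induction x using groth_induction with
    | add a a' h h' => simp only [map_add, h, h']
    | neg a h => simp only [map_neg, h]
    | of m => simp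

theorem grothSMul_one [Semiring S] [Module S M] (x : GrothendieckAddGroup M) :
    grothSMul (gOf (1 : S)) x = x := by
  induction x using groth_induction with
  | add a a' h h' => simp only [map_add, h, h']
  | neg a h => simp only [map_neg, h]
  | of m => simp

theorem grothSMul_comm [CommSemiring S] (a b : GrothendieckAddGroup S) :
    grothSMul a b = grothSMul b a := by
  induction a using groth_induction with
  | add a a' h h' => simp only [map_add, AddMonoidHom.add_apply, h, h']
  | neg a h => simp only [map_neg, AddMonoidHom.neg_apply, h]
  | of s =>
    induction b using groth_induction with
    | add a a' h h' => simp only [map_add, AddMonoidHom.add_apply, h, h']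
    | neg a h => simp only [map_neg, AddMonoidHom.neg_apply, h]
    | of t => simp [mul_comm]

end Grothendieck

section RepresentationRing

/-- A finite-dimensional complex representation of `Q`. -/
structure FinRep (Q : Type w) [Group Q] where
  carrier : Type v
  [addCommGroup : AddCommGroup carrier]
  [module : Module ℂ carrier]
  [finite : FiniteDimensional ℂ carrier]
  rep : Representation ℂ Q carrier

attribute [instance] FinRep.addCommGroup FinRep.module FinRep.finite

variable (Q : Type w) [Group Q]

instance FinRep.setoid : Setoid (FinRep.{v} Q) where
  r W W' := ∃ e : W.carrier ≃ₗ[ℂ] W'.carrier, ∀ q w, e (W.rep q w) = W'.rep q (e w)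
  iseqv :=
    { refl := fun W => ⟨LinearEquiv.refl _ _, fun _ _ => rfl⟩
      symm := fun {W W'} ⟨e, h⟩ => ⟨e.symm, fun q w => by
        apply e.injective; rw [h]; simp⟩
      trans := fun ⟨e, h⟩ ⟨e', h'⟩ => ⟨e.trans e', fun q w => by simp [h, h']⟩ }

/-- Isomorphism classes of finite-dimensional complex representations of `Q`. -/
def RepClass : Type (max w (v + 1)) := Quotient (FinRep.setoid.{v, w} Q)

variable {Q}

/-- Direct sum of representations. -/
abbrev FinRep.sum (W W' : FinRep.{v} Q) : FinRep.{v} Q where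
  carrier := W.carrier × W'.carrier
  rep := W.rep.prod W'.rep

/-- Tensor product of representations. -/
abbrev FinRep.tensor (W W' : FinRep.{v} Q) : FinRep.{v} Q where
  carrier := W.carrier ⊗[ℂ] W'.carrier
  rep := W.rep.tprod W'.rep

variable (Q) in
/-- The zero representation. -/
abbrev FinRep.zero : FinRep.{v} Q where
  carrier := PUnit.{v + 1}
  rep := 1

variable (Q) in
/-- The trivial one-dimensional representation. -/
abbrev FinRep.triv : FinRep.{v} Q where
  carrier := ULift.{v} ℂ
  rep := 1

theorem tmul_equiv_of_tmul {W W' F : Type*} [AddCommGroup W] [AddCommGroup W'] [AddCommGroup F]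
    [Module ℂ W] [Module ℂ W'] [Module ℂ F] {f g : W ⊗[ℂ] W' →ₗ[ℂ] F}
    (h : ∀ a b, f (a ⊗ₜ b) = g (a ⊗ₜ b)) (t : W ⊗[ℂ] W') : f t = g t :=
  DFunLike.congr_fun (TensorProduct.ext' h) t

instance : Zero (RepClass.{v} Q) := ⟨Quotient.mk _ (FinRep.zero Q)⟩
instance : One (RepClass.{v} Q) := ⟨Quotient.mk _ (FinRep.triv Q)⟩

instance : Add (RepClass.{v} Q) :=
  ⟨Quotient.map₂ FinRep.sum fun _ _ ⟨e, h⟩ _ _ ⟨e', h'⟩ =>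
    ⟨e.prodCongr e', fun q w => Prod.ext (h q w.1) (h' q w.2)⟩⟩

instance : Mul (RepClass.{v} Q) :=
  ⟨Quotient.map₂ FinRep.tensor fun W₁ W₂ ⟨e, h⟩ W₃ W₄ ⟨e', h'⟩ =>
    ⟨TensorProduct.congr e e', fun q w => tmul_equiv_of_tmul
      (f := (TensorProduct.congr e e').toLinearMap ∘ₗ (W₁.tensor W₃).rep q)
      (g := (W₂.tensor W₄).rep q ∘ₗ (TensorProduct.congr e e').toLinearMap)
      (fun a b => by simp [FinRep.tensor, h, h']) w⟩⟩

theorem RepClass.zero_mul' (a : RepClass.{v} Q) : 0 * a = 0 := by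
  induction a using Quotient.ind with
  | _ W =>
    refine Quotient.sound ⟨⟨0, 0, fun t => ?_, fun t => ?_⟩, fun q t => rfl⟩
    · exact tmul_equiv_of_tmul (W := PUnit) (f := 0) (g := LinearMap.id)
        (fun a b => by rw [Subsingleton.elim a 0]; simp) t
    · rfl

theorem RepClass.mul_comm' (a b : RepClass.{v} Q) : a * b = b * a := by
  induction a, b using Quotient.inductionOn₂ with
  | _ W W' =>
    exact Quotient.sound ⟨TensorProduct.comm ℂ _ _, fun q t => tmul_equiv_of_tmul
      (f := (TensorProduct.comm ℂ _ _).toLinearMap ∘ₗ (W.tensor W').rep q)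
      (g := (W'.tensor W).rep q ∘ₗ (TensorProduct.comm ℂ _ _).toLinearMap)
      (fun a b => by simp [FinRep.tensor]) t⟩

theorem RepClass.mul_add' (a b c : RepClass.{v} Q) : a * (b + c) = a * b + a * c := by
  induction a, b, c using Quotient.inductionOn₃ with
  | _ W W' W'' =>
    exact Quotient.sound ⟨TensorProduct.prodRight ℂ ℂ _ _ _, fun q t => tmul_equiv_of_tmul
      (f := (TensorProduct.prodRight ℂ ℂ W.carrier W'.carrier W''.carrier).toLinearMap
        ∘ₗ (W.tensor (W'.sum W'')).rep q)
      (g := ((W.tensor W').sum (W.tensor W'')).rep q ∘ₗ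
        (TensorProduct.prodRight ℂ ℂ W.carrier W'.carrier W''.carrier).toLinearMap)
      (fun a b => by simp [FinRep.tensor, FinRep.sum]) t⟩

theorem RepClass.one_mul' (a : RepClass.{v} Q) : 1 * a = a := by
  induction a using Quotient.ind with
  | _ W =>
    let e : (ULift.{v} ℂ) ⊗[ℂ] W.carrier ≃ₗ[ℂ] W.carrier :=
      (TensorProduct.congr ULift.moduleEquiv (LinearEquiv.refl _ _)).trans
        (TensorProduct.lid ℂ _)
    exact Quotient.sound ⟨e, fun q t => tmul_equiv_of_tmul
      (f := e.toLinearMap ∘ₗ ((FinRep.triv Q).tensor W).rep q)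
      (g := W.rep q ∘ₗ e.toLinearMap)
      (fun a b => by simp [FinRep.tensor, FinRep.triv, e]) t⟩

theorem RepClass.mul_assoc' (a b c : RepClass.{v} Q) : a * b * c = a * (b * c) := by
  induction a, b, c using Quotient.inductionOn₃ with
  | _ W W' W'' =>
    refine Quotient.sound ⟨TensorProduct.assoc ℂ _ _ _, fun q t => ?_⟩
    refine DFunLike.congr_fun (f := (TensorProduct.assoc ℂ _ _ _).toLinearMap ∘ₗ
      ((W.tensor W').tensor W'').rep q) (g := (W.tensor (W'.tensor W'')).rep q ∘ₗ
      (TensorProduct.assoc ℂ _ _ _).toLinearMap) ?_ t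
    refine TensorProduct.ext_threefold fun a b c => ?_
    simp [FinRep.tensor]

instance : CommSemiring (RepClass.{v} Q) where
  add_assoc a b c := by
    induction a, b, c using Quotient.inductionOn₃ with
    | _ W W' W'' => exact Quotient.sound ⟨LinearEquiv.prodAssoc ℂ _ _ _, fun _ _ => rfl⟩
  zero_add a := by
    induction a using Quotient.ind with
    | _ W => exact Quotient.sound ⟨LinearEquiv.uniqueProd, fun _ _ => rfl⟩
  add_zero a := by
    induction a using Quotient.ind with
    | _ W => exact Quotient.sound ⟨LinearEquiv.prodUnique, fun _ _ => rfl⟩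
  add_comm a b := by
    induction a, b using Quotient.inductionOn₂ with
    | _ W W' => exact Quotient.sound ⟨LinearEquiv.prodComm ℂ _ _, fun _ _ => rfl⟩
  nsmul := nsmulRec
  left_distrib := RepClass.mul_add'
  right_distrib a b c := by
    rw [RepClass.mul_comm', RepClass.mul_add', RepClass.mul_comm' c, RepClass.mul_comm' c]
  zero_mul := RepClass.zero_mul'
  mul_zero a := by rw [RepClass.mul_comm', RepClass.zero_mul']
  mul_assoc := RepClass.mul_assoc'
  one_mul := RepClass.one_mul'
  mul_one a := by rw [RepClass.mul_comm', RepClass.one_mul']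
  mul_comm := RepClass.mul_comm'

variable (Q) in
/-- The complex representation ring `R(Q)`: the Grothendieck ring of the semiring of isomorphism
classes of finite-dimensional complex representations, with direct sum and tensor product. -/
def RepRing : Type (max w (v + 1)) := Algebra.GrothendieckAddGroup (RepClass.{v} Q)

instance : AddCommGroup (RepRing.{v} Q) :=
  inferInstanceAs (AddCommGroup (Algebra.GrothendieckAddGroup (RepClass.{v} Q)))

instance : CommRing (RepRing.{v} Q) :=
  { (inferInstance : AddCommGroup (RepRing.{v} Q)) with
    mul := fun a b => grothSMul a b
    one := gOf (1 : RepClass.{v} Q)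
    mul_assoc := grothSMul_assoc
    one_mul := grothSMul_one
    mul_one := fun a => (grothSMul_comm _ _).trans (grothSMul_one a)
    left_distrib := fun a b c => map_add (grothSMul a) b c
    right_distrib := fun a b c => DFunLike.congr_fun
      ((grothSMul (S := RepClass.{v} Q) (M := RepClass.{v} Q)).map_add a b) c
    zero_mul := fun a => DFunLike.congr_fun
      ((grothSMul (S := RepClass.{v} Q) (M := RepClass.{v} Q)).map_zero) a
    mul_zero := fun a => map_zero (grothSMul a)
    mul_comm := grothSMul_comm }

/-- The Grothendieck group of an `S`-semimodule is a module over the Grothendieck ring; here for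
the semiring of classes of representations. -/
abbrev grothModule (M : Type u) [AddCommMonoid M] [Module (RepClass.{v} Q) M] :
    Module (RepRing.{v} Q) (Algebra.GrothendieckAddGroup M) where
  smul a x := grothSMul (S := RepClass.{v} Q) a x
  one_smul := grothSMul_one
  mul_smul := grothSMul_assoc
  smul_zero a := map_zero (grothSMul a)
  smul_add a := map_add (grothSMul a)
  add_smul a b x := DFunLike.congr_fun
    ((grothSMul (S := RepClass.{v} Q) (M := M)).map_add a b) x
  zero_smul x := DFunLike.congr_fun ((grothSMul (S := RepClass.{v} Q) (M := M)).map_zero) x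

end RepresentationRing

section Families

variable {Γ : Type w'} [Group Γ] {Q : Type w} [Group Q]

/-- Let `p : Γ → Q` be a homomorphism of groups and `X` a `Q`-space, regarded as a `Γ`-space
through `p`.  A `Γ`-equivariant family of complex vector spaces over `X`: a topology on the
disjoint union of complex vector spaces `fiber x`, and a fibrewise linear action of `Γ` covering
the action on `X`.  The element `γ` maps the fibre at `x` to the fibre at `y = γ x`; to avoid
transports, `y` is a variable and `γ x = y` a hypothesis. -/
structure Family (p : Γ →* Q) (X : Type u) [MulAction Q X] where
  fiber : X → Type v
  [addCommGroup : ∀ x, AddCommGroup (fiber x)]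
  [module : ∀ x, Module ℂ (fiber x)]
  top : TopologicalSpace (Σ x, fiber x)
  act : ∀ (γ : Γ) {x y : X}, p γ • x = y → (fiber x →ₗ[ℂ] fiber y)
  act_one : ∀ {x : X} (h : p 1 • x = x) (e : fiber x), act 1 h e = e
  act_mul : ∀ (γ δ : Γ) {x y z : X} (h₁ : p δ • x = y) (h₂ : p γ • y = z)
    (h₃ : p (γ * δ) • x = z) (e : fiber x), act (γ * δ) h₃ e = act γ h₂ (act δ h₁ e)

attribute [instance] Family.addCommGroup Family.module

variable {p : Γ →* Q} {X : Type u} [MulAction Q X]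

namespace Family

/-- The total space of a family. -/
def Tot (E : Family.{u, v} p X) : Type (max u v) := Σ x, E.fiber x

instance (E : Family.{u, v} p X) : TopologicalSpace E.Tot := E.top

/-- The point of the total space given by a vector in a fibre. -/
def pt (E : Family.{u, v} p X) (x : X) (e : E.fiber x) : E.Tot := ⟨x, e⟩

/-- The projection to the base. -/
def proj (E : Family.{u, v} p X) (t : E.Tot) : X := t.1

/-- The vector part of a point of the total space. -/
def vec (E : Family.{u, v} p X) (t : E.Tot) : E.fiber (E.proj t) := t.2

/-- The action of `Γ` on the total space. -/
def totAct (E : Family.{u, v} p X) (t : Γ × E.Tot) : E.Tot :=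
  ⟨p t.1 • t.2.1, E.act t.1 rfl t.2.2⟩

/-- The family is a (finite-dimensional, locally trivial) `Γ`-equivariant complex vector bundle.
The rank may vary from one component of the base to another. -/
structure IsVectorBundle [TopologicalSpace Γ] [TopologicalSpace X] (E : Family.{u, v} p X) :
    Prop where
  continuous_proj : Continuous E.proj
  locally_trivial : ∀ x : X, ∃ U : Set X, IsOpen U ∧ x ∈ U ∧
    ∃ (ι : Type) (_ : Fintype ι) (φ : ∀ y : U, E.fiber y ≃ₗ[ℂ] (ι → ℂ)),
      Continuous (fun t : {t : E.Tot // E.proj t ∈ U} => φ ⟨E.proj t, t.2⟩ (E.vec t)) ∧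
      Continuous (fun s : U × (ι → ℂ) => E.pt s.1 ((φ s.1).symm s.2))
  continuous_act : Continuous E.totAct

/-- The fibrewise linear map of total spaces. -/
def totMap {E F : Family.{u, v} p X} (f : ∀ x, E.fiber x →ₗ[ℂ] F.fiber x) (t : E.Tot) : F.Tot :=
  ⟨t.1, f t.1 t.2⟩

/-- Isomorphism of `Γ`-equivariant families: a `Γ`-equivariant homeomorphism over `X` which is
linear on the fibres. -/
def Iso (E F : Family.{u, v} p X) : Prop :=
  ∃ e : ∀ x, E.fiber x ≃ₗ[ℂ] F.fiber x,
    (∀ (γ : Γ) (x y : X) (h : p γ • x = y) (a : E.fiber x),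
      e y (E.act γ h a) = F.act γ h (e x a)) ∧
    Continuous (totMap fun x => (e x).toLinearMap) ∧
    Continuous (totMap fun x => (e x).symm.toLinearMap)

theorem Iso.refl (E : Family.{u, v} p X) : E.Iso E :=
  ⟨fun _ => LinearEquiv.refl _ _, fun _ _ _ _ _ => rfl, continuous_id, continuous_id⟩

theorem Iso.symm {E F : Family.{u, v} p X} : E.Iso F → F.Iso E := fun ⟨e, h, h₁, h₂⟩ =>
  ⟨fun x => (e x).symm, fun γ x y hxy a => by apply (e y).injective; rw [h]; simp, h₂, h₁⟩

theorem Iso.trans {E F H : Family.{u, v} p X} : E.Iso F → F.Iso H → E.Iso H :=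
  fun ⟨e, h, h₁, h₂⟩ ⟨e', h', h₁', h₂'⟩ =>
  ⟨fun x => (e x).trans (e' x), fun γ x y hxy a => by simp [h, h'],
    h₁'.comp h₁, h₂.comp h₂'⟩

section Topological

variable [TopologicalSpace Γ] [TopologicalSpace X]

/-- A continuous, fibrewise bijective morphism of vector bundles is an isomorphism. -/
theorem iso_of_continuous {E F : Family.{u, v} p X} (hE : E.IsVectorBundle)
    (hF : F.IsVectorBundle) (e : ∀ x, E.fiber x ≃ₗ[ℂ] F.fiber x)
    (he : ∀ (γ : Γ) (x y : X) (h : p γ • x = y) (a : E.fiber x),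
      e y (E.act γ h a) = F.act γ h (e x a))
    (hc : Continuous (totMap (E := E) (F := F) fun x => (e x).toLinearMap)) : E.Iso F := by
  refine ⟨e, he, hc, continuous_iff_continuousAt.2 fun t₀ => ?_⟩
  obtain ⟨U, hU, hxU, ι, _, φ, hφ, hφ'⟩ := hE.locally_trivial t₀.1
  obtain ⟨U', hU', hxU', κ, _, ψ, hψ, hψ'⟩ := hF.locally_trivial t₀.1
  have hN : IsOpen (U ∩ U') := hU.inter hU'
  let T := {t : F.Tot // F.proj t ∈ U ∩ U'}
  have hT : IsOpen {t : F.Tot | F.proj t ∈ U ∩ U'} := hN.preimage hF.continuous_proj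
  let i : ↥(U ∩ U') → U := fun y => ⟨y, y.2.1⟩
  let j : ↥(U ∩ U') → U' := fun y => ⟨y, y.2.2⟩
  have hi : Continuous i := by fun_prop
  have hj : Continuous j := by fun_prop
  let B : ↥(U ∩ U') → ((ι → ℂ) ≃L[ℂ] (κ → ℂ)) := fun y =>
    (((φ (i y)).symm.trans (e y)).trans (ψ (j y))).toContinuousLinearEquiv
  have hB : Continuous fun y => (B y : (ι → ℂ) →L[ℂ] (κ → ℂ)) := by
    rw [continuous_clm_apply]
    intro c
    have h₁ : Continuous fun y : ↥(U ∩ U') => E.pt y ((φ (i y)).symm c) :=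
      hφ'.comp (hi.prodMk continuous_const)
    have h₂ := hc.comp h₁
    exact hψ.comp (h₂.subtype_mk fun y => y.2.2)
  have hB' : Continuous fun y => ((B y).symm : (κ → ℂ) →L[ℂ] (ι → ℂ)) := by
    have : (fun y => ((B y).symm : (κ → ℂ) →L[ℂ] (ι → ℂ)))
        = fun y => ContinuousLinearMap.inverse (B y : (ι → ℂ) →L[ℂ] (κ → ℂ)) := by
      ext1 y; simp
    rw [this]
    refine continuous_iff_continuousAt.2 fun y => ?_
    have := (contDiffAt_map_inverse (𝕜 := ℂ) (n := 0) (B y)).continuousAt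
    exact ContinuousAt.comp (f := fun y => (B y : (ι → ℂ) →L[ℂ] (κ → ℂ))) this hB.continuousAt
  let pr : T → ↥(U ∩ U') := fun t => ⟨t.1.1, t.2⟩
  have hpr : Continuous pr :=
    (hF.continuous_proj.comp continuous_subtype_val).subtype_mk _
  have hψT : Continuous fun t : T => ψ (j (pr t)) t.1.2 :=
    hψ.comp (continuous_subtype_val.subtype_mk fun t : T => t.2.2)
  have key : Continuous fun t : T =>
      E.pt t.1.1 ((φ (i (pr t))).symm ((B (pr t)).symm (ψ (j (pr t)) t.1.2))) :=
    hφ'.comp ((hi.comp hpr).prodMk ((hB'.comp hpr).clm_apply hψT))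
  have key' : (fun t : T => totMap (E := F) (F := E) (fun x => (e x).symm.toLinearMap) t.1)
      = fun t : T =>
      E.pt t.1.1 ((φ (i (pr t))).symm ((B (pr t)).symm (ψ (j (pr t)) t.1.2))) := by
    ext1 t
    have : (φ (i (pr t))).symm ((B (pr t)).symm (ψ (j (pr t)) t.1.2)) = (e t.1.1).symm t.1.2 := by
      apply (φ (i (pr t))).injective
      rw [LinearEquiv.apply_symm_apply]
      apply (B (pr t)).injective
      rw [ContinuousLinearEquiv.apply_symm_apply]
      simp [B, i, pr]
    rw [this]; rfl
  rw [← key'] at key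
  exact (hT.isOpenEmbedding_subtypeVal.continuousAt_iff (x := ⟨t₀, hxU, hxU'⟩)).1
    key.continuousAt

end Topological

/-- The action of the kernel of `p` on the fibre at `x`. -/
def kerRep (E : Family.{u, v} p X) (x : X) : Representation ℂ p.ker (E.fiber x) where
  toFun k := E.act (k : Γ) (by rw [k.2, one_smul])
  map_one' := by ext a; exact E.act_one _ a
  map_mul' k l := by ext a; exact E.act_mul _ _ _ _ _ a

/-- The zero family. -/
def zero (p : Γ →* Q) (X : Type u) [MulAction Q X] [TopologicalSpace X] : Family.{u, v} p X where
  fiber _ := PUnit.{v + 1}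
  top := TopologicalSpace.induced (fun t => t.1) inferInstance
  act _ _ _ _ := 0
  act_one _ _ := rfl
  act_mul _ _ _ _ _ _ _ _ _ := rfl

/-- The fibrewise direct sum. -/
def sum (E F : Family.{u, v} p X) : Family.{u, v} p X where
  fiber x := E.fiber x × F.fiber x
  top := TopologicalSpace.induced
    (fun t => (E.pt t.1 t.2.1, F.pt t.1 t.2.2)) inferInstance
  act γ _ _ h := (E.act γ h).prodMap (F.act γ h)
  act_one h e := Prod.ext (E.act_one h e.1) (F.act_one h e.2)
  act_mul γ δ _ _ _ h₁ h₂ h₃ e :=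
    Prod.ext (E.act_mul γ δ h₁ h₂ h₃ e.1) (F.act_mul γ δ h₁ h₂ h₃ e.2)

/-- Contraction of `W ⊗ F` with a linear form on `W`. -/
def contract {W F : Type v} [AddCommGroup W] [Module ℂ W] [AddCommGroup F] [Module ℂ F]
    (φ : Module.Dual ℂ W) : W ⊗[ℂ] F →ₗ[ℂ] F :=
  (TensorProduct.lid ℂ F).toLinearMap ∘ₗ LinearMap.rTensor F φ

@[simp] theorem contract_tmul {W F : Type v} [AddCommGroup W] [Module ℂ W] [AddCommGroup F]
    [Module ℂ F] (φ : Module.Dual ℂ W) (a : W) (b : F) : contract φ (a ⊗ₜ[ℂ] b) = φ a • b := by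
  simp [contract]

/-- The tensor product of a family with a representation `W` of `Q`.  Its total space carries the
coarsest topology for which the projection to `X` and the contractions with the linear forms on
`W` are continuous (for bundles, and `W` with a basis of `n` elements, this is the topology of the
`n`-fold direct sum). -/
def tensor (W : FinRep.{v} Q) (E : Family.{u, v} p X) [TopologicalSpace X] :
    Family.{u, v} p X where
  fiber x := W.carrier ⊗[ℂ] E.fiber x
  top := TopologicalSpace.induced
    (fun t => (t.1, fun φ : Module.Dual ℂ W.carrier => E.pt t.1 (contract φ t.2))) inferInstance
  act γ _ _ h := TensorProduct.map (W.rep (p γ)) (E.act γ h)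
  act_one {x} h e := by
    refine tmul_equiv_of_tmul (g := LinearMap.id) (fun a b => ?_) e
    rw [TensorProduct.map_tmul, E.act_one, map_one, map_one]; rfl
  act_mul γ δ x y z h₁ h₂ h₃ e := by
    refine tmul_equiv_of_tmul (g := TensorProduct.map (W.rep (p γ)) (E.act γ h₂) ∘ₗ
      TensorProduct.map (W.rep (p δ)) (E.act δ h₁)) (fun a b => ?_) e
    rw [TensorProduct.map_tmul, E.act_mul γ δ h₁ h₂ h₃, map_mul, map_mul]; rfl

end Family

/-- A continuous `Q`-equivariant map. -/
structure EqMap (Q : Type w) [Group Q] (X Y : Type u) [MulAction Q X] [MulAction Q Y]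
    [TopologicalSpace X] [TopologicalSpace Y] where
  toFun : X → Y
  continuous : Continuous toFun
  map_smul : ∀ (q : Q) (x : X), toFun (q • x) = q • toFun x

/-- The pullback of a family along an equivariant map. -/
def Family.pullback {Y : Type u} [MulAction Q Y] [TopologicalSpace X] [TopologicalSpace Y]
    (f : EqMap Q X Y) (E : Family.{u, v} p Y) : Family.{u, v} p X where
  fiber x := E.fiber (f.toFun x)
  top := TopologicalSpace.induced
    (fun t => (t.1, E.pt (f.toFun t.1) t.2)) inferInstance
  act γ _ _ h := E.act γ (by rw [← f.map_smul, h])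
  act_one _ e := E.act_one _ e
  act_mul γ δ _ _ _ h₁ h₂ h₃ e := E.act_mul γ δ _ _ _ e

namespace Family

theorem isInducing_zero [TopologicalSpace X] :
    IsInducing (zero.{u, v} p X).proj := ⟨rfl⟩

theorem isInducing_sum (E F : Family.{u, v} p X) :
    IsInducing fun t : (E.sum F).Tot => (E.pt t.1 t.2.1, F.pt t.1 t.2.2) := ⟨rfl⟩

theorem isInducing_tensor [TopologicalSpace X] (W : FinRep.{v} Q) (E : Family.{u, v} p X) :
    IsInducing fun t : (E.tensor W).Tot =>
      (t.1, fun φ : Module.Dual ℂ W.carrier => E.pt t.1 (contract φ t.2)) := ⟨rfl⟩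

theorem isInducing_pullback {Y : Type u} [MulAction Q Y] [TopologicalSpace X]
    [TopologicalSpace Y]
    (f : EqMap Q X Y) (E : Family.{u, v} p Y) :
    IsInducing fun t : (E.pullback f).Tot => (t.1, E.pt (f.toFun t.1) t.2) := ⟨rfl⟩

theorem continuous_sum_fst (E F : Family.{u, v} p X) :
    Continuous fun t : (E.sum F).Tot => E.pt t.1 t.2.1 :=
  continuous_fst.comp (isInducing_sum E F).continuous

theorem continuous_sum_snd (E F : Family.{u, v} p X) :
    Continuous fun t : (E.sum F).Tot => F.pt t.1 t.2.2 :=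
  continuous_snd.comp (isInducing_sum E F).continuous

theorem continuous_tensor_fst [TopologicalSpace X] (W : FinRep.{v} Q) (E : Family.{u, v} p X) :
    Continuous (E.tensor W).proj :=
  continuous_fst.comp (isInducing_tensor W E).continuous

theorem continuous_tensor_contract [TopologicalSpace X] (W : FinRep.{v} Q) (E : Family.{u, v} p X)
    (φ : Module.Dual ℂ W.carrier) :
    Continuous fun t : (E.tensor W).Tot => E.pt t.1 (contract φ t.2) :=
  (continuous_apply φ).comp (continuous_snd.comp (isInducing_tensor W E).continuous)

theorem sum_contract {W F : Type v} {κ : Type*} [Fintype κ] [AddCommGroup W] [Module ℂ W]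
    [AddCommGroup F] [Module ℂ F] (b : Module.Basis κ ℂ W) (t : W ⊗[ℂ] F) :
    ∑ k, b k ⊗ₜ[ℂ] contract (b.coord k) t = t := by
  have := tmul_equiv_of_tmul (g := LinearMap.id)
    (f := ∑ k, (TensorProduct.mk ℂ W F (b k)) ∘ₗ contract (b.coord k)) (fun w e => by
      simp only [LinearMap.sum_apply, LinearMap.comp_apply, contract_tmul,
        TensorProduct.mk_apply, LinearMap.id_apply, ← TensorProduct.smul_tmul,
        ← TensorProduct.sum_tmul]
      congr 1
      exact b.sum_repr w) t
  simpa using this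

theorem contract_sum {W F : Type v} {κ : Type*} [Fintype κ] [AddCommGroup W] [Module ℂ W]
    [AddCommGroup F] [Module ℂ F] (b : Module.Basis κ ℂ W) (c : κ → F) (k : κ) :
    contract (b.coord k) (∑ l, b l ⊗ₜ[ℂ] c l) = c k := by
  classical
  simp [Finsupp.single_apply]

/-- Coordinates on `W ⊗ F` from bases. -/
def tensorEquiv {W F : Type v} {κ ι : Type*} [Fintype κ] [AddCommGroup W] [Module ℂ W]
    [AddCommGroup F] [Module ℂ F] (b : Module.Basis κ ℂ W) (φ : F ≃ₗ[ℂ] (ι → ℂ)) :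
    W ⊗[ℂ] F ≃ₗ[ℂ] (κ × ι → ℂ) where
  toFun t s := φ (contract (b.coord s.1) t) s.2
  map_add' t t' := by ext; simp
  map_smul' c t := by ext; simp
  invFun c := ∑ k, b k ⊗ₜ[ℂ] φ.symm fun i => c (k, i)
  left_inv t := by
    simpa using sum_contract b t
  right_inv c := by
    ext s
    simp only [contract_sum b, LinearEquiv.apply_symm_apply]

end Family

section Operations

variable [TopologicalSpace Γ] [TopologicalSpace X]

theorem continuous_of_locallyConstant {S T : Type*} [TopologicalSpace S] [TopologicalSpace T]
    (hp : IsLocallyConstant p) (F : Q → Γ × S → T) (hF : ∀ q, Continuous (F q)) :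
    Continuous fun s : Γ × S => F (p s.1) s := by
  refine continuous_iff_continuousAt.2 fun s => ?_
  have h : ∀ᶠ s' in 𝓝 s, p s'.1 = p s.1 :=
    continuous_fst.continuousAt.eventually (hp.eventually_eq s.1)
  refine (hF (p s.1)).continuousAt.congr ?_
  filter_upwards [h] with s' hs'
  rw [hs']

namespace Family

theorem continuous_baseAct [ContinuousConstSMul Q X] (hp : IsLocallyConstant p) :
    Continuous fun s : Γ × X => p s.1 • s.2 :=
  continuous_of_locallyConstant hp (fun q s => q • s.2) fun q => by fun_prop

theorem isVectorBundle_zero [ContinuousConstSMul Q X] (hp : IsLocallyConstant p) :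
    (zero.{u, v} p X).IsVectorBundle where
  continuous_proj := isInducing_zero.continuous
  locally_trivial x := by
    refine ⟨Set.univ, isOpen_univ, trivial, Empty, inferInstance, fun y =>
      { toFun := fun _ => 0
        map_add' := fun _ _ => Subsingleton.elim _ _
        map_smul' := fun _ _ => Subsingleton.elim _ _
        invFun := fun _ => PUnit.unit
        left_inv := fun _ => rfl
        right_inv := fun _ => Subsingleton.elim _ _ }, ?_, ?_⟩
    · exact continuous_pi fun i => i.elim
    · exact isInducing_zero.continuous_iff.2 (continuous_subtype_val.comp continuous_fst)
  continuous_act := isInducing_zero.continuous_iff.2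
    ((continuous_baseAct hp).comp (continuous_fst.prodMk
      (isInducing_zero.continuous.comp continuous_snd)))

theorem IsVectorBundle.sum {E F : Family.{u, v} p X} (hE : E.IsVectorBundle)
    (hF : F.IsVectorBundle) : (E.sum F).IsVectorBundle where
  continuous_proj := hE.continuous_proj.comp (continuous_sum_fst E F)
  locally_trivial x := by
    obtain ⟨U, hU, hxU, ι, _, φ, hφ, hφ'⟩ := hE.locally_trivial x
    obtain ⟨U', hU', hxU', κ, _, ψ, hψ, hψ'⟩ := hF.locally_trivial x
    refine ⟨U ∩ U', hU.inter hU', ⟨hxU, hxU'⟩, ι ⊕ κ, inferInstance, fun y =>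
      ((φ ⟨y, y.2.1⟩).prodCongr (ψ ⟨y, y.2.2⟩)).trans
        (LinearEquiv.sumArrowLequivProdArrow ι κ ℂ ℂ).symm, ?_, ?_⟩
    · refine continuous_pi fun i => ?_
      rcases i with i | i
      · exact (continuous_apply i).comp (hφ.comp
          (((continuous_sum_fst E F).comp continuous_subtype_val).subtype_mk fun t => t.2.1))
      · exact (continuous_apply i).comp (hψ.comp
          (((continuous_sum_snd E F).comp continuous_subtype_val).subtype_mk fun t => t.2.2))
    · refine (isInducing_sum E F).continuous_iff.2 (Continuous.prodMk ?_ ?_)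
      · exact hφ'.comp (Continuous.prodMk
          (f := fun s : ↥(U ∩ U') × (ι ⊕ κ → ℂ) => (⟨s.1.1, s.1.2.1⟩ : U))
          (g := fun s i => s.2 (Sum.inl i)) (by fun_prop) (by fun_prop))
      · exact hψ'.comp (Continuous.prodMk
          (f := fun s : ↥(U ∩ U') × (ι ⊕ κ → ℂ) => (⟨s.1.1, s.1.2.2⟩ : U'))
          (g := fun s i => s.2 (Sum.inr i)) (by fun_prop) (by fun_prop))
  continuous_act := (isInducing_sum E F).continuous_iff.2 (Continuous.prodMk
    (hE.continuous_act.comp (continuous_fst.prodMk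
      ((continuous_sum_fst E F).comp continuous_snd)))
    (hF.continuous_act.comp (continuous_fst.prodMk
      ((continuous_sum_snd E F).comp continuous_snd))))

theorem IsVectorBundle.tensor (W : FinRep.{v} Q) {E : Family.{u, v} p X}
    [ContinuousConstSMul Q X] (hp : IsLocallyConstant p)
    (hE : E.IsVectorBundle) : (E.tensor W).IsVectorBundle where
  continuous_proj := continuous_tensor_fst W E
  locally_trivial x := by
    obtain ⟨U, hU, hxU, ι, _, φ, hφ, hφ'⟩ := hE.locally_trivial x
    let b := Module.finBasis ℂ W.carrier
    refine ⟨U, hU, hxU, Fin (Module.finrank ℂ W.carrier) × ι, inferInstance, fun y =>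
      tensorEquiv b (φ y), ?_, ?_⟩
    · refine continuous_pi fun s => ?_
      exact (continuous_apply s.2).comp (hφ.comp
        (((continuous_tensor_contract W E (b.coord s.1)).comp
          continuous_subtype_val).subtype_mk fun t => t.2))
    · refine (isInducing_tensor W E).continuous_iff.2 (Continuous.prodMk ?_ ?_)
      · exact continuous_subtype_val.comp continuous_fst
      · refine continuous_pi fun ψ => ?_
        have hs : Continuous fun s : U × (Fin (Module.finrank ℂ W.carrier) × ι → ℂ) =>
            fun i => ∑ k, ψ (b k) * s.2 (k, i) :=
          continuous_pi fun i => continuous_finsetSum _ fun k _ => continuous_const.mul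
            ((continuous_apply (k, i)).comp continuous_snd)
        have : Continuous fun s : U × (Fin (Module.finrank ℂ W.carrier) × ι → ℂ) =>
            E.pt s.1 ((φ s.1).symm (fun i => ∑ k, ψ (b k) * s.2 (k, i))) :=
          hφ'.comp (Continuous.prodMk continuous_fst hs)
        convert this using 2 with s
        change E.pt s.1 (contract ψ (∑ k, b k ⊗ₜ[ℂ] (φ s.1).symm fun i => s.2 (k, i))) = _
        congr 1
        apply (φ s.1).injective
        ext i
        simp
  continuous_act := by
    refine (isInducing_tensor W E).continuous_iff.2 (Continuous.prodMk ?_ ?_)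
    · exact (continuous_baseAct hp).comp
        (continuous_fst.prodMk ((continuous_tensor_fst W E).comp continuous_snd))
    · refine continuous_pi fun φ => ?_
      have := continuous_of_locallyConstant hp (S := (E.tensor W).Tot)
        (fun q s => E.totAct (s.1, E.pt s.2.1 (contract (φ ∘ₗ W.rep q) s.2.2)))
        (fun q => hE.continuous_act.comp (continuous_fst.prodMk
          ((continuous_tensor_contract W E _).comp continuous_snd)))
      convert this using 2 with s
      refine congrArg (E.pt _) ?_
      exact tmul_equiv_of_tmul
        (f := contract φ ∘ₗ TensorProduct.map (W.rep (p s.1)) (E.act s.1 rfl))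
        (g := E.act s.1 rfl ∘ₗ contract (φ ∘ₗ W.rep (p s.1)))
        (fun a b => by simp) s.2.2

theorem IsVectorBundle.pullback {Y : Type u} [MulAction Q Y] [TopologicalSpace Y]
    [ContinuousConstSMul Q X] (hp : IsLocallyConstant p) (f : EqMap Q X Y)
    {E : Family.{u, v} p Y} (hE : E.IsVectorBundle) : (E.pullback f).IsVectorBundle where
  continuous_proj := continuous_fst.comp (isInducing_pullback f E).continuous
  locally_trivial x := by
    obtain ⟨U, hU, hxU, ι, _, φ, hφ, hφ'⟩ := hE.locally_trivial (f.toFun x)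
    refine ⟨f.toFun ⁻¹' U, hU.preimage f.continuous, hxU, ι, inferInstance,
      fun y => φ ⟨f.toFun y, y.2⟩, ?_, ?_⟩
    · exact hφ.comp (((continuous_snd.comp (isInducing_pullback f E).continuous).comp
        continuous_subtype_val).subtype_mk fun t => t.2)
    · refine (isInducing_pullback f E).continuous_iff.2 (Continuous.prodMk
        (continuous_subtype_val.comp continuous_fst) ?_)
      exact hφ'.comp (Continuous.prodMk
        (((f.continuous.comp continuous_subtype_val).comp continuous_fst).subtype_mk
          fun s : ↥(f.toFun ⁻¹' U) × (ι → ℂ) => s.1.2) continuous_snd)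
  continuous_act := by
    refine (isInducing_pullback f E).continuous_iff.2 (Continuous.prodMk ?_ ?_)
    · exact (continuous_baseAct hp).comp (continuous_fst.prodMk
        ((continuous_fst.comp (isInducing_pullback f E).continuous).comp continuous_snd))
    · have := hE.continuous_act.comp (continuous_fst.prodMk
        ((continuous_snd.comp (isInducing_pullback f E).continuous).comp
          (continuous_snd (X := Γ))))
      convert this using 2 with s
      have key : ∀ (y : Y) (h₁ : p s.1 • f.toFun s.2.1 = y),
          E.pt y (E.act s.1 h₁ s.2.2) = E.totAct (s.1, E.pt (f.toFun s.2.1) s.2.2) := by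
        rintro y rfl; rfl
      exact key _ _

end Family

end Operations

end Families

section KTheory

/-- The data selecting a type of equivariant bundles over `Q`-spaces: a topological group `grp`
with a locally constant homomorphism to `Q` (through which it acts on `Q`-spaces), and a condition
on the representation of the kernel on the fibres, stable under direct sums and under tensor
products with trivial representations. -/
structure Kind (Q : Type w) [Group Q] where
  grp : Type w'
  [group : Group grp]
  [top : TopologicalSpace grp]
  proj : grp →* Q
  locConst : IsLocallyConstant proj
  cond : ∀ (F : Type v) [AddCommGroup F] [Module ℂ F], Representation ℂ proj.ker F → Prop
  cond_zero : ∀ σ : Representation ℂ proj.ker PUnit.{v + 1}, cond PUnit σ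
  cond_sum : ∀ (F F' : Type v) [AddCommGroup F] [Module ℂ F] [AddCommGroup F'] [Module ℂ F']
    (σ : Representation ℂ proj.ker F) (σ' : Representation ℂ proj.ker F'),
    cond F σ → cond F' σ' → cond (F × F') (σ.prod σ')
  cond_tensor : ∀ (W F : Type v) [AddCommGroup W] [Module ℂ W] [FiniteDimensional ℂ W]
    [AddCommGroup F] [Module ℂ F] (σ : Representation ℂ proj.ker F),
    cond F σ → cond (W ⊗[ℂ] F) (Representation.tprod 1 σ)

attribute [instance] Kind.group Kind.top

variable {Q : Type w} [Group Q]

/-- An equivariant vector bundle over `X` of the given kind. -/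
structure Bundle (𝒯 : Kind.{v, w, w'} Q) (X : Type u) [TopologicalSpace X] [MulAction Q X] where
  fam : Family.{u, v} 𝒯.proj X
  isVB : fam.IsVectorBundle
  cond : ∀ x, 𝒯.cond (fam.fiber x) (fam.kerRep x)

instance Bundle.setoid (𝒯 : Kind.{v, w, w'} Q) (X : Type u) [TopologicalSpace X]
    [MulAction Q X] : Setoid (Bundle.{u, v} 𝒯 X) where
  r E F := E.fam.Iso F.fam
  iseqv := ⟨fun E => Family.Iso.refl _, Family.Iso.symm, Family.Iso.trans⟩

/-- The set of isomorphism classes of bundles of the given kind. -/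
def Vec (𝒯 : Kind.{v, w, w'} Q) (X : Type u) [TopologicalSpace X] [MulAction Q X] :
    Type (max u (v + 1) w') :=
  Quotient (Bundle.setoid.{u, v} 𝒯 X)

variable (𝒯 : Kind.{v, w, w'} Q)

namespace Bundle

section
variable {𝒯}
variable {X : Type u} [TopologicalSpace X] [MulAction Q X]

/-- The class of a bundle. -/
def cls (E : Bundle.{u, v} 𝒯 X) : Vec 𝒯 X := Quotient.mk _ E

theorem cls_eq {E F : Bundle.{u, v} 𝒯 X} (e : ∀ x, E.fam.fiber x ≃ₗ[ℂ] F.fam.fiber x)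
    (he : ∀ (γ : 𝒯.grp) (x y : X) (h : 𝒯.proj γ • x = y) (a : E.fam.fiber x),
      e y (E.fam.act γ h a) = F.fam.act γ h (e x a))
    (hc : Continuous (Family.totMap (E := E.fam) (F := F.fam) fun x => (e x).toLinearMap)) :
    E.cls = F.cls :=
  Quotient.sound (Family.iso_of_continuous E.isVB F.isVB e he hc)

/-- Whitney sum. -/
def sum (E F : Bundle.{u, v} 𝒯 X) : Bundle.{u, v} 𝒯 X where
  fam := E.fam.sum F.fam
  isVB := E.isVB.sum F.isVB
  cond x := 𝒯.cond_sum _ _ _ _ (E.cond x) (F.cond x)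

variable [ContinuousConstSMul Q X]

variable (𝒯 X) in
/-- The zero bundle. -/
def zero : Bundle.{u, v} 𝒯 X where
  fam := Family.zero _ _
  isVB := Family.isVectorBundle_zero 𝒯.locConst
  cond x := 𝒯.cond_zero _

/-- Tensor product with a representation of `Q`. -/
def tensor (W : FinRep.{v} Q) (E : Bundle.{u, v} 𝒯 X) : Bundle.{u, v} 𝒯 X where
  fam := E.fam.tensor W
  isVB := E.isVB.tensor W 𝒯.locConst
  cond x := by
    have h : (E.fam.tensor W).kerRep x = Representation.tprod 1 (E.fam.kerRep x) := by
      ext1 k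
      have hk : 𝒯.proj k = 1 := k.2
      change TensorProduct.map (W.rep (𝒯.proj k)) _ = TensorProduct.map 1 _
      rw [hk, map_one]; rfl
    have := 𝒯.cond_tensor W.carrier _ _ (E.cond x)
    rw [← h] at this
    exact this

/-- Pullback. -/
def pullback {Y : Type u} [TopologicalSpace Y] [MulAction Q Y] (f : EqMap Q X Y)
    (E : Bundle.{u, v} 𝒯 Y) : Bundle.{u, v} 𝒯 X where
  fam := E.fam.pullback f
  isVB := E.isVB.pullback 𝒯.locConst f
  cond x := E.cond (f.toFun x)

end

end Bundle

/-- A zero space is isomorphic to the standard one. -/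
def zeroEquiv {F : Type v} [AddCommGroup F] [Module ℂ F] (h : ∀ t : F, 0 = t) :
    F ≃ₗ[ℂ] PUnit.{v + 1} where
  toFun _ := PUnit.unit
  map_add' _ _ := rfl
  map_smul' _ _ := rfl
  invFun _ := 0
  left_inv := h
  right_inv _ := rfl

namespace Vec

variable {X : Type u} [TopologicalSpace X] [MulAction Q X]

variable {𝒯}

open Family

instance : Add (Vec.{u, v} 𝒯 X) :=
  ⟨Quotient.map₂ Bundle.sum fun E E' ⟨e, h, hc, hc'⟩ F F' ⟨f, h', _, _⟩ => by
    rename_i hf hf'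
    refine iso_of_continuous (E.sum F).isVB (E'.sum F').isVB (fun x => (e x).prodCongr (f x))
      (fun γ x y hxy a => Prod.ext (h γ x y hxy a.1) (h' γ x y hxy a.2)) ?_
    exact (isInducing_sum _ _).continuous_iff.2
      ((hc.comp (continuous_sum_fst _ _)).prodMk (hf.comp (continuous_sum_snd _ _)))⟩

theorem cls_add (E F : Bundle.{u, v} 𝒯 X) : E.cls + F.cls = (E.sum F).cls := rfl

theorem add_comm' (a b : Vec.{u, v} 𝒯 X) : a + b = b + a := by
  induction a, b using Quotient.inductionOn₂ with
  | _ E F =>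
    exact Bundle.cls_eq (E := E.sum F) (F := F.sum E) (fun x => LinearEquiv.prodComm ℂ _ _)
      (fun _ _ _ _ _ => rfl) ((isInducing_sum _ _).continuous_iff.2
        ((continuous_sum_snd _ _).prodMk (continuous_sum_fst _ _)))

variable [ContinuousConstSMul Q X]

instance : Zero (Vec.{u, v} 𝒯 X) := ⟨(Bundle.zero 𝒯 X).cls⟩

theorem zero_def : (0 : Vec.{u, v} 𝒯 X) = (Bundle.zero 𝒯 X).cls := rfl

instance : AddCommMonoid (Vec.{u, v} 𝒯 X) where
  nsmul := nsmulRec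
  add_comm := add_comm'
  add_assoc a b c := by
    induction a, b, c using Quotient.inductionOn₃ with
    | _ E F H =>
      exact Bundle.cls_eq (E := (E.sum F).sum H) (F := E.sum (F.sum H))
        (fun x => LinearEquiv.prodAssoc ℂ _ _ _)
        (fun _ _ _ _ _ => rfl) ((isInducing_sum _ _).continuous_iff.2
        (((continuous_sum_fst _ _).comp (continuous_sum_fst _ _)).prodMk
          ((isInducing_sum _ _).continuous_iff.2
            (((continuous_sum_snd _ _).comp (continuous_sum_fst _ _)).prodMk
              (continuous_sum_snd _ _)))))
  zero_add a := by
    induction a using Quotient.ind with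
    | _ E =>
      exact Bundle.cls_eq (E := (Bundle.zero 𝒯 X).sum E) (F := E)
        (fun x => (LinearEquiv.uniqueProd :
          (PUnit.{v + 1} × E.fam.fiber x) ≃ₗ[ℂ] E.fam.fiber x))
        (fun _ _ _ _ _ => rfl) (continuous_sum_snd _ _)
  add_zero a := by
    rw [add_comm']
    induction a using Quotient.ind with
    | _ E =>
      exact Bundle.cls_eq (E := (Bundle.zero 𝒯 X).sum E) (F := E)
        (fun x => (LinearEquiv.uniqueProd :
          (PUnit.{v + 1} × E.fam.fiber x) ≃ₗ[ℂ] E.fam.fiber x))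
        (fun _ _ _ _ _ => rfl) (continuous_sum_snd _ _)

instance : SMul (RepClass.{v} Q) (Vec.{u, v} 𝒯 X) :=
  ⟨Quotient.map₂ Bundle.tensor fun W W' ⟨e, h⟩ E E' ⟨f, h', hf, hf'⟩ => by
    refine iso_of_continuous (E.tensor W).isVB (E'.tensor W').isVB
      (fun x => TensorProduct.congr e (f x)) (fun γ x y hxy a => ?_) ?_
    · exact tmul_equiv_of_tmul
        (f := (TensorProduct.congr e (f y)).toLinearMap ∘ₗ
          TensorProduct.map (W.rep (𝒯.proj γ)) (E.fam.act γ hxy))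
        (g := TensorProduct.map (W'.rep (𝒯.proj γ)) (E'.fam.act γ hxy) ∘ₗ
          (TensorProduct.congr e (f x)).toLinearMap) (fun a b => by simp [h, h']) a
    · refine (isInducing_tensor _ _).continuous_iff.2
        ((continuous_tensor_fst _ _).prodMk (continuous_pi fun φ => ?_))
      refine Continuous.congr (hf.comp (continuous_tensor_contract W E.fam (φ ∘ₗ e.toLinearMap))) fun t =>
        congrArg (E'.fam.pt _) (Eq.symm ?_)
      exact tmul_equiv_of_tmul
        (f := contract φ ∘ₗ (TensorProduct.congr e (f t.1)).toLinearMap)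
        (g := (f t.1).toLinearMap ∘ₗ contract (φ ∘ₗ e.toLinearMap))
        (fun a b => by simp) t.2⟩

theorem smul_cls (W : FinRep.{v} Q) (E : Bundle.{u, v} 𝒯 X) :
    (show RepClass.{v} Q from Quotient.mk _ W) • E.cls = (E.tensor W).cls := rfl

instance : Module (RepClass.{v} Q) (Vec.{u, v} 𝒯 X) where
  one_smul a := by
    induction a using Quotient.ind with
    | _ E =>
      refine Bundle.cls_eq (E := E.tensor (FinRep.triv Q)) (F := E)
        (fun x => (TensorProduct.congr ULift.moduleEquiv (LinearEquiv.refl _ _)).trans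
          (TensorProduct.lid ℂ _)) (fun γ x y hxy a => ?_) ?_
      · exact tmul_equiv_of_tmul
          (f := ((TensorProduct.congr ULift.moduleEquiv (LinearEquiv.refl _ _)).trans
            (TensorProduct.lid ℂ _)).toLinearMap ∘ₗ
            TensorProduct.map ((FinRep.triv.{v} Q).rep (𝒯.proj γ)) (E.fam.act γ hxy))
          (g := E.fam.act γ hxy ∘ₗ ((TensorProduct.congr ULift.moduleEquiv
            (LinearEquiv.refl _ _)).trans (TensorProduct.lid ℂ _)).toLinearMap)
          (fun a b => by simp) a
      · refine Continuous.congr (continuous_tensor_contract (FinRep.triv Q) E.fam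
          (ULift.moduleEquiv.toLinearMap)) fun t =>
          congrArg (E.fam.pt _) (Eq.symm ?_)
        exact tmul_equiv_of_tmul
          (f := ((TensorProduct.congr ULift.moduleEquiv (LinearEquiv.refl _ _)).trans
            (TensorProduct.lid ℂ _)).toLinearMap)
          (g := contract ULift.moduleEquiv.toLinearMap) (fun a b => by simp) t.2
  mul_smul w w' a := by
    induction w, w', a using Quotient.inductionOn₃ with
    | _ W W' E =>
      refine Bundle.cls_eq (E := E.tensor (W.tensor W')) (F := (E.tensor W').tensor W)
        (fun x => TensorProduct.assoc ℂ _ _ _) (fun γ x y hxy a => ?_) ?_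
      · refine DFunLike.congr_fun (f := (TensorProduct.assoc ℂ _ _ _).toLinearMap ∘ₗ
          TensorProduct.map ((W.tensor W').rep (𝒯.proj γ)) (E.fam.act γ hxy))
          (g := TensorProduct.map (W.rep (𝒯.proj γ))
            (TensorProduct.map (W'.rep (𝒯.proj γ)) (E.fam.act γ hxy)) ∘ₗ
            (TensorProduct.assoc ℂ _ _ _).toLinearMap) ?_ a
        refine TensorProduct.ext_threefold fun a b c => ?_
        simp
      · refine (isInducing_tensor _ _).continuous_iff.2
          ((continuous_tensor_fst _ _).prodMk (continuous_pi fun φ => ?_))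
        refine (isInducing_tensor _ _).continuous_iff.2
          ((continuous_tensor_fst _ _).prodMk (continuous_pi fun ψ => ?_))
        refine Continuous.congr (continuous_tensor_contract (W.tensor W') E.fam
          (LinearMap.mul' ℂ ℂ ∘ₗ TensorProduct.map φ ψ)) fun t =>
          congrArg (E.fam.pt _) (Eq.symm ?_)
        refine DFunLike.congr_fun (f := contract ψ ∘ₗ contract φ ∘ₗ
          (TensorProduct.assoc ℂ W.carrier W'.carrier (E.fam.fiber t.1)).toLinearMap)
          (g := contract (LinearMap.mul' ℂ ℂ ∘ₗ TensorProduct.map φ ψ)) ?_ t.2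
        refine TensorProduct.ext_threefold fun a b c => ?_
        simp [mul_smul]
  smul_zero w := by
    induction w using Quotient.ind with
    | _ W =>
      have hs : ∀ t : W.carrier ⊗[ℂ] PUnit.{v + 1}, 0 = t := fun t =>
        tmul_equiv_of_tmul (W' := PUnit) (f := 0) (g := LinearMap.id)
          (fun a b => by rw [Subsingleton.elim b 0]; simp) t
      refine Bundle.cls_eq (E := (Bundle.zero 𝒯 X).tensor W) (F := Bundle.zero 𝒯 X)
        (fun x => zeroEquiv hs) (fun _ _ _ _ _ => rfl) ?_
      exact isInducing_zero.continuous_iff.2 (continuous_tensor_fst _ _)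
  zero_smul a := by
    induction a using Quotient.ind with
    | _ E =>
      have hs : ∀ x, ∀ t : PUnit.{v + 1} ⊗[ℂ] E.fam.fiber x, 0 = t := fun x t =>
        tmul_equiv_of_tmul (W := PUnit) (f := 0) (g := LinearMap.id)
          (fun a b => by rw [Subsingleton.elim a 0]; simp) t
      refine Bundle.cls_eq (E := E.tensor (FinRep.zero Q)) (F := Bundle.zero 𝒯 X)
        (fun x => zeroEquiv (hs x)) (fun _ _ _ _ _ => rfl) ?_
      exact isInducing_zero.continuous_iff.2 (continuous_tensor_fst _ _)
  smul_add w a b := by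
    induction w, a, b using Quotient.inductionOn₃ with
    | _ W E F =>
      refine Bundle.cls_eq (E := (E.sum F).tensor W) (F := (E.tensor W).sum (F.tensor W))
        (fun x => TensorProduct.prodRight ℂ ℂ _ _ _) (fun γ x y hxy a => ?_) ?_
      · exact tmul_equiv_of_tmul
          (f := (TensorProduct.prodRight ℂ ℂ _ _ _).toLinearMap ∘ₗ
            TensorProduct.map (W.rep (𝒯.proj γ)) ((E.fam.act γ hxy).prodMap (F.fam.act γ hxy)))
          (g := ((TensorProduct.map (W.rep (𝒯.proj γ)) (E.fam.act γ hxy)).prodMap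
            (TensorProduct.map (W.rep (𝒯.proj γ)) (F.fam.act γ hxy))) ∘ₗ
            (TensorProduct.prodRight ℂ ℂ _ _ _).toLinearMap) (fun a b => by simp) a
      · refine (isInducing_sum _ _).continuous_iff.2 (Continuous.prodMk ?_ ?_)
        · refine (isInducing_tensor _ _).continuous_iff.2
            ((continuous_tensor_fst _ _).prodMk (continuous_pi fun φ => ?_))
          refine Continuous.congr ((continuous_sum_fst _ _).comp
            (continuous_tensor_contract W (E.fam.sum F.fam) φ)) fun t =>
            congrArg (E.fam.pt _) (Eq.symm ?_)
          exact tmul_equiv_of_tmul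
            (f := contract φ ∘ₗ LinearMap.fst ℂ _ _ ∘ₗ
              (TensorProduct.prodRight ℂ ℂ W.carrier (E.fam.fiber t.1)
                (F.fam.fiber t.1)).toLinearMap)
            (g := LinearMap.fst ℂ _ _ ∘ₗ contract φ) (fun a b => by simp) t.2
        · refine (isInducing_tensor _ _).continuous_iff.2
            ((continuous_tensor_fst _ _).prodMk (continuous_pi fun φ => ?_))
          refine Continuous.congr ((continuous_sum_snd _ _).comp
            (continuous_tensor_contract W (E.fam.sum F.fam) φ)) fun t =>
            congrArg (F.fam.pt _) (Eq.symm ?_)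
          exact tmul_equiv_of_tmul
            (f := contract φ ∘ₗ LinearMap.snd ℂ _ _ ∘ₗ
              (TensorProduct.prodRight ℂ ℂ W.carrier (E.fam.fiber t.1)
                (F.fam.fiber t.1)).toLinearMap)
            (g := LinearMap.snd ℂ _ _ ∘ₗ contract φ) (fun a b => by simp) t.2
  add_smul w w' a := by
    induction w, w', a using Quotient.inductionOn₃ with
    | _ W W' E =>
      refine Bundle.cls_eq (E := E.tensor (W.sum W')) (F := (E.tensor W).sum (E.tensor W'))
        (fun x => TensorProduct.prodLeft ℂ ℂ _ _ _) (fun γ x y hxy a => ?_) ?_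
      · exact tmul_equiv_of_tmul
          (f := (TensorProduct.prodLeft ℂ ℂ _ _ _).toLinearMap ∘ₗ
            TensorProduct.map ((W.sum W').rep (𝒯.proj γ)) (E.fam.act γ hxy))
          (g := ((TensorProduct.map (W.rep (𝒯.proj γ)) (E.fam.act γ hxy)).prodMap
            (TensorProduct.map (W'.rep (𝒯.proj γ)) (E.fam.act γ hxy))) ∘ₗ
            (TensorProduct.prodLeft ℂ ℂ _ _ _).toLinearMap) (fun a b => by obtain ⟨a₁, a₂⟩ := a; simp) a
      · refine (isInducing_sum _ _).continuous_iff.2 (Continuous.prodMk ?_ ?_)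
        · refine (isInducing_tensor _ _).continuous_iff.2
            ((continuous_tensor_fst _ _).prodMk (continuous_pi fun φ => ?_))
          refine Continuous.congr (continuous_tensor_contract (W.sum W') E.fam (φ ∘ₗ LinearMap.fst ℂ _ _)) fun t =>
            congrArg (E.fam.pt _) (Eq.symm ?_)
          exact tmul_equiv_of_tmul
            (f := contract φ ∘ₗ LinearMap.fst ℂ _ _ ∘ₗ
              (TensorProduct.prodLeft ℂ ℂ W.carrier W'.carrier (E.fam.fiber t.1)).toLinearMap)
            (g := contract (φ ∘ₗ LinearMap.fst ℂ _ _)) (fun a b => by obtain ⟨a₁, a₂⟩ := a; simp) t.2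
        · refine (isInducing_tensor _ _).continuous_iff.2
            ((continuous_tensor_fst _ _).prodMk (continuous_pi fun φ => ?_))
          refine Continuous.congr (continuous_tensor_contract (W.sum W') E.fam (φ ∘ₗ LinearMap.snd ℂ _ _)) fun t =>
            congrArg (E.fam.pt _) (Eq.symm ?_)
          exact tmul_equiv_of_tmul
            (f := contract φ ∘ₗ LinearMap.snd ℂ _ _ ∘ₗ
              (TensorProduct.prodLeft ℂ ℂ W.carrier W'.carrier (E.fam.fiber t.1)).toLinearMap)
            (g := contract (φ ∘ₗ LinearMap.snd ℂ _ _)) (fun a b => by obtain ⟨a₁, a₂⟩ := a; simp) t.2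

end Vec

end KTheory

section KGroups

variable {Q : Type w} [Group Q] (𝒯 : Kind.{v, w, w'} Q)

/-- The Grothendieck group of the semigroup of isomorphism classes of bundles of the given kind. -/
def K0 (X : Type u) [TopologicalSpace X] [MulAction Q X] [ContinuousConstSMul Q X] :
    Type (max u (v + 1) w') :=
  Algebra.GrothendieckAddGroup (Vec.{u, v} 𝒯 X)

section
variable (X : Type u) [TopologicalSpace X] [MulAction Q X] [ContinuousConstSMul Q X]

instance : AddCommGroup (K0.{u, v} 𝒯 X) :=
  inferInstanceAs (AddCommGroup (Algebra.GrothendieckAddGroup (Vec.{u, v} 𝒯 X)))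

/-- The `R(Q)`-module structure, given by the tensor product with representations. -/
instance : Module (RepRing.{v} Q) (K0.{u, v} 𝒯 X) := grothModule (Vec.{u, v} 𝒯 X)

variable {X}

/-- The class `[E]` of a bundle in `K`-theory. -/
def K0.of {𝒯 : Kind.{v, w, w'} Q} (E : Bundle.{u, v} 𝒯 X) : K0.{u, v} 𝒯 X :=
  gOf (M := Vec.{u, v} 𝒯 X) E.cls

end

section Pullback

variable {X Y Z : Type u} [TopologicalSpace X] [MulAction Q X] [ContinuousConstSMul Q X]
  [TopologicalSpace Y] [MulAction Q Y] [ContinuousConstSMul Q Y]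
  [TopologicalSpace Z] [MulAction Q Z] [ContinuousConstSMul Q Z]

/-- Composition of equivariant maps. -/
def EqMap.comp (g : EqMap Q Y Z) (f : EqMap Q X Y) : EqMap Q X Z where
  toFun := g.toFun ∘ f.toFun
  continuous := g.continuous.comp f.continuous
  map_smul q x := by simp [f.map_smul, g.map_smul]

open Family

variable {𝒯}

theorem Family.continuous_pullback {p : 𝒯.grp →* Q} (f : EqMap Q X Y) (E : Family.{u, v} p Y) :
    Continuous fun t : (E.pullback f).Tot => E.pt (f.toFun t.1) t.2 :=
  continuous_snd.comp (isInducing_pullback f E).continuous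

theorem Family.continuous_pullback_fst {p : 𝒯.grp →* Q} (f : EqMap Q X Y)
    (E : Family.{u, v} p Y) : Continuous (E.pullback f).proj :=
  continuous_fst.comp (isInducing_pullback f E).continuous

/-- Pullback of isomorphism classes. -/
def Vec.pull (f : EqMap Q X Y) : Vec.{u, v} 𝒯 Y → Vec.{u, v} 𝒯 X :=
  Quotient.map (Bundle.pullback f) fun E F ⟨e, h, hc, hc'⟩ => by
    refine iso_of_continuous (E.pullback f).isVB (F.pullback f).isVB (fun x => e (f.toFun x))
      (fun γ x y hxy a => h _ _ _ _ a) ?_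
    exact (isInducing_pullback _ _).continuous_iff.2
      ((continuous_pullback_fst _ _).prodMk (hc.comp (continuous_pullback _ _)))

/-- Pullback of isomorphism classes as a linear map. -/
def Vec.pullHom (f : EqMap Q X Y) : Vec.{u, v} 𝒯 Y →ₗ[RepClass.{v} Q] Vec.{u, v} 𝒯 X where
  toFun := Vec.pull f
  map_add' a b := by
    induction a, b using Quotient.inductionOn₂ with
    | _ E F =>
      refine Bundle.cls_eq (E := (E.sum F).pullback f) (F := (E.pullback f).sum (F.pullback f))
        (fun x => LinearEquiv.refl _ _) (fun _ _ _ _ _ => rfl)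
        ((isInducing_sum _ _).continuous_iff.2 (Continuous.prodMk ?_ ?_))
      · exact (isInducing_pullback _ _).continuous_iff.2 ((continuous_pullback_fst _ _).prodMk
          ((continuous_sum_fst _ _).comp (continuous_pullback _ _)))
      · exact (isInducing_pullback _ _).continuous_iff.2 ((continuous_pullback_fst _ _).prodMk
          ((continuous_sum_snd _ _).comp (continuous_pullback _ _)))
  map_smul' w a := by
    induction w, a using Quotient.inductionOn₂ with
    | _ W E =>
      refine Bundle.cls_eq (E := (E.tensor W).pullback f) (F := (E.pullback f).tensor W)
        (fun x => LinearEquiv.refl _ _) (fun _ _ _ _ _ => rfl)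
        ((isInducing_tensor _ _).continuous_iff.2
          ((continuous_pullback_fst _ _).prodMk (continuous_pi fun φ => ?_)))
      exact (isInducing_pullback _ _).continuous_iff.2 ((continuous_pullback_fst _ _).prodMk
          ((continuous_tensor_contract W E.fam φ).comp (continuous_pullback _ _)))

theorem Vec.pull_comp (g : EqMap Q Y Z) (f : EqMap Q X Y) (a : Vec.{u, v} 𝒯 Z) :
    Vec.pull (g.comp f) a = Vec.pull f (Vec.pull g a) := by
  induction a using Quotient.ind with
  | _ E =>
    refine Bundle.cls_eq (E := E.pullback (g.comp f)) (F := (E.pullback g).pullback f)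
      (fun x => LinearEquiv.refl _ _) (fun _ _ _ _ _ => rfl) ?_
    refine (isInducing_pullback _ _).continuous_iff.2
      ((continuous_pullback_fst _ _).prodMk ?_)
    exact (isInducing_pullback _ _).continuous_iff.2
      ((f.continuous.comp (continuous_pullback_fst _ _)).prodMk (continuous_pullback _ _))

/-- The induced map `f^*` in `K`-theory. -/
def K0.pull (f : EqMap Q X Y) : K0.{u, v} 𝒯 Y →ₗ[RepRing.{v} Q] K0.{u, v} 𝒯 X where
  toFun := grothMap (Vec.pullHom (𝒯 := 𝒯) f).toAddMonoidHom
  map_add' := map_add (grothMap (Vec.pullHom (𝒯 := 𝒯) f).toAddMonoidHom)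
  map_smul' r a := grothMap_smul (Vec.pullHom (𝒯 := 𝒯) f) r a

theorem K0.pull_of (f : EqMap Q X Y) (E : Bundle.{u, v} 𝒯 Y) :
    K0.pull f (K0.of E) = K0.of (E.pullback f) :=
  grothMap_of _ _

theorem K0.pull_comp (g : EqMap Q Y Z) (f : EqMap Q X Y) (a : K0.{u, v} 𝒯 Z) :
    K0.pull (g.comp f) a = K0.pull f (K0.pull g a) := by
  change grothMap (Vec.pullHom (𝒯 := 𝒯) (g.comp f)).toAddMonoidHom a =
    grothMap (Vec.pullHom (𝒯 := 𝒯) f).toAddMonoidHom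
      (grothMap (Vec.pullHom (𝒯 := 𝒯) g).toAddMonoidHom a)
  induction a using groth_induction with
  | add a a' h h' => simp only [map_add, h, h']
  | neg a h => simp only [map_neg, h]
  | of m =>
    rw [grothMap_of, grothMap_of, grothMap_of]
    exact congrArg _ (Vec.pull_comp g f m)

end Pullback

section Suspension

/-- The `n`-fold reduced suspension `Σⁿ X₊ = Sⁿ ∧ X₊` of the space `X` with a disjoint base point,
for compact Hausdorff `X`: the one-point compactification of `ℝⁿ × X`, the base point being the
point at infinity. -/
def SuspPlus (n : ℕ) (X : Type u) : Type u := OnePoint ((Fin n → ℝ) × X)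

variable (n : ℕ) (X : Type u) [TopologicalSpace X]

instance : TopologicalSpace (SuspPlus n X) :=
  inferInstanceAs (TopologicalSpace (OnePoint ((Fin n → ℝ) × X)))

instance : CompactSpace (SuspPlus n X) :=
  inferInstanceAs (CompactSpace (OnePoint ((Fin n → ℝ) × X)))

instance [CompactSpace X] [T2Space X] : T2Space (SuspPlus n X) :=
  inferInstanceAs (T2Space (OnePoint ((Fin n → ℝ) × X)))

/-- The group acts on `Σⁿ X₊` through `X`. -/
instance [MulAction Q X] : MulAction Q (SuspPlus n X) where
  smul q := OnePoint.map (Prod.map id (q • ·))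
  one_smul t := by
    change OnePoint.map (Prod.map id ((1 : Q) • ·)) t = t
    have : (Prod.map id ((1 : Q) • ·) : (Fin n → ℝ) × X → (Fin n → ℝ) × X) = id := by
      ext1 s; simp [Prod.map]
    rw [this, OnePoint.map_id]; rfl
  mul_smul q r t := by
    change OnePoint.map (Prod.map id ((q * r) • ·)) t
      = OnePoint.map (Prod.map id (q • ·)) (OnePoint.map (Prod.map id (r • ·)) t)
    have : (Prod.map id ((q * r) • ·) : (Fin n → ℝ) × X → (Fin n → ℝ) × X)
        = Prod.map id (q • ·) ∘ Prod.map id (r • ·) := by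
      ext1 s; simp [Prod.map, mul_smul]
    rw [this, OnePoint.map_comp]; rfl

instance [MulAction Q X] [ContinuousConstSMul Q X] : ContinuousConstSMul Q (SuspPlus n X) where
  continuous_const_smul q := by
    refine OnePoint.continuous_map (by fun_prop) ?_
    let h := (Homeomorph.refl (Fin n → ℝ)).prodCongr (Homeomorph.smul q : X ≃ₜ X)
    exact (Filter.hasBasis_coclosedCompact.tendsto_iff Filter.hasBasis_coclosedCompact).2
      fun K hK => ⟨h ⁻¹' K, ⟨hK.1.preimage h.continuous, h.isCompact_preimage.2 hK.2⟩,
        fun t ht => ht⟩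

variable {X} {Y : Type u} [TopologicalSpace Y] [MulAction Q X] [MulAction Q Y]

/-- The map `Σⁿ X₊ → Σⁿ Y₊` induced by an equivariant map. -/
def EqMap.susp [CompactSpace X] [T2Space Y] (f : EqMap Q X Y) :
    EqMap Q (SuspPlus n X) (SuspPlus n Y) where
  toFun := OnePoint.map (Prod.map id f.toFun)
  continuous := by
    refine OnePoint.continuous_map (continuous_id.prodMap f.continuous) ?_
    refine (Filter.hasBasis_coclosedCompact.tendsto_iff Filter.hasBasis_coclosedCompact).2
      fun K hK => ⟨Prod.map id f.toFun ⁻¹' K, ⟨?_, ?_⟩, fun t ht => ht⟩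
    · exact hK.1.preimage (continuous_id.prodMap f.continuous)
    · refine IsCompact.of_isClosed_subset ((hK.2.image continuous_fst).prod isCompact_univ)
        (hK.1.preimage (continuous_id.prodMap f.continuous)) fun t ht => ?_
      exact ⟨⟨_, ht, rfl⟩, trivial⟩
  map_smul q t := by
    change OnePoint.map _ (OnePoint.map (Prod.map id (q • ·)) t)
      = OnePoint.map (Prod.map id (q • ·)) (OnePoint.map _ t)
    induction t using OnePoint.rec with
    | infty => rfl
    | coe t => exact congrArg OnePoint.some (Prod.ext rfl (f.map_smul q t.2))

variable (Q X) in
/-- The inclusion of the base point. -/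
def EqMap.base : EqMap Q PUnit.{u + 1} (SuspPlus n X) where
  toFun _ := (OnePoint.infty : OnePoint ((Fin n → ℝ) × X))
  continuous := continuous_const
  map_smul _ _ := rfl

variable [ContinuousConstSMul Q X] [ContinuousConstSMul Q Y]

variable (X) in
/-- `Kⁿ(X)`: the reduced group of `Σⁿ X₊`, i.e. the kernel of the restriction to the base point. -/
def Kn : Submodule (RepRing.{v} Q) (K0.{u, v} 𝒯 (SuspPlus n X)) :=
  LinearMap.ker (K0.pull (EqMap.base Q n X))

/-- The induced map `f^*` on `Kⁿ`. -/
def Kn.pull [CompactSpace X] [T2Space Y] (f : EqMap Q X Y) :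
    Kn.{u, v} 𝒯 n Y →ₗ[RepRing.{v} Q] Kn.{u, v} 𝒯 n X :=
  (K0.pull (f.susp n)).restrict fun a ha => by
    have h : K0.pull (EqMap.base Q n Y) a = 0 := ha
    change K0.pull (EqMap.base Q n X) (K0.pull (f.susp n) a) = 0
    rw [← K0.pull_comp]
    exact h

end Suspension

end KGroups

section Twisted

variable {Q : Type w} [Group Q]

/-- A normalized 2-cocycle on `Q` with values in the circle group (with trivial action). -/
structure NormCocycle (Q : Type w) [Group Q] where
  toFun : Q → Q → Circle
  cocycle : ∀ q₁ q₂ q₃, toFun q₁ (q₂ * q₃) * toFun q₂ q₃ = toFun (q₁ * q₂) q₃ * toFun q₁ q₂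
  one_left : ∀ q, toFun 1 q = 1
  one_right : ∀ q, toFun q 1 = 1

/-- The central extension of `Q` by the circle defined by `α`: pairs `(q, z)` with product
`(q₁, z₁) (q₂, z₂) = (q₁ q₂, α(q₁, q₂) z₁ z₂)`. -/
@[ext] structure TwExt (α : NormCocycle Q) where
  q : Q
  z : Circle

variable (α : NormCocycle Q)

instance : Group (TwExt α) where
  mul a b := ⟨a.q * b.q, α.toFun a.q b.q * a.z * b.z⟩
  one := ⟨1, 1⟩
  inv a := ⟨a.q⁻¹, (α.toFun a.q⁻¹ a.q * a.z)⁻¹⟩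
  mul_assoc a b c := TwExt.ext (mul_assoc _ _ _) (by
    change α.toFun (a.q * b.q) c.q * (α.toFun a.q b.q * a.z * b.z) * c.z
      = α.toFun a.q (b.q * c.q) * a.z * (α.toFun b.q c.q * b.z * c.z)
    calc _ = (α.toFun (a.q * b.q) c.q * α.toFun a.q b.q) * (a.z * b.z * c.z) := by
          simp only [mul_assoc]
      _ = (α.toFun a.q (b.q * c.q) * α.toFun b.q c.q) * (a.z * b.z * c.z) := by
          rw [α.cocycle]
      _ = _ := by
          simp only [mul_assoc, mul_left_comm, mul_comm])
  one_mul a := TwExt.ext (one_mul _) (by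
    change α.toFun 1 a.q * 1 * a.z = a.z
    rw [α.one_left, one_mul, one_mul])
  mul_one a := TwExt.ext (mul_one _) (by
    change α.toFun a.q 1 * a.z * 1 = a.z
    rw [α.one_right, one_mul, mul_one])
  inv_mul_cancel a := TwExt.ext (inv_mul_cancel _) (by
    change α.toFun a.q⁻¹ a.q * (α.toFun a.q⁻¹ a.q * a.z)⁻¹ * a.z = 1
    rw [mul_inv_rev, mul_comm a.z⁻¹, ← mul_assoc, mul_inv_cancel, one_mul, inv_mul_cancel])

/-- The product topology of the discrete topology and the topology of the circle. -/
instance : TopologicalSpace (TwExt α) :=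
  TopologicalSpace.induced (fun a => a.q) ⊥ ⊓ TopologicalSpace.induced (fun a => a.z) inferInstance

/-- The projection of the central extension to `Q`. -/
def TwExt.proj : TwExt α →* Q where
  toFun a := a.q
  map_one' := rfl
  map_mul' _ _ := rfl

/-- The circle as the central subgroup of the extension. -/
def TwExt.circle (z : Circle) : (TwExt.proj α).ker := ⟨⟨1, z⟩, rfl⟩

/-- `α`-twisted `Q`-equivariant bundles: equivariant vector bundles for the central extension
defined by `α`, on which the central circle acts by multiplication by scalars. -/
def twistedKind : Kind.{v, w, w} Q where
  grp := TwExt α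
  proj := TwExt.proj α
  locConst := by
    rw [IsLocallyConstant.iff_exists_open]
    intro a
    refine ⟨{b | b.q = a.q}, ?_, rfl, fun b hb => hb⟩
    have h : IsOpen[TopologicalSpace.induced (fun a : TwExt α => a.q) (⊥ : TopologicalSpace Q)] {b | b.q = a.q} :=
      by
      let _ : TopologicalSpace Q := ⊥
      exact isOpen_induced_iff.2 ⟨{a.q}, trivial, rfl⟩
    exact (inf_le_left : (inferInstance : TopologicalSpace (TwExt α)) ≤ _) _ h
  cond F _ _ σ := ∀ (z : Circle) (f : F), σ (TwExt.circle α z) f = (z : ℂ) • f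
  cond_zero σ z f := rfl
  cond_sum F F' _ _ _ _ σ σ' h h' z f := Prod.ext (h z f.1) (h' z f.2)
  cond_tensor W F _ _ _ _ _ σ h z f :=
    tmul_equiv_of_tmul (f := TensorProduct.map 1 (σ (TwExt.circle α z)))
      (g := (z : ℂ) • LinearMap.id) (fun a b => by simp [h]) f

end Twisted

section Isotypic

variable {G : Type w} [Group G] {A : Subgroup G}
variable {V : Type v} [NormedAddCommGroup V] [InnerProductSpace ℂ V]

/-- The linear representation underlying a unitary representation `A → U(V)`. -/
def toRep (ρ : A →* (V ≃ₗᵢ[ℂ] V)) : Representation ℂ A V where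
  toFun a := (ρ a).toLinearEquiv.toLinearMap
  map_one' := by rw [map_one]; rfl
  map_mul' a b := by rw [map_mul]; rfl

@[simp] theorem toRep_apply (ρ : A →* (V ≃ₗᵢ[ℂ] V)) (a : A) (x : V) : toRep ρ a x = ρ a x := rfl

/-- The evaluation map `V ⊗ Hom_A(V, F) → F`. -/
def evalMap {B F : Type*} [Group B] [AddCommGroup F] [Module ℂ F] (τ : Representation ℂ B V)
    (σ : Representation ℂ B F) : V ⊗[ℂ] Representation.IntertwiningMap τ σ →ₗ[ℂ] F :=
  TensorProduct.lift (LinearMap.flip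
    { toFun := fun f => f.toLinearMap
      map_add' := fun _ _ => rfl
      map_smul' := fun _ _ => rfl })

@[simp] theorem evalMap_tmul {B F : Type*} [Group B] [AddCommGroup F] [Module ℂ F]
    (τ : Representation ℂ B V) (σ : Representation ℂ B F) (x : V)
    (f : Representation.IntertwiningMap τ σ) : evalMap τ σ (x ⊗ₜ[ℂ] f) = f x := rfl

/-- Composition with an equivariant map. -/
def postComp {B F F' : Type*} [Group B] [AddCommGroup F] [Module ℂ F] [AddCommGroup F']
    [Module ℂ F'] (τ : Representation ℂ B V) {σ : Representation ℂ B F}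
    {σ' : Representation ℂ B F'} (g : F →ₗ[ℂ] F') (hg : ∀ b x, g (σ b x) = σ' b (g x)) :
    Representation.IntertwiningMap τ σ →ₗ[ℂ] Representation.IntertwiningMap τ σ' where
  toFun f := ⟨g ∘ₗ f.toLinearMap, fun b => by
    ext x
    have := Representation.IntertwiningMap.isIntertwining τ σ f b x
    simp [this, hg]⟩
  map_add' f f' := by ext; simp
  map_smul' c f := by ext; simp

theorem evalMap_postComp {B F F' : Type*} [Group B] [AddCommGroup F] [Module ℂ F]
    [AddCommGroup F'] [Module ℂ F'] (τ : Representation ℂ B V) {σ : Representation ℂ B F}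
    {σ' : Representation ℂ B F'} (g : F →ₗ[ℂ] F') (hg : ∀ b x, g (σ b x) = σ' b (g x))
    (t : V ⊗[ℂ] Representation.IntertwiningMap τ σ) :
    evalMap τ σ' (LinearMap.lTensor V (postComp τ g hg) t) = g (evalMap τ σ t) := by
  refine tmul_equiv_of_tmul (f := evalMap τ σ' ∘ₗ LinearMap.lTensor V (postComp τ g hg))
    (g := g ∘ₗ evalMap τ σ) (fun a b => ?_) t
  rfl

/-- A representation which is a retract of a finite family of representations on which the
evaluation map is bijective has this property. -/
theorem bijective_evalMap {B F κ : Type*} [Group B] [AddCommGroup F] [Module ℂ F] [Fintype κ]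
    {F' : κ → Type*} [∀ k, AddCommGroup (F' k)] [∀ k, Module ℂ (F' k)]
    (τ : Representation ℂ B V) {σ : Representation ℂ B F}
    {σ' : ∀ k, Representation ℂ B (F' k)} (π : ∀ k, F →ₗ[ℂ] F' k) (ι : ∀ k, F' k →ₗ[ℂ] F)
    (hπ : ∀ k b x, π k (σ b x) = σ' k b (π k x)) (hι : ∀ k b x, ι k (σ' k b x) = σ b (ι k x))
    (hs : ∀ x, ∑ k, ι k (π k x) = x) (h : ∀ k, Function.Bijective (evalMap τ (σ' k))) :
    Function.Bijective (evalMap τ σ) := by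
  refine ⟨(injective_iff_map_eq_zero _).2 fun t ht => ?_, fun x => ?_⟩
  · have h₁ : ∀ k, LinearMap.lTensor V (postComp τ (π k) (hπ k)) t = 0 := fun k => by
      apply (h k).1
      rw [evalMap_postComp, ht, map_zero, map_zero]
    have h₂ : ∑ k, LinearMap.lTensor V (postComp τ (ι k) (hι k))
        (LinearMap.lTensor V (postComp τ (π k) (hπ k)) t) = t := by
      have := tmul_equiv_of_tmul (g := LinearMap.id)
        (f := ∑ k, LinearMap.lTensor V (postComp τ (ι k) (hι k)) ∘ₗ
          LinearMap.lTensor V (postComp τ (π k) (hπ k))) (fun a b => by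
            simp only [LinearMap.sum_apply, LinearMap.comp_apply, LinearMap.lTensor_tmul,
              ← TensorProduct.tmul_sum, LinearMap.id_apply]
            congr 1
            ext x
            rw [Representation.IntertwiningMap.toLinearMap_sum, LinearMap.sum_apply]
            exact hs (b x)) t
      simpa using this
    rw [← h₂]
    simp [h₁]
  · choose t ht using fun k => (h k).2 (π k x)
    refine ⟨∑ k, LinearMap.lTensor V (postComp τ (ι k) (hι k)) (t k), ?_⟩
    rw [map_sum]
    simp only [evalMap_postComp, ht, hs]

/-- `A` as the kernel of `G → G / A`. -/
def toKer (A : Subgroup G) [A.Normal] : A →* (QuotientGroup.mk' A).ker :=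
  Subgroup.inclusion (by rw [QuotientGroup.ker_mk'])

/-- `(G, ρ)`-equivariant bundles over `G`-spaces on which `A` acts trivially: `G`-equivariant
vector bundles `E` for which the evaluation map `V ⊗ Hom_A(V, E) → E` is an isomorphism (on each
fibre). -/
def rhoKind [A.Normal] (ρ : A →* (V ≃ₗᵢ[ℂ] V)) : Kind.{v, w, w} (G ⧸ A) where
  grp := G
  top := ⊥
  proj := QuotientGroup.mk' A
  locConst := by
    let _ : TopologicalSpace G := ⊥
    have : DiscreteTopology G := ⟨rfl⟩
    exact IsLocallyConstant.of_discrete _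
  cond F _ _ σ := Function.Bijective (evalMap (toRep ρ) (σ.comp (toKer A)))
  cond_zero σ := bijective_evalMap (κ := Empty) (F' := fun _ => PUnit.{v + 1}) _
    (σ' := fun _ => 1) (fun _ => 0) (fun _ => 0)
    (fun k => k.elim) (fun k => k.elim) (fun _ => rfl) (fun k => k.elim)
  cond_sum F F' _ _ _ _ σ σ' h h' := by
    let T : Bool → Type v := fun k => match k with | true => F | false => F'
    let _ : ∀ k, AddCommGroup (T k) := fun k => match k with
      | true => inferInstanceAs (AddCommGroup F)
      | false => inferInstanceAs (AddCommGroup F')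
    let _ : ∀ k, Module ℂ (T k) := fun k => match k with
      | true => inferInstanceAs (Module ℂ F)
      | false => inferInstanceAs (Module ℂ F')
    refine bijective_evalMap (F' := T) _
      (σ' := fun k => match k with | true => σ.comp (toKer A) | false => σ'.comp (toKer A))
      (fun k => match k with | true => LinearMap.fst ℂ F F' | false => LinearMap.snd ℂ F F')
      (fun k => match k with | true => LinearMap.inl ℂ F F' | false => LinearMap.inr ℂ F F')
      (fun k => match k with | true => fun _ _ => rfl | false => fun _ _ => rfl)
      (fun k => match k with
        | true => fun a x => Prod.ext rfl (map_zero (σ' (toKer A a))).symm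
        | false => fun a x => Prod.ext (map_zero (σ (toKer A a))).symm rfl)
      (fun x => ?_) (fun k => match k with | true => h | false => h')
    rw [Fintype.sum_bool]
    exact Prod.ext (add_zero _) (zero_add _)
  cond_tensor W F _ _ _ _ _ σ h := by
    let b := Module.finBasis ℂ W
    refine bijective_evalMap (F' := fun _ => F) (σ' := fun _ => σ.comp (toKer A)) _
      (fun k => Family.contract (b.coord k)) (fun k => TensorProduct.mk ℂ W F (b k))
      (fun k a x => ?_) (fun k a x => rfl) (Family.sum_contract b) (fun _ => h)
    exact tmul_equiv_of_tmul (f := Family.contract (b.coord k) ∘ₗ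
        TensorProduct.map 1 (σ (toKer A a)))
      (g := σ (toKer A a) ∘ₗ Family.contract (b.coord k)) (fun a b => by simp) x

end Isotypic

section Lifts

variable {G : Type w} [Group G] {A : Subgroup G} [A.Normal]
variable {V : Type v} [NormedAddCommGroup V] [InnerProductSpace ℂ V]

/-- The representation `g · ρ`, given by `(g · ρ)(a) = ρ(g⁻¹ a g)`. -/
def conjRep (g : G) (ρ : A →* (V ≃ₗᵢ[ℂ] V)) : A →* (V ≃ₗᵢ[ℂ] V) :=
  ρ.comp (MulAut.conjNormal g⁻¹).toMonoidHom

/-- The choices made for a unitary representation `ρ` of `A`: a set-theoretic section `σ` of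
`G → Q = G / A` with `σ(1) = 1`, and elements `M_q ∈ U(V)` with `M_1 = 1` and
`ρ(σ(q)⁻¹ a σ(q)) = M_q⁻¹ ρ(a) M_q`. -/
structure Lifts (ρ : A →* (V ≃ₗᵢ[ℂ] V)) where
  σ : G ⧸ A → G
  mk_σ : ∀ q, (QuotientGroup.mk (σ q) : G ⧸ A) = q
  σ_one : σ 1 = 1
  M : G ⧸ A → (V ≃ₗᵢ[ℂ] V)
  M_one : M 1 = 1
  conj : ∀ q a, conjRep (σ q) ρ a = (M q)⁻¹ * ρ a * M q

variable {ρ : A →* (V ≃ₗᵢ[ℂ] V)} (D : Lifts ρ)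

namespace Lifts

/-- `χ(q₁, q₂) = σ(q₁ q₂)⁻¹ σ(q₁) σ(q₂) ∈ A`. -/
def χ (q₁ q₂ : G ⧸ A) : A :=
  ⟨(D.σ (q₁ * q₂))⁻¹ * (D.σ q₁ * D.σ q₂), by
    rw [← QuotientGroup.eq, QuotientGroup.mk_mul, D.mk_σ, D.mk_σ, D.mk_σ]⟩

theorem χ_spec (q₁ q₂ : G ⧸ A) : D.σ q₁ * D.σ q₂ = D.σ (q₁ * q₂) * (D.χ q₁ q₂ : G) := by
  simp [χ]

/-- The unitary transformation `ρ(χ(q₁, q₂)) M_{q₂}⁻¹ M_{q₁}⁻¹ M_{q₁ q₂}`. -/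
def obstruction (q₁ q₂ : G ⧸ A) : V ≃ₗᵢ[ℂ] V :=
  ρ (D.χ q₁ q₂) * (D.M q₂)⁻¹ * (D.M q₁)⁻¹ * D.M (q₁ * q₂)

theorem conj' (q : G ⧸ A) (a : A) :
    ρ a * D.M q = D.M q * ρ (MulAut.conjNormal (D.σ q)⁻¹ a) := by
  have := D.conj q a
  change ρ (MulAut.conjNormal (D.σ q)⁻¹ a) = _ at this
  rw [this]; group

theorem conj'' (q : G ⧸ A) (a : A) :
    (D.M q)⁻¹ * ρ a = ρ (MulAut.conjNormal (D.σ q)⁻¹ a) * (D.M q)⁻¹ := by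
  have := D.conj q a
  change ρ (MulAut.conjNormal (D.σ q)⁻¹ a) = _ at this
  rw [this]; group

theorem obstruction_comm (q₁ q₂ : G ⧸ A) (a : A) :
    D.obstruction q₁ q₂ * ρ a = ρ a * D.obstruction q₁ q₂ := by
  have h₁ : ∀ q a, D.M q * ρ a = ρ (MulAut.conjNormal (D.σ q) a) * D.M q := fun q a => by
    rw [D.conj']
    congr 2
    simp
  simp only [obstruction]
  rw [mul_assoc _ (D.M (q₁ * q₂)), h₁, ← mul_assoc, mul_assoc _ (D.M q₁)⁻¹, conj'', ← mul_assoc,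
    mul_assoc _ (D.M q₂)⁻¹, conj'', ← mul_assoc, ← map_mul]
  simp only [← mul_assoc, ← map_mul]
  have h₂ : D.χ q₁ q₂ * MulAut.conjNormal (D.σ q₂)⁻¹ (MulAut.conjNormal (D.σ q₁)⁻¹
      (MulAut.conjNormal (D.σ (q₁ * q₂)) a)) = a * D.χ q₁ q₂ := by
    ext
    simp [χ, mul_assoc]
  rw [h₂]

theorem nontrivial [Representation.IsIrreducible (toRep ρ)] : Nontrivial V := by
  by_contra h
  rw [not_nontrivial_iff_subsingleton] at h
  refine bot_ne_top (α := Subrepresentation (toRep ρ)) (SetLike.ext fun x => ?_)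
  rw [Subsingleton.elim x 0]
  exact ⟨fun _ => Submodule.zero_mem (⊤ : Subrepresentation (toRep ρ)).toSubmodule,
    fun _ => Submodule.zero_mem (⊥ : Subrepresentation (toRep ρ)).toSubmodule⟩

variable [FiniteDimensional ℂ V] [Representation.IsIrreducible (toRep ρ)]

/-- By Schur's lemma the obstruction is a scalar of absolute value one. -/
theorem exists_scalar (q₁ q₂ : G ⧸ A) :
    ∃ z : Circle, ∀ x : V, D.obstruction q₁ q₂ x = (z : ℂ) • x := by
  let f : Representation.IntertwiningMap (toRep ρ) (toRep ρ) :=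
    ⟨(D.obstruction q₁ q₂).toLinearEquiv.toLinearMap, fun a => by
      ext x
      exact DFunLike.congr_fun (D.obstruction_comm q₁ q₂ a) x⟩
  obtain ⟨c, hc⟩ :=
    (Representation.IsIrreducible.algebraMap_intertwiningMap_bijective_of_isAlgClosed
      (ρ := toRep ρ)).2 f
  have h : ∀ x : V, D.obstruction q₁ q₂ x = c • x := fun x => by
    have := DFunLike.congr_fun hc x
    rw [Algebra.algebraMap_eq_smul_one] at this
    exact this.symm
  have := nontrivial (ρ := ρ)
  obtain ⟨x, hx⟩ := exists_ne (0 : V)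
  refine ⟨⟨c, ?_⟩, h⟩
  have h₁ := (D.obstruction q₁ q₂).norm_map x
  rw [h, norm_smul] at h₁
  simpa [Submonoid.unitSphere] using (mul_eq_right₀ (norm_ne_zero_iff.2 hx)).1 h₁

/-- The function `α_ρ`: the scalar `ρ(χ(q₁, q₂)) M_{q₂}⁻¹ M_{q₁}⁻¹ M_{q₁ q₂} ∈ Z(U(V)) = S¹`. -/
def αfun (q₁ q₂ : G ⧸ A) : Circle := Classical.choose (D.exists_scalar q₁ q₂)

theorem αfun_spec (q₁ q₂ : G ⧸ A) (x : V) : D.obstruction q₁ q₂ x = (D.αfun q₁ q₂ : ℂ) • x :=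
  Classical.choose_spec (D.exists_scalar q₁ q₂) x

theorem αfun_eq (q₁ q₂ : G ⧸ A) {z : Circle} {x : V} (hx : x ≠ 0)
    (h : D.obstruction q₁ q₂ x = (z : ℂ) • x) : D.αfun q₁ q₂ = z := by
  rw [αfun_spec] at h
  exact Circle.ext (smul_left_injective ℂ hx h)

theorem αfun_spec' (q₁ q₂ : G ⧸ A) (x : V) :
    ρ (D.χ q₁ q₂) ((D.M q₂)⁻¹ ((D.M q₁)⁻¹ x)) = (D.αfun q₁ q₂ : ℂ) • (D.M (q₁ * q₂))⁻¹ x := by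
  rw [← αfun_spec]
  simp [obstruction]

theorem αfun_spec'' (q₁ q₂ : G ⧸ A) (x : V) :
    (D.αfun q₁ q₂ : ℂ) • D.M q₁ (D.M q₂ x) = D.M (q₁ * q₂) (ρ (D.χ q₁ q₂) x) := by
  have h := D.αfun_spec' q₁ q₂ (D.M q₁ (D.M q₂ x))
  have h' := congrArg (D.M (q₁ * q₂)) h
  rw [map_smul] at h'
  simpa using h'.symm

/-- The normalized 2-cocycle `α_ρ`. -/
def α : NormCocycle (G ⧸ A) where
  toFun := D.αfun
  cocycle q₁ q₂ q₃ := by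
    have := nontrivial (ρ := ρ)
    obtain ⟨x, hx⟩ := exists_ne (0 : V)
    have h₁ : ((D.αfun q₁ (q₂ * q₃) * D.αfun q₂ q₃ : Circle) : ℂ) • D.M q₁ (D.M q₂ (D.M q₃ x))
        = D.M (q₁ * (q₂ * q₃)) (ρ (D.χ q₁ (q₂ * q₃) * D.χ q₂ q₃) x) := by
      rw [Circle.coe_mul, mul_smul, ← map_smul, αfun_spec'', αfun_spec'', map_mul]; rfl
    have h₂ : ((D.αfun (q₁ * q₂) q₃ * D.αfun q₁ q₂ : Circle) : ℂ) • D.M q₁ (D.M q₂ (D.M q₃ x))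
        = D.M (q₁ * q₂ * q₃) (ρ (D.χ (q₁ * q₂) q₃ *
          MulAut.conjNormal (D.σ q₃)⁻¹ (D.χ q₁ q₂)) x) := by
      have h := DFunLike.congr_fun (D.conj' q₃ (D.χ q₁ q₂)) x
      change ρ (D.χ q₁ q₂) (D.M q₃ x) = D.M q₃ _ at h
      rw [Circle.coe_mul, mul_smul, αfun_spec'', h, αfun_spec'', map_mul]; rfl
    have h₃ : D.χ q₁ (q₂ * q₃) * D.χ q₂ q₃
        = D.χ (q₁ * q₂) q₃ * MulAut.conjNormal (D.σ q₃)⁻¹ (D.χ q₁ q₂) := by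
      ext
      simp [χ, mul_assoc]
    rw [h₃, ← mul_assoc q₁, ← h₂] at h₁
    exact Circle.ext (smul_left_injective ℂ (m := D.M q₁ (D.M q₂ (D.M q₃ x)))
      (by simpa using hx) h₁)
  one_left q := by
    have := nontrivial (ρ := ρ)
    obtain ⟨x, hx⟩ := exists_ne (0 : V)
    refine D.αfun_eq 1 q hx ?_
    have : D.χ 1 q = 1 := by ext; simp [χ, D.σ_one]
    simp [obstruction, this, D.M_one]
  one_right q := by
    have := nontrivial (ρ := ρ)
    obtain ⟨x, hx⟩ := exists_ne (0 : V)
    refine D.αfun_eq q 1 hx ?_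
    have : D.χ q 1 = 1 := by ext; simp [χ, D.σ_one]
    simp [obstruction, this, D.M_one]

end Lifts

section HomFamily

variable [FiniteDimensional ℂ V] [Representation.IsIrreducible (toRep ρ)]
variable {X : Type u} [TopologicalSpace X] [MulAction (G ⧸ A) X]

/-- The representation of `A` on a fibre of a `G`-equivariant family over a `G`-space on which
`A` acts trivially. -/
def fibRep (E : Family.{u, v} (QuotientGroup.mk' A) X) (x : X) :
    Representation ℂ A (E.fiber x) :=
  (E.kerRep x).comp (toKer A)

theorem fibRep_apply (E : Family.{u, v} (QuotientGroup.mk' A) X) (x : X) (a : A)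
    (h : QuotientGroup.mk' A (a : G) • x = x) (e : E.fiber x) : fibRep E x a e = E.act a h e := rfl

theorem act_congr (E : Family.{u, v} (QuotientGroup.mk' A) X) {g h : G} (hgh : g = h) {x y : X}
    (h₁ : QuotientGroup.mk' A g • x = y) (h₂ : QuotientGroup.mk' A h • x = y) (e : E.fiber x) :
    E.act g h₁ e = E.act h h₂ e := by
  subst hgh; rfl

theorem fib_act (E : Family.{u, v} (QuotientGroup.mk' A) X) {x y : X} (g h : G) (a b : A)
    (hgh : g * a = b * h) (h₁ : QuotientGroup.mk' A g • x = y)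
    (h₂ : QuotientGroup.mk' A h • x = y) (e : E.fiber x) :
    E.act g h₁ (fibRep E x a e) = fibRep E y b (E.act h h₂ e) := by
  have ha : QuotientGroup.mk' A (a : G) • x = x := by
    rw [show QuotientGroup.mk' A (a : G) = 1 from (QuotientGroup.eq_one_iff _).2 a.2, one_smul]
  have hb : QuotientGroup.mk' A (b : G) • y = y := by
    rw [show QuotientGroup.mk' A (b : G) = 1 from (QuotientGroup.eq_one_iff _).2 b.2, one_smul]
  have h₃ : QuotientGroup.mk' A (g * a) • x = y := by rw [map_mul, mul_smul, ha, h₁]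
  have h₄ : QuotientGroup.mk' A (b * h) • x = y := by rw [map_mul, mul_smul, h₂, hb]
  rw [fibRep_apply E x a ha, fibRep_apply E y b hb, ← E.act_mul g a ha h₁ h₃,
    ← E.act_mul b h h₂ hb h₄]
  exact act_congr E hgh _ _ _

/-- The family `Hom_A(V, E)`, with the action `((q, z) · f)(x) = z σ(q) f(M_q⁻¹ x)` of the
extension defined by `α_ρ`.  The total space carries the topology of pointwise convergence, i.e.
the coarsest topology for which the projection to `X` and the evaluations `f ↦ f(x)` at the
vectors `x ∈ V` are continuous. -/
def homFamily (E : Family.{u, v} (QuotientGroup.mk' A) X) : Family.{u, v} (TwExt.proj D.α) X where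
  fiber x := Representation.IntertwiningMap (toRep ρ) (fibRep E x)
  top := TopologicalSpace.induced
    (fun t => (t.1, fun x : V => E.pt t.1 (t.2 x))) inferInstance
  act γ {x y} h :=
    { toFun := fun f =>
        ⟨(γ.z : ℂ) • (E.act (D.σ γ.q) (by rw [← h]; exact congrArg (· • x) (D.mk_σ γ.q)) ∘ₗ
          f.toLinearMap ∘ₗ (D.M γ.q)⁻¹.toLinearEquiv.toLinearMap), fun a => by
            ext x
            have h₁ := DFunLike.congr_fun (D.conj'' γ.q a) x
            have h₂ := Representation.IntertwiningMap.isIntertwining _ _ f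
              (MulAut.conjNormal (D.σ γ.q)⁻¹ a) ((D.M γ.q)⁻¹ x)
            change (γ.z : ℂ) • E.act _ _ (f ((D.M γ.q)⁻¹ (ρ a x)))
              = fibRep E y a ((γ.z : ℂ) • E.act _ _ (f ((D.M γ.q)⁻¹ x)))
            rw [map_smul]
            refine congrArg _ ?_
            change (D.M γ.q)⁻¹ (ρ a x) = ρ _ ((D.M γ.q)⁻¹ x) at h₁
            rw [h₁]
            refine (congrArg _ h₂).trans ?_
            exact fib_act E _ _ _ _ (by simp [mul_assoc]) _ _ _⟩
      map_add' := fun f f' => by ext; simp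
      map_smul' := fun c f => by
        ext x
        change (γ.z : ℂ) • E.act _ _ (c • f ((D.M γ.q)⁻¹ x))
          = c • (γ.z : ℂ) • E.act _ _ (f ((D.M γ.q)⁻¹ x))
        rw [map_smul, smul_comm] }
  act_one {x} h f := by
    ext v
    change ((1 : Circle) : ℂ) • E.act (D.σ 1) _ (f ((D.M 1)⁻¹ v)) = f v
    have hx : QuotientGroup.mk' A (1 : G) • x = x := by rw [map_one, one_smul]
    rw [D.M_one, Circle.coe_one, one_smul, act_congr E D.σ_one _ hx, E.act_one]
    simp
  act_mul γ δ x y z h₁ h₂ h₃ f := by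
    ext v
    have hσ : ∀ {q : G ⧸ A} {x y : X}, q • x = y → QuotientGroup.mk' A (D.σ q) • x = y :=
      fun {q x y} h => by rw [← h]; exact congrArg (· • x) (D.mk_σ q)
    have e₁ : QuotientGroup.mk' A (D.σ δ.q) • x = y := hσ h₁
    have e₂ : QuotientGroup.mk' A (D.σ γ.q) • y = z := hσ h₂
    have e₃ : QuotientGroup.mk' A (D.σ (γ.q * δ.q)) • x = z := hσ h₃
    have e₄ : QuotientGroup.mk' A (D.σ γ.q * D.σ δ.q) • x = z := by
      rw [map_mul, mul_smul, e₁, e₂]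
    change ((D.αfun γ.q δ.q * γ.z * δ.z : Circle) : ℂ) •
        E.act (D.σ (γ.q * δ.q)) e₃ (f ((D.M (γ.q * δ.q))⁻¹ v))
      = (γ.z : ℂ) • E.act (D.σ γ.q) e₂ ((δ.z : ℂ) • E.act (D.σ δ.q) e₁
        (f ((D.M δ.q)⁻¹ ((D.M γ.q)⁻¹ v))))
    rw [map_smul, ← E.act_mul _ _ e₁ e₂ e₄]
    have ha : QuotientGroup.mk' A (D.χ γ.q δ.q : G) • x = x := by
      rw [show QuotientGroup.mk' A (D.χ γ.q δ.q : G) = 1 from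
        (QuotientGroup.eq_one_iff _).2 (D.χ γ.q δ.q).2, one_smul]
    have e₅ : QuotientGroup.mk' A (D.σ (γ.q * δ.q) * (D.χ γ.q δ.q : G)) • x = z := by
      rw [map_mul, mul_smul, ha, e₃]
    rw [act_congr E (D.χ_spec γ.q δ.q) e₄ e₅, E.act_mul _ _ ha e₃ e₅]
    have h := Representation.IntertwiningMap.isIntertwining _ _ f (D.χ γ.q δ.q)
      ((D.M δ.q)⁻¹ ((D.M γ.q)⁻¹ v))
    change f (ρ _ _) = E.act _ ha _ at h
    rw [← h, D.αfun_spec', map_smul, map_smul, Circle.coe_mul, Circle.coe_mul]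
    simp only [smul_smul]
    congr 1
    ring

end HomFamily

end Lifts

section QuotientAction

variable {G : Type w} [Group G] (A : Subgroup G)

/-- The subgroup `A` acts trivially on the `G`-space `X`. -/
class ActsTrivially (X : Type u) [MulAction G X] : Prop where
  smul_eq : ∀ a ∈ A, ∀ x : X, a • x = x

variable [A.Normal] (X : Type u) [MulAction G X] [ActsTrivially A X]

/-- The induced action of `Q = G / A` on a `G`-space on which `A` acts trivially. -/
instance quotientAction : MulAction (G ⧸ A) X where
  smul q x := Quotient.liftOn' q (fun g => g • x) fun g h hgh => by
    have := ActsTrivially.smul_eq _ (QuotientGroup.leftRel_apply.1 hgh) x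
    rw [mul_smul, inv_smul_eq_iff] at this
    exact this.symm
  one_smul x := one_smul G x
  mul_smul q r x := by
    induction q using QuotientGroup.induction_on
    induction r using QuotientGroup.induction_on
    exact mul_smul (α := G) _ _ x

theorem mk_smul (g : G) (x : X) : (QuotientGroup.mk g : G ⧸ A) • x = g • x := rfl

instance [TopologicalSpace X] [ContinuousConstSMul G X] : ContinuousConstSMul (G ⧸ A) X where
  continuous_const_smul q := by
    induction q using QuotientGroup.induction_on with
    | H g => exact continuous_const_smul g

variable {X} {Y : Type u} [MulAction G Y] [ActsTrivially A Y] [TopologicalSpace X]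
  [TopologicalSpace Y]

/-- A continuous `G`-equivariant map as an equivariant map of `Q`-spaces. -/
def EqMap.ofG (f : X → Y) (hf : Continuous f) (hG : ∀ (g : G) (x : X), f (g • x) = g • f x) :
    EqMap (G ⧸ A) X Y where
  toFun := f
  continuous := hf
  map_smul q x := by
    induction q using QuotientGroup.induction_on with
    | H g => exact hG g x

end QuotientAction

end EqK

end

/-!
Since `ρ` is irreducible, Burnside's theorem makes `ℂ[A] → End(V)` surjective, so a projection of
`V` onto the line of a vector `v ≠ 0` is the action of some `b ∈ ℂ[A]`. On a `(G, ρ)`-bundle `E`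
this `b` acts as a continuous family of idempotents, and `f ↦ f(v)` identifies `Hom_A(V, E)` with
its image; the image of a continuous family of idempotents being locally trivial, `Hom_A(V, E)` is
a vector bundle.

The map `σ(q) a ↦ M_q ρ(a)` is a projective representation of `G` on `V` extending `ρ`, and its
cocycle is inverse to the one of an `α_ρ`-twisted bundle `F`. Hence `G` acts on `V ⊗ F`, and
`F ↦ V ⊗ F` is inverse to `E ↦ Hom_A(V, E)` through the evaluation `V ⊗ Hom_A(V, E) → E` and the
coevaluation `F → Hom_A(V, V ⊗ F)`. The functor `V ⊗ -` commutes with direct sums, with tensoring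
by representations of `Q` and with pullbacks, so it induces natural isomorphisms of modules on
`K⁰`, and these restrict to the kernels defining `Kⁿ`.
-/

noncomputable section

namespace EqK

open Topology TensorProduct

section Schur

variable {k B V : Type*} [Field k] [IsAlgClosed k] [Monoid B] [AddCommGroup V] [Module k V]
  [FiniteDimensional k V]

theorem exists_eq_smul_id_of_forall_commute (τ : Representation k B V) [τ.IsIrreducible]
    {f : V →ₗ[k] V} (hf : ∀ b, f ∘ₗ τ b = τ b ∘ₗ f) : ∃ c : k, f = c • LinearMap.id := by
  obtain ⟨c, hc⟩ :=
    (Representation.IsIrreducible.algebraMap_intertwiningMap_bijective_of_isAlgClosed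
      (ρ := τ)).2 ⟨f, hf⟩
  rw [Algebra.algebraMap_eq_smul_one] at hc
  exact ⟨c, (congrArg Representation.IntertwiningMap.toLinearMap hc).symm⟩

/-- Burnside's theorem, from the Jacobson density theorem: by Schur's lemma the commutant of the
group algebra consists of the scalars. -/
theorem asAlgebraHom_surjective (τ : Representation k B V) [τ.IsIrreducible] :
    Function.Surjective τ.asAlgebraHom := fun T => by
  have scalar : ∀ g : Module.End (MonoidAlgebra k B) τ.asModule,
      ∃ c : k, ∀ m, g m = c • m := fun g => by
    obtain ⟨c, rfl⟩ := (IsSimpleModule.algebraMap_end_bijective_of_isAlgClosed k).2 g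
    exact ⟨c, fun _ => rfl⟩
  let T' : Module.End (Module.End (MonoidAlgebra k B) τ.asModule) τ.asModule :=
    { toFun := T
      map_add' := T.map_add
      map_smul' := fun g m => by
        obtain ⟨c, hc⟩ := scalar g
        rw [Module.End.smul_def, hc]
        exact (T.map_smul c m).trans (hc (T m)).symm }
  obtain ⟨s, hs⟩ := Module.Finite.fg_top (R := k) (M := V)
  obtain ⟨r, hr⟩ := jacobson_density T' s
  exact ⟨r, LinearMap.ext_on hs fun m hm => (hr m hm).symm⟩

end Schur

section Unitary

section Adjoint

variable {𝕜 V W : Type*} [RCLike 𝕜] [NormedAddCommGroup V] [InnerProductSpace 𝕜 V]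
  [FiniteDimensional 𝕜 V] [NormedAddCommGroup W] [InnerProductSpace 𝕜 W] [FiniteDimensional 𝕜 W]

theorem norm_eq_sqrt_mul_norm_of_adjoint_comp_self {f : V →ₗ[𝕜] W} {c : 𝕜}
    (h : f.adjoint ∘ₗ f = c • LinearMap.id) (x : V) : ‖f x‖ = √(RCLike.re c) * ‖x‖ := by
  have hsq : ‖f x‖ ^ 2 = RCLike.re c * ‖x‖ ^ 2 := by
    have hinner : inner 𝕜 (f x) (f x) = c * inner 𝕜 x x := by
      rw [← LinearMap.adjoint_inner_right, ← inner_smul_right]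
      exact congrArg (inner 𝕜 x) (DFunLike.congr_fun h x)
    rw [inner_self_eq_norm_sq_to_K, inner_self_eq_norm_sq_to_K, ← RCLike.ofReal_pow,
      ← RCLike.ofReal_pow] at hinner
    simpa only [RCLike.ofReal_re, RCLike.re_mul_ofReal] using congrArg RCLike.re hinner
  rw [← Real.sqrt_sq (norm_nonneg (f x)), hsq, Real.sqrt_mul' _ (sq_nonneg _),
    Real.sqrt_sq (norm_nonneg x)]

theorem exists_linearIsometry_eq_smul_of_adjoint_comp_self {f : V →ₗ[𝕜] W}
    (hf : Function.Injective f) {c : 𝕜} (h : f.adjoint ∘ₗ f = c • LinearMap.id) :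
    ∃ (u : V →ₗᵢ[𝕜] W) (r : 𝕜), u.toLinearMap = r • f := by
  refine ⟨⟨((√(RCLike.re c) : ℝ) : 𝕜)⁻¹ • f, fun x => ?_⟩, _, rfl⟩
  obtain rfl | hx := eq_or_ne x 0
  · simp only [map_zero, norm_zero]
  have hc : √(RCLike.re c) ≠ 0 := fun hc => hx <| hf <| by
    rw [map_zero, ← norm_eq_zero, norm_eq_sqrt_mul_norm_of_adjoint_comp_self h, hc, zero_mul]
  rw [LinearMap.smul_apply, norm_smul, norm_inv, RCLike.norm_ofReal,
    abs_of_nonneg (Real.sqrt_nonneg _), norm_eq_sqrt_mul_norm_of_adjoint_comp_self h,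
    inv_mul_cancel_left₀ hc]

variable {B : Type*} [Group B] {τ : Representation 𝕜 B V} {τ' : Representation 𝕜 B W}

theorem adjoint_eq_apply_inv (hτ : ∀ b x, ‖τ b x‖ = ‖x‖) (b : B) :
    (τ b).adjoint = τ b⁻¹ := by
  refine ((LinearMap.eq_adjoint_iff _ _).2 fun x y => ?_).symm
  rw [← (LinearMap.norm_map_iff_inner_map_map (τ b)).1 (hτ b), τ.self_inv_apply]

theorem adjoint_comp_intertwines (hτ : ∀ b x, ‖τ b x‖ = ‖x‖) (hτ' : ∀ b x, ‖τ' b x‖ = ‖x‖)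
    (f : Representation.IntertwiningMap τ τ') (b : B) :
    f.toLinearMap.adjoint ∘ₗ τ' b = τ b ∘ₗ f.toLinearMap.adjoint := by
  rw [← inv_inv b, ← adjoint_eq_apply_inv hτ, ← adjoint_eq_apply_inv hτ', ← LinearMap.adjoint_comp,
    ← LinearMap.adjoint_comp, f.isIntertwining']

end Adjoint

variable {B V W : Type*} [Group B] [NormedAddCommGroup V] [InnerProductSpace ℂ V]
  [FiniteDimensional ℂ V] [NormedAddCommGroup W] [InnerProductSpace ℂ W] [FiniteDimensional ℂ W]

theorem exists_linearIsometryEquiv_of_equiv {τ : Representation ℂ B V} [τ.IsIrreducible]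
    {τ' : Representation ℂ B W} (hτ : ∀ b x, ‖τ b x‖ = ‖x‖) (hτ' : ∀ b x, ‖τ' b x‖ = ‖x‖)
    (e : τ.Equiv τ') : ∃ u : V ≃ₗᵢ[ℂ] W, ∀ b x, u (τ b x) = τ' b (u x) := by
  let f := e.toIntertwiningMap
  obtain ⟨c, hc⟩ := exists_eq_smul_id_of_forall_commute τ
    (f := f.toLinearMap.adjoint ∘ₗ f.toLinearMap) fun b => by
      rw [LinearMap.comp_assoc, f.isIntertwining', ← LinearMap.comp_assoc,
        adjoint_comp_intertwines hτ hτ', LinearMap.comp_assoc]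
  obtain ⟨u, r, hu⟩ :=
    exists_linearIsometry_eq_smul_of_adjoint_comp_self e.toLinearEquiv.injective hc
  refine ⟨u.toLinearIsometryEquiv e.toLinearEquiv.finrank_eq, fun b x => ?_⟩
  have hu' : ∀ x, u x = r • f x := DFunLike.congr_fun hu
  simp only [LinearIsometry.coe_toLinearIsometryEquiv, hu', f.isIntertwining, map_smul]

end Unitary

section Lifts

variable {G : Type w} [Group G] {A : Subgroup G} [A.Normal] {V : Type v} [NormedAddCommGroup V]
  [InnerProductSpace ℂ V] [FiniteDimensional ℂ V]

theorem nonempty_lifts {ρ : A →* (V ≃ₗᵢ[ℂ] V)} [Representation.IsIrreducible (toRep ρ)]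
    (hinv : ∀ g : G, Nonempty (Representation.Equiv (toRep (conjRep g ρ)) (toRep ρ))) :
    Nonempty (Lifts ρ) := by
  classical
  have hM : ∀ g : G, ∃ M : V ≃ₗᵢ[ℂ] V, ∀ a, conjRep g ρ a = M⁻¹ * ρ a * M := fun g => by
    obtain ⟨M, hM⟩ := exists_linearIsometryEquiv_of_equiv (fun a => (ρ a).norm_map)
      (fun a => (conjRep g ρ a).norm_map) (hinv g).some.symm
    refine ⟨M⁻¹, fun a => ?_⟩
    rw [inv_inv, eq_mul_inv_iff_mul_eq]
    exact LinearIsometryEquiv.ext fun x => (hM a x).symm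
  choose M hM using hM
  refine ⟨
    { σ := fun q => if q = 1 then 1 else q.out
      mk_σ := fun q => ?_
      σ_one := if_pos rfl
      M := fun q => if q = 1 then 1 else M q.out
      M_one := if_pos rfl
      conj := fun q a => ?_ }⟩
  · split_ifs with h
    · exact h.symm
    · exact QuotientGroup.out_eq' q
  · split_ifs with h
    · simp [conjRep]
    · exact hM _ a

end Lifts

section Intertwining

open Family

theorem intertwiningMap_asAlgebraHom {k B V F : Type*} [Field k] [Monoid B] [AddCommGroup V]
    [Module k V] [AddCommGroup F] [Module k F] {τ : Representation k B V}
    {σ : Representation k B F} (f : Representation.IntertwiningMap τ σ) (b : MonoidAlgebra k B)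
    (x : V) : f (τ.asAlgebraHom b x) = σ.asAlgebraHom b (f x) := by
  induction b using MonoidAlgebra.induction_on with
  | of b => simpa only [Representation.asAlgebraHom_of] using f.isIntertwining τ σ b x
  | add b c hb hc => simp only [map_add, LinearMap.add_apply, hb, hc]
  | smul r b hb => simp only [map_smul, LinearMap.smul_apply, hb]

theorem asAlgebraHom_eq_rTensor {k B V N : Type*} [Field k] [Monoid B] [AddCommGroup V]
    [Module k V] [AddCommGroup N] [Module k N] {τ : Representation k B V}
    {σ : Representation k B (V ⊗[k] N)} (hσ : ∀ b, σ b = LinearMap.rTensor N (τ b))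
    (b : MonoidAlgebra k B) : σ.asAlgebraHom b = LinearMap.rTensor N (τ.asAlgebraHom b) := by
  induction b using MonoidAlgebra.induction_on with
  | of b => simpa only [Representation.asAlgebraHom_of] using hσ b
  | add b c hb hc => rw [map_add, map_add, LinearMap.rTensor_add, hb, hc]
  | smul r b hb => rw [map_smul, map_smul, LinearMap.rTensor_smul, hb]

variable {B : Type w} [Group B] {V F N : Type v} [NormedAddCommGroup V] [InnerProductSpace ℂ V]
  [AddCommGroup F] [Module ℂ F] [AddCommGroup N] [Module ℂ N]
  {τ : Representation ℂ B V} {σ : Representation ℂ B F}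

section Surjective

theorem asAlgebraHom_eq_of_surjective_evalMap (h : Function.Surjective (evalMap τ σ))
    {b c : MonoidAlgebra ℂ B} (hbc : τ.asAlgebraHom b = τ.asAlgebraHom c) :
    σ.asAlgebraHom b = σ.asAlgebraHom c := by
  refine LinearMap.cancel_right h |>.1 (TensorProduct.ext' fun x f => ?_)
  simp only [LinearMap.comp_apply, evalMap_tmul, ← intertwiningMap_asAlgebraHom, hbc]

/-- Evaluation of intertwining maps at a vector. -/
def evalAt (τ : Representation ℂ B V) (σ : Representation ℂ B F) (v : V) :
    Representation.IntertwiningMap τ σ →ₗ[ℂ] F :=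
  evalMap τ σ ∘ₗ TensorProduct.mk ℂ V _ v

theorem evalAt_apply (v : V) (f : Representation.IntertwiningMap τ σ) : evalAt τ σ v f = f v := rfl

theorem range_evalAt (h : Function.Surjective (evalMap τ σ)) {b : MonoidAlgebra ℂ B} {v : V}
    {φ : Module.Dual ℂ V} (hb : τ.asAlgebraHom b = φ.smulRight v) (hv : φ v = 1) :
    LinearMap.range (evalAt τ σ v) = LinearMap.range (σ.asAlgebraHom b) := by
  have hfix (f : Representation.IntertwiningMap τ σ) : σ.asAlgebraHom b (f v) = f v := by
    rw [← intertwiningMap_asAlgebraHom, hb, LinearMap.smulRight_apply, hv, one_smul]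
  refine le_antisymm ?_ ?_
  · rintro _ ⟨f, rfl⟩
    exact ⟨f v, hfix f⟩
  · rintro _ ⟨e, rfl⟩
    obtain ⟨t, rfl⟩ := h e
    refine ⟨contract φ t, ?_⟩
    refine tmul_equiv_of_tmul (f := evalAt τ σ v ∘ₗ contract φ)
      (g := σ.asAlgebraHom b ∘ₗ evalMap τ σ) (fun x f => ?_) t
    simp only [LinearMap.comp_apply, contract_tmul, evalAt_apply, evalMap_tmul,
      ← intertwiningMap_asAlgebraHom, hb, LinearMap.smulRight_apply, map_smul]

end Surjective

section Coevaluation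

variable {σ : Representation ℂ B (V ⊗[ℂ] N)} (hσ : ∀ b, σ b = LinearMap.rTensor N (τ b))

/-- Coevaluation `n ↦ (x ↦ x ⊗ n)`, for a representation `σ` of `B` on `V ⊗ N` through `V`. -/
def coevMap : N →ₗ[ℂ] Representation.IntertwiningMap τ σ where
  toFun n := ⟨(TensorProduct.mk ℂ V N).flip n, fun b => LinearMap.ext fun x => by
    simp only [hσ, LinearMap.comp_apply, LinearMap.flip_apply, TensorProduct.mk_apply,
      LinearMap.rTensor_tmul]⟩
  map_add' _ _ := Representation.IntertwiningMap.ext (map_add _ _ _)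
  map_smul' _ _ := Representation.IntertwiningMap.ext (map_smul _ _ _)

variable [FiniteDimensional ℂ V] [τ.IsIrreducible]

include hσ in
theorem intertwiningMap_apply_rTensor (f : Representation.IntertwiningMap τ σ)
    (T : V →ₗ[ℂ] V) (x : V) : f (T x) = LinearMap.rTensor N T (f x) := by
  obtain ⟨b, rfl⟩ := asAlgebraHom_surjective τ T
  rw [intertwiningMap_asAlgebraHom, asAlgebraHom_eq_rTensor hσ]

theorem bijective_coevMap : Function.Bijective (coevMap hσ) := by
  have : Nontrivial V := IsSimpleModule.nontrivial (MonoidAlgebra ℂ B) τ.asModule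
  obtain ⟨v, hv⟩ := exists_ne (0 : V)
  obtain ⟨φ, hφ⟩ := Module.Projective.exists_dual_eq_one ℂ hv
  refine ⟨fun m n h => ?_, fun f => ⟨contract φ (f v), ?_⟩⟩
  · have hmn : v ⊗ₜ[ℂ] m = v ⊗ₜ n := DFunLike.congr_fun h v
    simpa only [contract_tmul, hφ, one_smul] using congrArg (contract φ) hmn
  · refine Representation.IntertwiningMap.ext (LinearMap.ext fun x => ?_)
    have hf : f x = LinearMap.rTensor N (φ.smulRight x) (f v) := by
      rw [← intertwiningMap_apply_rTensor hσ, LinearMap.smulRight_apply, hφ, one_smul]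
    refine Eq.trans ?_ hf.symm
    refine tmul_equiv_of_tmul (f := TensorProduct.mk ℂ V N x ∘ₗ contract φ)
      (fun y n => ?_) (f v)
    simp only [LinearMap.comp_apply, contract_tmul, TensorProduct.mk_apply,
      LinearMap.rTensor_tmul, LinearMap.smulRight_apply, TensorProduct.smul_tmul]

include hσ in
theorem bijective_evalMap_of_eq_rTensor : Function.Bijective (evalMap τ σ) := by
  let e := LinearEquiv.lTensor V (LinearEquiv.ofBijective _ (bijective_coevMap hσ))
  have he : evalMap τ σ ∘ₗ e.toLinearMap = LinearMap.id := TensorProduct.ext' fun _ _ => rfl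
  have hsymm : ⇑(evalMap τ σ) = e.symm := funext fun t => by
    rw [← e.apply_symm_apply t, e.symm_apply_apply]
    exact DFunLike.congr_fun he _
  rw [hsymm]
  exact e.symm.bijective

end Coevaluation

theorem injective_evalAt [FiniteDimensional ℂ V] [τ.IsIrreducible] {v : V} (hv : v ≠ 0) :
    Function.Injective (evalAt τ σ v) := fun f g h => by
  obtain ⟨φ, hφ⟩ := Module.Projective.exists_dual_eq_one ℂ hv
  refine Representation.IntertwiningMap.ext (LinearMap.ext fun x => ?_)
  obtain ⟨b, hb⟩ := asAlgebraHom_surjective τ (φ.smulRight x)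
  obtain rfl : τ.asAlgebraHom b v = x := by rw [hb, LinearMap.smulRight_apply, hφ, one_smul]
  exact ((intertwiningMap_asAlgebraHom f b v).trans (congrArg _ h)).trans
    (intertwiningMap_asAlgebraHom g b v).symm

end Intertwining

section Idempotent

/-- Near `y₀`, the element `P y₀ * P y + (1 - P y₀) * (1 - P y)` is close to `1`, hence
invertible, and it intertwines `P y` with `P y₀`. -/
theorem exists_units_mul_eq_mul {Y R : Type*} [TopologicalSpace Y] [NormedRing R]
    [HasSummableGeomSeries R] {P : Y → R} (hP : Continuous P) (hidem : ∀ y, IsIdempotentElem (P y))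
    (y₀ : Y) : ∃ W : Set Y, IsOpen W ∧ y₀ ∈ W ∧
      ∃ u : W → Rˣ, Continuous u ∧ ∀ y : W, u y * P y = P y₀ * u y := by
  let T : Y → R := fun y => P y₀ * P y + (1 - P y₀) * (1 - P y)
  have hT : Continuous T := by fun_prop
  have hT₀ : T y₀ = 1 := by
    simp only [T, (hidem y₀).eq, (hidem y₀).one_sub.eq, add_sub_cancel]
  have hTP (y : Y) : T y * P y = P y₀ * T y := by
    simp only [T, add_mul, mul_add, mul_assoc, (hidem y).eq, (hidem y).one_sub_mul_self,
      ← mul_assoc (P y₀) (1 - P y₀), (hidem y₀).mul_one_sub_self, mul_zero, zero_mul]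
    rw [← mul_assoc, (hidem y₀).eq]
  refine ⟨T ⁻¹' {x | IsUnit x}, Units.isOpen.preimage hT, ?_, fun y => y.2.unit, ?_,
    fun y => hTP y⟩
  · rw [Set.mem_preimage, hT₀]
    exact isUnit_one
  · exact Units.isOpenEmbedding_val.isInducing.continuous_iff.2 (hT.comp continuous_subtype_val)

theorem exists_retraction_of_isIdempotentElem {k E : Type*} [Field k] [AddCommGroup E] [Module k E]
    [FiniteDimensional k E] {P : Module.End k E} (hP : IsIdempotentElem P) :
    ∃ (n : ℕ) (r : E →ₗ[k] (Fin n → k)) (i : (Fin n → k) →ₗ[k] E),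
      r ∘ₗ i = LinearMap.id ∧ i ∘ₗ r = P := by
  let b := (Module.finBasis k (LinearMap.range P)).equivFun
  refine ⟨_, b.toLinearMap ∘ₗ P.rangeRestrict,
    (LinearMap.range P).subtype ∘ₗ b.symm.toLinearMap, ?_, ?_⟩
  · refine LinearMap.ext fun c => ?_
    have hfix : P.rangeRestrict (b.symm c) = b.symm c := by
      obtain ⟨x, hx⟩ := (b.symm c).2
      refine Subtype.ext ?_
      change P (b.symm c : E) = b.symm c
      rw [← hx]
      exact DFunLike.congr_fun hP.eq x
    exact (congrArg b hfix).trans (b.apply_symm_apply c)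
  · refine LinearMap.ext fun x => ?_
    change ((b.symm (b (P.rangeRestrict x)) : LinearMap.range P) : E) = P x
    rw [b.symm_apply_apply, LinearMap.codRestrict_apply]

theorem exists_local_retraction {Y 𝕜 E : Type*} [TopologicalSpace Y] [RCLike 𝕜]
    [NormedAddCommGroup E] [NormedSpace 𝕜 E] [FiniteDimensional 𝕜 E] {P : Y → E →L[𝕜] E}
    (hP : Continuous P) (hidem : ∀ y, IsIdempotentElem (P y)) (y₀ : Y) :
    ∃ W : Set Y, IsOpen W ∧ y₀ ∈ W ∧
      ∃ (n : ℕ) (r : W → E →L[𝕜] (Fin n → 𝕜)) (i : W → (Fin n → 𝕜) →L[𝕜] E),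
        Continuous r ∧ Continuous i ∧
        ∀ y : W, (∀ c, r y (i y c) = c) ∧ ∀ e, i y (r y e) = P y e := by
  have : CompleteSpace E := FiniteDimensional.complete 𝕜 E
  obtain ⟨W, hW, hy₀, u, hu, huP⟩ := exists_units_mul_eq_mul hP hidem y₀
  obtain ⟨n, r, i, hri, hir⟩ := exists_retraction_of_isIdempotentElem
    (P := (P y₀).toLinearMap) (congrArg ContinuousLinearMap.toLinearMap (hidem y₀).eq)
  refine ⟨W, hW, hy₀, n, fun y => r.toContinuousLinearMap ∘L (u y).1,
    fun y => (u y).2 ∘L i.toContinuousLinearMap, ?_, ?_, fun y => ⟨fun c => ?_, fun e => ?_⟩⟩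
  · exact continuous_const.clm_comp (Units.continuous_val.comp hu)
  · exact (Units.continuous_val.comp hu.inv).clm_comp continuous_const
  · have huu : (u y).1 ((u y).2 (i c)) = i c := DFunLike.congr_fun (u y).mul_inv (i c)
    exact (congrArg r huu).trans (DFunLike.congr_fun hri c)
  · have hconj : (u y).2 * (P y₀ * (u y).1) = P y := by
      rw [← huP y]
      exact (u y).inv_mul_cancel_left _
    rw [← hconj]
    exact congrArg (u y).2 (DFunLike.congr_fun hir _)

end Idempotent

namespace Family

section Continuity

variable {Γ : Type w'} [Group Γ] {Q : Type w} [Group Q] {p : Γ →* Q} {X : Type u}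
  [MulAction Q X] [TopologicalSpace Γ] [TopologicalSpace X] {E : Family.{u, v} p X}

namespace IsVectorBundle

theorem continuous_sum_smul (hE : E.IsVectorBundle)
    {T κ : Type*} [TopologicalSpace T] [Fintype κ] {x : T → X} (hx : Continuous x)
    {c : κ → T → ℂ} (hc : ∀ k, Continuous (c k)) {s : κ → ∀ t, E.fiber (x t)}
    (hs : ∀ k, Continuous fun t => E.pt (x t) (s k t)) :
    Continuous fun t => E.pt (x t) (∑ k, c k t • s k t) := by
  refine continuous_iff_continuousAt.2 fun t₀ => ?_
  obtain ⟨U, hU, hxU, ι, _, φ, hφ, hφ'⟩ := hE.locally_trivial (x t₀)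
  have hcoord : Continuous fun t : ↥(x ⁻¹' U) => ∑ k, c k t • φ ⟨x t, t.2⟩ (s k t) :=
    continuous_finsetSum _ fun k _ => ((hc k).comp continuous_subtype_val).smul <|
      hφ.comp (((hs k).comp continuous_subtype_val).subtype_mk fun t => t.2)
  have hi : Continuous fun t : ↥(x ⁻¹' U) => (⟨x t, t.2⟩ : U) :=
    (hx.comp continuous_subtype_val).subtype_mk _
  refine ((hU.preimage hx).isOpenEmbedding_subtypeVal.continuousAt_iff (x := ⟨t₀, hxU⟩)).1
    (((hφ'.comp (hi.prodMk hcoord)).congr fun t => ?_).continuousAt)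
  refine congrArg (E.pt (x t)) ((φ ⟨x t, t.2⟩).symm_apply_eq.2 ?_)
  simp only [map_sum, map_smul]

theorem continuous_smul (hE : E.IsVectorBundle)
    {T : Type*} [TopologicalSpace T] {x : T → X} {c : T → ℂ} (hc : Continuous c)
    {s : ∀ t, E.fiber (x t)} (hs : Continuous fun t => E.pt (x t) (s t)) :
    Continuous fun t => E.pt (x t) (c t • s t) := by
  simpa only [Finset.univ_unique, Finset.sum_singleton] using
    hE.continuous_sum_smul (κ := Unit) (x := x) (hE.continuous_proj.comp hs) (fun _ => hc)
      (s := fun _ => s) (fun _ => hs)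

theorem continuous_act_apply (hE : E.IsVectorBundle)
    {T : Type*} [TopologicalSpace T] (γ : Γ) {x y : T → X} (h : ∀ t, p γ • x t = y t)
    {s : ∀ t, E.fiber (x t)} (hs : Continuous fun t => E.pt (x t) (s t)) :
    Continuous fun t => E.pt (y t) (E.act γ (h t) (s t)) := by
  obtain rfl : (fun t => p γ • x t) = y := funext h
  exact hE.continuous_act.comp (continuous_const.prodMk hs)

theorem exists_local_retraction (hE : E.IsVectorBundle) {P : ∀ x, Module.End ℂ (E.fiber x)}
    (hP : Continuous (totMap (E := E) (F := E) P)) (hidem : ∀ x, IsIdempotentElem (P x)) (x₀ : X) :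
    ∃ U : Set X, IsOpen U ∧ x₀ ∈ U ∧ ∃ (n : ℕ) (r : ∀ x : U, E.fiber x →ₗ[ℂ] (Fin n → ℂ))
      (i : ∀ x : U, (Fin n → ℂ) →ₗ[ℂ] E.fiber x),
      Continuous (fun t : {t : E.Tot // E.proj t ∈ U} => r ⟨E.proj t, t.2⟩ (E.vec t)) ∧
      Continuous (fun s : U × (Fin n → ℂ) => E.pt s.1 (i s.1 s.2)) ∧
      ∀ x : U, (∀ c, r x (i x c) = c) ∧ ∀ e, i x (r x e) = P x e := by
  obtain ⟨U, hU, hxU, ι, _, φ, hφ, hφ'⟩ := hE.locally_trivial x₀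
  let P' : U → (ι → ℂ) →L[ℂ] (ι → ℂ) := fun x =>
    LinearMap.toContinuousLinearMap ((φ x).conj (P x))
  have hP' : Continuous P' := continuous_clm_apply.2 fun c =>
    hφ.comp ((hP.comp (hφ'.comp (Continuous.prodMk_left c))).subtype_mk fun x => x.2)
  have hidem' (x : U) : IsIdempotentElem (P' x) := ContinuousLinearMap.ext fun c =>
    DFunLike.congr_fun ((hidem x).map (φ x).conjRingEquiv).eq c
  obtain ⟨W, hW, hxW, n, r, i, hr, hi, hri⟩ := EqK.exists_local_retraction hP' hidem' ⟨x₀, hxU⟩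
  have hWU (x : Subtype.val '' W) : (x : X) ∈ U := Subtype.coe_image_subset U W x.2
  let j : Subtype.val '' W → W := fun x => ⟨⟨x, hWU x⟩, Set.mem_of_mem_image_val x.2⟩
  have hj : Continuous j := (continuous_subtype_val.subtype_mk hWU).subtype_mk _
  refine ⟨_, hU.isOpenMap_subtype_val W hW, ⟨_, hxW, rfl⟩, n,
    fun x => r (j x) ∘ₗ (φ ⟨x, hWU x⟩).toLinearMap,
    fun x => (φ ⟨x, hWU x⟩).symm.toLinearMap ∘ₗ (i (j x)).toLinearMap,
    ?_, ?_, fun x => ⟨fun c => ?_, fun e => ?_⟩⟩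
  · have hW : Continuous fun t : {t : E.Tot // E.proj t ∈ Subtype.val '' W} =>
        (⟨t.1, hWU ⟨_, t.2⟩⟩ : {t : E.Tot // E.proj t ∈ U}) := continuous_subtype_val.subtype_mk _
    refine (hr.comp (hj.comp ?_)).clm_apply (hφ.comp hW)
    exact (hE.continuous_proj.comp continuous_subtype_val).subtype_mk _
  · refine hφ'.comp ((continuous_subtype_val.comp (hj.comp continuous_fst)).prodMk ?_)
    exact (hi.comp (hj.comp continuous_fst)).clm_apply continuous_snd
  · simp only [LinearMap.comp_apply, LinearEquiv.coe_coe, LinearEquiv.apply_symm_apply]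
    exact (hri (j x)).1 c
  · refine (φ ⟨x, hWU x⟩).symm_apply_eq.2 (((hri (j x)).2 _).trans ?_)
    exact congrArg (φ ⟨x, hWU x⟩ ∘ P x) ((φ ⟨x, hWU x⟩).symm_apply_apply e)

end IsVectorBundle

end Continuity

end Family

section RetractEval

variable {B : Type w} [Group B] {V F : Type v} [NormedAddCommGroup V] [InnerProductSpace ℂ V]
  [AddCommGroup F] [Module ℂ F] {τ : Representation ℂ B V} {σ : Representation ℂ B F}
  {b : MonoidAlgebra ℂ B} {v : V} {φ : Module.Dual ℂ V}

theorem isIdempotentElem_asAlgebraHom (h : Function.Surjective (evalMap τ σ))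
    (hb : τ.asAlgebraHom b = φ.smulRight v) (hv : φ v = 1) :
    IsIdempotentElem (σ.asAlgebraHom b) := by
  rw [IsIdempotentElem, ← map_mul]
  refine asAlgebraHom_eq_of_surjective_evalMap h (LinearMap.ext fun x => ?_)
  rw [map_mul, hb, Module.End.mul_apply, LinearMap.smulRight_apply, LinearMap.smulRight_apply,
    map_smul, hv, smul_eq_mul, mul_one]

theorem bijective_retraction_comp_evalAt [FiniteDimensional ℂ V] [τ.IsIrreducible]
    (h : Function.Surjective (evalMap τ σ)) (hb : τ.asAlgebraHom b = φ.smulRight v) (hv : φ v = 1)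
    {N : Type*} [AddCommGroup N] [Module ℂ N] {r : F →ₗ[ℂ] N} {i : N →ₗ[ℂ] F}
    (hri : ∀ c, r (i c) = c) (hir : ∀ e, i (r e) = σ.asAlgebraHom b e) :
    Function.Bijective (r ∘ₗ evalAt τ σ v) := by
  have hv₀ : v ≠ 0 := fun h₀ => one_ne_zero (hv.symm.trans (h₀ ▸ map_zero φ))
  refine ⟨fun f g hfg => injective_evalAt hv₀ ?_, fun c => ?_⟩
  · have hfix (f : Representation.IntertwiningMap τ σ) : i (r (f v)) = f v := by
      rw [hir, ← intertwiningMap_asAlgebraHom, hb, LinearMap.smulRight_apply, hv, one_smul]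
    exact (hfix f).symm.trans ((congrArg i hfg).trans (hfix g))
  · obtain ⟨f, hf⟩ : i c ∈ LinearMap.range (evalAt τ σ v) := by
      rw [range_evalAt h hb hv]
      exact ⟨i c, by rw [← hir, hri]⟩
    exact ⟨f, (congrArg r hf).trans (hri c)⟩

end RetractEval

theorem TwExt.continuous_z {Q : Type w} [Group Q] (α : NormCocycle Q) :
    Continuous fun γ : TwExt α => (γ.z : ℂ) :=
  continuous_subtype_val.comp (continuous_iff_le_induced.2 inf_le_right)

section HomBundle

open Family

variable {G : Type w} [Group G] {A : Subgroup G} [A.Normal] {X : Type u} [MulAction (G ⧸ A) X]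

theorem mk_coe_smul (a : A) (x : X) : QuotientGroup.mk' A (a : G) • x = x := by
  rw [show QuotientGroup.mk' A (a : G) = 1 from (QuotientGroup.eq_one_iff _).2 a.2, one_smul]

theorem Lifts.mk_σ_smul {V : Type v} [NormedAddCommGroup V] [InnerProductSpace ℂ V]
    {ρ : A →* (V ≃ₗᵢ[ℂ] V)} (D : Lifts ρ) {q : G ⧸ A} {x y : X} (h : q • x = y) :
    QuotientGroup.mk' A (D.σ q) • x = y := by
  rw [← h]; exact congrArg (· • x) (D.mk_σ q)

variable [TopologicalSpace X]

theorem continuous_asAlgebraHom_apply [TopologicalSpace G]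
    {E : Family.{u, v} (QuotientGroup.mk' A) X} (hE : E.IsVectorBundle)
    (b : MonoidAlgebra ℂ A) {T : Type*} [TopologicalSpace T] {x : T → X}
    {s : ∀ t, E.fiber (x t)} (hs : Continuous fun t => E.pt (x t) (s t)) :
    Continuous fun t => E.pt (x t) ((fibRep E (x t)).asAlgebraHom b (s t)) := by
  have h := hE.continuous_sum_smul (κ := b.coeff.support) (x := x) (hE.continuous_proj.comp hs)
    (c := fun a _ => b.coeff a) (fun _ => continuous_const)
    (s := fun a t => fibRep E (x t) a (s t))
    (fun a => hE.continuous_act_apply (a : G) (fun t => mk_coe_smul a.1 (x t)) hs)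
  refine h.congr fun t => congrArg (E.pt (x t)) ?_
  rw [Representation.asAlgebraHom_def, MonoidAlgebra.lift_apply, Finsupp.sum, LinearMap.sum_apply]
  exact Finset.sum_coe_sort b.coeff.support fun a => b.coeff a • fibRep E (x t) a (s t)

variable {V : Type v} [NormedAddCommGroup V] [InnerProductSpace ℂ V] [FiniteDimensional ℂ V]
  {ρ : A →* (V ≃ₗᵢ[ℂ] V)} [Representation.IsIrreducible (toRep ρ)] (D : Lifts ρ)

namespace Lifts

variable (E : Family.{u, v} (QuotientGroup.mk' A) X)

variable {D E} in
/-- A vector in a fibre of `Hom_A(V, E)` as an intertwining map. -/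
abbrev homMap {x : X} (f : (homFamily D E).fiber x) :
    Representation.IntertwiningMap (toRep ρ) (fibRep E x) := f

theorem isInducing_homFamily :
    IsInducing fun t : (homFamily D E).Tot => (t.1, fun x : V => E.pt t.1 (homMap t.2 x)) := ⟨rfl⟩

theorem continuous_homFamily_proj : Continuous (homFamily D E).proj :=
  continuous_fst.comp (isInducing_homFamily D E).continuous

theorem continuous_homFamily_eval (x : V) :
    Continuous fun t : (homFamily D E).Tot => E.pt t.1 (homMap t.2 x) :=
  (continuous_apply x).comp (continuous_snd.comp (isInducing_homFamily D E).continuous)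

theorem continuous_homFamily {T : Type*} [TopologicalSpace T] {s : T → (homFamily D E).Tot}
    (h : Continuous fun t => (homFamily D E).proj (s t))
    (h' : ∀ a : V, Continuous fun t => E.pt (s t).1 (homMap (s t).2 a)) : Continuous s :=
  (isInducing_homFamily D E).continuous_iff.2 (h.prodMk (continuous_pi h'))

theorem homFamily_act_circle (z : Circle) {x : X} (h : TwExt.proj D.α ⟨1, z⟩ • x = x)
    (f : (homFamily D E).fiber x) : (homFamily D E).act ⟨1, z⟩ h f = (z : ℂ) • f := by
  refine Representation.IntertwiningMap.ext (LinearMap.ext fun a => ?_)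
  change (z : ℂ) • E.act (D.σ 1) _ (homMap f ((D.M 1)⁻¹ a)) = (z : ℂ) • homMap f a
  have hx : QuotientGroup.mk' A (1 : G) • x = x := by rw [map_one, one_smul]
  rw [act_congr E D.σ_one _ hx, D.M_one, E.act_one, inv_one]
  rfl

variable {E}

theorem homFamily_locally_trivial [TopologicalSpace G] (hE : E.IsVectorBundle)
    (hev : ∀ x, Function.Surjective (evalMap (toRep ρ) (fibRep E x))) (x₀ : X) :
    ∃ U : Set X, IsOpen U ∧ x₀ ∈ U ∧
      ∃ (ι : Type) (_ : Fintype ι) (φ : ∀ y : U, (homFamily D E).fiber y ≃ₗ[ℂ] (ι → ℂ)),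
        Continuous (fun t : {t : (homFamily D E).Tot // (homFamily D E).proj t ∈ U} =>
          φ ⟨(homFamily D E).proj t, t.2⟩ ((homFamily D E).vec t)) ∧
        Continuous (fun s : U × (ι → ℂ) => (homFamily D E).pt s.1 ((φ s.1).symm s.2)) := by
  have := Lifts.nontrivial (ρ := ρ)
  obtain ⟨v, hv⟩ := exists_ne (0 : V)
  obtain ⟨ψ, hψ⟩ := Module.Projective.exists_dual_eq_one ℂ hv
  choose b hb using fun x => asAlgebraHom_surjective (toRep ρ) (ψ.smulRight x)
  obtain ⟨U, hU, hxU, n, r, i, hr, hi, hri⟩ := hE.exists_local_retraction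
    (P := fun x => (fibRep E x).asAlgebraHom (b v))
    (continuous_asAlgebraHom_apply hE _ continuous_id)
    (fun x => isIdempotentElem_asAlgebraHom (hev x) (hb v) hψ) x₀
  let θ (y : U) : (homFamily D E).fiber y ≃ₗ[ℂ] (Fin n → ℂ) :=
    .ofBijective (r y ∘ₗ evalAt (toRep ρ) (fibRep E y) v)
      (bijective_retraction_comp_evalAt (hev y) (hb v) hψ (hri y).1 (hri y).2)
  have symm_apply (y : U) (c : Fin n → ℂ) (x : V) :
      homMap ((θ y).symm c) x = (fibRep E y).asAlgebraHom (b x) (i y c) := by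
    obtain ⟨f, rfl⟩ := (θ y).surjective c
    have hfv : i y (θ y f) = homMap f v := by
      refine ((hri y).2 (homMap f v)).trans ?_
      rw [← intertwiningMap_asAlgebraHom, hb, LinearMap.smulRight_apply, hψ, one_smul]
    rw [(θ y).symm_apply_apply, hfv, ← intertwiningMap_asAlgebraHom, hb,
      LinearMap.smulRight_apply, hψ, one_smul]
  refine ⟨U, hU, hxU, Fin n, inferInstance, θ, ?_, ?_⟩
  · exact hr.comp (((continuous_homFamily_eval D E v).comp continuous_subtype_val).subtype_mk
      fun t => t.2)
  · refine continuous_homFamily D E (continuous_subtype_val.comp continuous_fst) fun x => ?_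
    exact (continuous_asAlgebraHom_apply hE (b x) hi).congr fun s =>
      congrArg (E.pt s.1) (symm_apply s.1 s.2 x).symm

theorem isVectorBundle_homFamily [TopologicalSpace G] [ContinuousConstSMul (G ⧸ A) X]
    (hE : E.IsVectorBundle)
    (hev : ∀ x, Function.Surjective (evalMap (toRep ρ) (fibRep E x))) :
    (homFamily D E).IsVectorBundle where
  continuous_proj := continuous_homFamily_proj D E
  locally_trivial := homFamily_locally_trivial D hE hev
  continuous_act := by
    refine continuous_homFamily D E ?_ fun a => ?_
    · exact (continuous_baseAct (twistedKind.{v} D.α).locConst).comp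
        (continuous_fst.prodMk ((continuous_homFamily_proj D E).comp continuous_snd))
    · exact continuous_of_locallyConstant (twistedKind.{v} D.α).locConst
        (S := (homFamily D E).Tot)
        (fun q s => E.pt (q • s.2.1) ((s.1.z : ℂ) • E.act (D.σ q) (D.mk_σ_smul rfl)
          (homMap s.2.2 ((D.M q)⁻¹ a))))
        (fun q => hE.continuous_smul ((TwExt.continuous_z D.α).comp continuous_fst)
          (hE.continuous_act_apply (D.σ q) (fun s : TwExt D.α × (homFamily D E).Tot =>
            D.mk_σ_smul (x := s.2.1) rfl)
            ((continuous_homFamily_eval D E _).comp continuous_snd)))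

/-- The twisted bundle `Hom_A(V, E)`. -/
def homBundle [ContinuousConstSMul (G ⧸ A) X] (E : Bundle.{u, v} (rhoKind ρ) X) :
    Bundle.{u, v} (twistedKind D.α) X where
  fam := homFamily D E.fam
  isVB :=
    let _ : TopologicalSpace G := ⊥
    isVectorBundle_homFamily D E.isVB fun x => (E.cond x).2
  cond x z f := D.homFamily_act_circle E.fam z (one_smul _ x) f

end Lifts

end HomBundle

section Contract

open Family

variable {W W' F F' : Type v} [AddCommGroup W] [Module ℂ W] [AddCommGroup W'] [Module ℂ W']
  [AddCommGroup F] [Module ℂ F] [AddCommGroup F'] [Module ℂ F']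

theorem contract_map (φ : Module.Dual ℂ W') (f : W →ₗ[ℂ] W') (g : F →ₗ[ℂ] F') (t : W ⊗[ℂ] F) :
    contract φ (TensorProduct.map f g t) = g (contract (φ ∘ₗ f) t) :=
  tmul_equiv_of_tmul (f := contract φ ∘ₗ TensorProduct.map f g) (g := g ∘ₗ contract (φ ∘ₗ f))
    (fun x y => by
      simp only [LinearMap.comp_apply, TensorProduct.map_tmul, contract_tmul, map_smul]) t

theorem contract_fst (φ : Module.Dual ℂ W) (t : W ⊗[ℂ] (F × F')) :
    (contract φ t).1 = contract φ (TensorProduct.prodRight ℂ ℂ W F F' t).1 :=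
  tmul_equiv_of_tmul (f := LinearMap.fst ℂ F F' ∘ₗ contract φ)
    (g := contract φ ∘ₗ LinearMap.fst ℂ _ _ ∘ₗ (TensorProduct.prodRight ℂ ℂ W F F').toLinearMap)
    (fun x y => by
      simp only [LinearMap.comp_apply, LinearMap.fst_apply, LinearEquiv.coe_coe,
        TensorProduct.prodRight_tmul, contract_tmul, Prod.smul_fst]) t

theorem contract_snd (φ : Module.Dual ℂ W) (t : W ⊗[ℂ] (F × F')) :
    (contract φ t).2 = contract φ (TensorProduct.prodRight ℂ ℂ W F F' t).2 :=
  tmul_equiv_of_tmul (f := LinearMap.snd ℂ F F' ∘ₗ contract φ)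
    (g := contract φ ∘ₗ LinearMap.snd ℂ _ _ ∘ₗ (TensorProduct.prodRight ℂ ℂ W F F').toLinearMap)
    (fun x y => by
      simp only [LinearMap.comp_apply, LinearMap.snd_apply, LinearEquiv.coe_coe,
        TensorProduct.prodRight_tmul, contract_tmul, Prod.smul_snd]) t

theorem contract_contract_leftComm (φ : Module.Dual ℂ W) (ψ : Module.Dual ℂ W')
    (t : W ⊗[ℂ] (W' ⊗[ℂ] F)) :
    contract φ (contract ψ (TensorProduct.leftComm ℂ W W' F t)) = contract ψ (contract φ t) := by
  induction t with
  | zero => simp only [map_zero]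
  | add t t' h h' => simp only [map_add, h, h']
  | tmul x s =>
    refine tmul_equiv_of_tmul
      (f := contract φ ∘ₗ contract ψ ∘ₗ (TensorProduct.leftComm ℂ W W' F).toLinearMap ∘ₗ
        TensorProduct.mk ℂ W _ x)
      (g := contract ψ ∘ₗ contract φ ∘ₗ TensorProduct.mk ℂ W _ x) (fun y z => ?_) s
    simp only [LinearMap.comp_apply, TensorProduct.mk_apply, LinearEquiv.coe_coe,
      TensorProduct.leftComm_tmul, contract_tmul, map_smul]
    exact smul_comm _ _ _

end Contract

theorem Family.act_eq_of_eq {Γ : Type w'} [Group Γ] {Q : Type w} [Group Q] {p : Γ →* Q}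
    {X : Type u} [MulAction Q X] (E : Family.{u, v} p X) {γ δ : Γ} (hγ : γ = δ) {x y : X}
    (h₁ : p γ • x = y) (h₂ : p δ • x = y) (e : E.fiber x) : E.act γ h₁ e = E.act δ h₂ e := by
  subst hγ; rfl

section Twisted

variable {Q : Type w} [Group Q] {α : NormCocycle Q} {X : Type u} [MulAction Q X]

/-- A family over the central extension defined by `α` is twisted if the central circle acts on
it by multiplication by scalars; this is the condition imposed by `twistedKind α`. -/
def IsTwisted (F : Family.{u, v} (TwExt.proj α) X) : Prop :=
  ∀ (x : X) (z : Circle) (f : F.fiber x), F.kerRep x (TwExt.circle α z) f = (z : ℂ) • f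

theorem IsTwisted.act_eq {F : Family.{u, v} (TwExt.proj α) X} (hF : IsTwisted F) (q : Q)
    (z : Circle) {x y : X} (h : q • x = y) (f : F.fiber x) :
    F.act ⟨q, z⟩ h f = (z : ℂ) • F.act ⟨q, 1⟩ h f := by
  have h₁ : TwExt.proj α (TwExt.circle α z) • x = x := one_smul Q x
  have h₂ : (⟨q, z⟩ : TwExt α) = ⟨q, 1⟩ * TwExt.circle α z := by
    refine TwExt.ext (mul_one q).symm ?_
    change z = α.toFun q 1 * 1 * z
    rw [α.one_right, one_mul, one_mul]
  have h₃ : TwExt.proj α (⟨q, 1⟩ * TwExt.circle α z) • x = y := by rw [← h₂]; exact h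
  rw [F.act_eq_of_eq h₂ h h₃, F.act_mul _ _ h₁ h h₃, ← map_smul]
  exact congrArg _ (hF x z f)

end Twisted

namespace Lifts

open Family

variable {G : Type w} [Group G] {A : Subgroup G} [A.Normal]
variable {V : Type v} [NormedAddCommGroup V] [InnerProductSpace ℂ V]
variable {ρ : A →* (V ≃ₗᵢ[ℂ] V)} (D : Lifts ρ)

/-- The element `a ∈ A` with `g = σ(q) a`, where `q` is the class of `g`. -/
def rem (g : G) : A :=
  ⟨(D.σ (QuotientGroup.mk g))⁻¹ * g, by rw [← QuotientGroup.eq, D.mk_σ]⟩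

theorem coe_rem (g : G) : (D.rem g : G) = (D.σ (QuotientGroup.mk g))⁻¹ * g := rfl

theorem σ_mul_rem (g : G) : D.σ (QuotientGroup.mk g) * (D.rem g : G) = g :=
  mul_inv_cancel_left _ g

/-- The projective representation `σ(q) a ↦ M_q ρ(a)` of `G` extending `ρ`. -/
def projRep (g : G) : V ≃ₗᵢ[ℂ] V := D.M (QuotientGroup.mk g) * ρ (D.rem g)

theorem projRep_coe (a : A) : D.projRep a = ρ a := by
  have h : (QuotientGroup.mk (a : G) : G ⧸ A) = 1 := (QuotientGroup.eq_one_iff _).2 a.2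
  have h' : D.rem a = a := Subtype.ext <| by
    rw [D.coe_rem, h, D.σ_one, inv_one, one_mul]
  rw [projRep, h, D.M_one, one_mul, h']

theorem projRep_one : D.projRep 1 = 1 :=
  (D.projRep_coe 1).trans (map_one ρ)

theorem projRep_σ (q : G ⧸ A) : D.projRep (D.σ q) = D.M q := by
  have h' : D.rem (D.σ q) = 1 := Subtype.ext <| by
    rw [D.coe_rem, D.mk_σ, inv_mul_cancel, OneMemClass.coe_one]
  rw [projRep, h', map_one, mul_one, D.mk_σ]

variable [FiniteDimensional ℂ V] [Representation.IsIrreducible (toRep ρ)]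

theorem projRep_mul (g h : G) (x : V) :
    D.projRep (g * h) x = (D.αfun (QuotientGroup.mk g) (QuotientGroup.mk h) : ℂ) •
      D.projRep g (D.projRep h x) := by
  have hconj := DFunLike.congr_fun (D.conj' (QuotientGroup.mk h) (D.rem g)) (ρ (D.rem h) x)
  have hrem : D.rem (g * h) = D.χ (QuotientGroup.mk g) (QuotientGroup.mk h) *
      (MulAut.conjNormal (D.σ (QuotientGroup.mk h))⁻¹ (D.rem g) * D.rem h) := by
    ext
    simp [χ, coe_rem, mul_assoc]
  change _ = (D.αfun _ _ : ℂ) • D.M _ ((ρ (D.rem g) * D.M (QuotientGroup.mk h)) (ρ (D.rem h) x))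
  rw [hconj]
  change _ = (D.αfun _ _ : ℂ) • D.M _ (D.M _ (ρ _ (ρ (D.rem h) x)))
  rw [D.αfun_spec'', projRep, hrem, map_mul, map_mul]
  rfl

theorem mk_one_mul_mk_one (q r : G ⧸ A) : (⟨q, 1⟩ * ⟨r, 1⟩ : TwExt D.α) = ⟨q * r, D.αfun q r⟩ :=
  TwExt.ext rfl <| by
    change D.αfun _ _ * 1 * 1 = _
    rw [mul_one, mul_one]

variable {X : Type u} [TopologicalSpace X] [MulAction (G ⧸ A) X]

/-- The family `V ⊗ F` with the action `g (x ⊗ f) = M_q ρ(a) x ⊗ (q, 1) f` for `g = σ(q) a`, with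
the topology of `Family.tensor`. The cocycle of `projRep` cancels the one of `F`. -/
def tensorFamily (F : Family.{u, v} (TwExt.proj D.α) X) (hF : IsTwisted F) :
    Family.{u, v} (QuotientGroup.mk' A) X where
  fiber x := V ⊗[ℂ] F.fiber x
  top := TopologicalSpace.induced
    (fun t => (t.1, fun φ : Module.Dual ℂ V => F.pt t.1 (contract φ t.2))) inferInstance
  act g _ _ h := TensorProduct.map (D.projRep g).toLinearEquiv.toLinearMap
    (F.act ⟨QuotientGroup.mk g, 1⟩ h)
  act_one {x} h e := by
    refine tmul_equiv_of_tmul (g := LinearMap.id) (fun a b => ?_) e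
    rw [TensorProduct.map_tmul, D.projRep_one]
    exact congrArg (a ⊗ₜ[ℂ] ·) (F.act_one h b)
  act_mul g h x y z h₁ h₂ h₃ e := by
    refine tmul_equiv_of_tmul
      (g := TensorProduct.map (D.projRep g).toLinearEquiv.toLinearMap
          (F.act ⟨QuotientGroup.mk g, 1⟩ h₂) ∘ₗ
        TensorProduct.map (D.projRep h).toLinearEquiv.toLinearMap
          (F.act ⟨QuotientGroup.mk h, 1⟩ h₁)) (fun a b => ?_) e
    change D.projRep (g * h) a ⊗ₜ[ℂ] F.act ⟨QuotientGroup.mk (g * h), 1⟩ h₃ b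
      = D.projRep g (D.projRep h a) ⊗ₜ[ℂ]
        F.act ⟨QuotientGroup.mk g, 1⟩ h₂ (F.act ⟨QuotientGroup.mk h, 1⟩ h₁ b)
    rw [← F.act_mul ⟨QuotientGroup.mk g, 1⟩ ⟨QuotientGroup.mk h, 1⟩ h₁ h₂ h₃, D.projRep_mul,
      TensorProduct.smul_tmul, F.act_eq_of_eq (D.mk_one_mul_mk_one _ _) h₃ h₃]
    exact congrArg _ (hF.act_eq _ _ h₃ b).symm

variable {F : Family.{u, v} (TwExt.proj D.α) X} (hF : IsTwisted F)

theorem isInducing_tensorFamily :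
    IsInducing fun t : (D.tensorFamily F hF).Tot =>
      (t.1, fun φ : Module.Dual ℂ V => F.pt t.1 (contract φ t.2)) := ⟨rfl⟩

theorem continuous_tensorFamily_proj : Continuous (D.tensorFamily F hF).proj :=
  continuous_fst.comp (D.isInducing_tensorFamily hF).continuous

theorem continuous_tensorFamily_contract (φ : Module.Dual ℂ V) :
    Continuous fun t : (D.tensorFamily F hF).Tot => F.pt t.1 (contract φ t.2) :=
  (continuous_apply φ).comp (continuous_snd.comp (D.isInducing_tensorFamily hF).continuous)

theorem continuous_tensorFamily {T : Type*} [TopologicalSpace T]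
    {s : T → (D.tensorFamily F hF).Tot}
    (h : Continuous fun t => (D.tensorFamily F hF).proj (s t))
    (h' : ∀ φ : Module.Dual ℂ V, Continuous fun t => F.pt (s t).1 (contract φ (s t).2)) :
    Continuous s :=
  (D.isInducing_tensorFamily hF).continuous_iff.2 (h.prodMk (continuous_pi h'))

theorem isVectorBundle_tensorFamily [TopologicalSpace G] [DiscreteTopology G]
    [ContinuousConstSMul (G ⧸ A) X] (hV : F.IsVectorBundle) :
    (D.tensorFamily F hF).IsVectorBundle where
  continuous_proj := D.continuous_tensorFamily_proj hF
  locally_trivial :=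
    (hV.tensor ⟨V, (1 : Representation ℂ (G ⧸ A) V)⟩
      (twistedKind.{v} D.α).locConst).locally_trivial
  continuous_act := by
    refine D.continuous_tensorFamily hF ?_ fun φ => ?_
    · exact (continuous_baseAct (IsLocallyConstant.of_discrete _)).comp
        (continuous_fst.prodMk ((D.continuous_tensorFamily_proj hF).comp continuous_snd))
    · refine continuous_prod_of_discrete_left.2 fun g => ?_
      have h := hV.continuous_act_apply ⟨QuotientGroup.mk g, 1⟩
        (x := fun t : (D.tensorFamily F hF).Tot => t.1) (fun t => rfl)
        (D.continuous_tensorFamily_contract hF (φ ∘ₗ (D.projRep g).toLinearEquiv.toLinearMap))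
      exact h.congr fun t => congrArg (F.pt _) (contract_map φ _ _ t.2).symm

theorem fibRep_tensorFamily (x : X) (a : A) :
    fibRep (D.tensorFamily F hF) x a = LinearMap.rTensor (F.fiber x) (toRep ρ a) := by
  refine LinearMap.ext (tmul_equiv_of_tmul fun b f => ?_)
  have h₁ : TwExt.proj D.α 1 • x = x := by rw [map_one, one_smul]
  have h₂ : (⟨QuotientGroup.mk (a : G), 1⟩ : TwExt D.α) = 1 :=
    TwExt.ext ((QuotientGroup.eq_one_iff _).2 a.2) rfl
  change D.projRep a b ⊗ₜ[ℂ] F.act ⟨QuotientGroup.mk (a : G), 1⟩ _ f = ρ a b ⊗ₜ[ℂ] f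
  rw [D.projRep_coe]
  exact congrArg _ ((F.act_eq_of_eq h₂ _ h₁ f).trans (F.act_one h₁ f))

/-- The `(G, ρ)`-equivariant bundle `V ⊗ F`. -/
def tensorBundle [ContinuousConstSMul (G ⧸ A) X] (F : Bundle.{u, v} (twistedKind D.α) X) :
    Bundle.{u, v} (rhoKind ρ) X where
  fam := D.tensorFamily F.fam F.cond
  isVB :=
    let _ : TopologicalSpace G := ⊥
    have : DiscreteTopology G := ⟨rfl⟩
    D.isVectorBundle_tensorFamily F.cond F.isVB
  cond x := bijective_evalMap_of_eq_rTensor (D.fibRep_tensorFamily F.cond x)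

end Lifts

namespace Lifts

open Family

variable {G : Type w} [Group G] {A : Subgroup G} [A.Normal]
variable {V : Type v} [NormedAddCommGroup V] [InnerProductSpace ℂ V]
variable {ρ : A →* (V ≃ₗᵢ[ℂ] V)} (D : Lifts ρ) {X : Type u} [TopologicalSpace X]
  [MulAction (G ⧸ A) X]

theorem act_σ_rem (E : Family.{u, v} (QuotientGroup.mk' A) X) (g : G) {x y : X}
    (h : QuotientGroup.mk' A g • x = y) (e : E.fiber x) :
    E.act (D.σ (QuotientGroup.mk g)) (D.mk_σ_smul h) (fibRep E x (D.rem g) e) = E.act g h e := by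
  have h' : QuotientGroup.mk' A (D.σ (QuotientGroup.mk g) * (D.rem g : G)) • x = y := by
    rw [D.σ_mul_rem, h]
  rw [fibRep_apply E x _ (mk_coe_smul _ _), ← E.act_mul _ _ _ _ h']
  exact act_congr E (D.σ_mul_rem g) _ _ _

variable [FiniteDimensional ℂ V] [Representation.IsIrreducible (toRep ρ)]

section Evaluation

variable (E : Family.{u, v} (QuotientGroup.mk' A) X) (hT : IsTwisted (homFamily D E))

/-- The evaluation `V ⊗ Hom_A(V, E) → E` on the fibre at `x`. -/
def homEval (x : X) : V ⊗[ℂ] (homFamily D E).fiber x →ₗ[ℂ] E.fiber x :=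
  evalMap (toRep ρ) (fibRep E x)

theorem homEval_tmul (x : X) (a : V) (f : (homFamily D E).fiber x) :
    D.homEval E x (a ⊗ₜ[ℂ] f) = homMap f a := rfl

theorem homEval_act (g : G) {x y : X} (h : QuotientGroup.mk' A g • x = y)
    (t : V ⊗[ℂ] (homFamily D E).fiber x) :
    D.homEval E y ((D.tensorFamily (homFamily D E) hT).act g h t)
      = E.act g h (D.homEval E x t) := by
  refine tmul_equiv_of_tmul
    (f := D.homEval E y ∘ₗ TensorProduct.map (D.projRep g).toLinearEquiv.toLinearMap
      ((homFamily D E).act ⟨QuotientGroup.mk g, 1⟩ h))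
    (g := E.act g h ∘ₗ D.homEval E x) (fun a f => ?_) t
  change ((1 : Circle) : ℂ) • E.act (D.σ (QuotientGroup.mk g)) (D.mk_σ_smul h)
    (homMap f ((D.M (QuotientGroup.mk g))⁻¹ (D.projRep g a))) = E.act g h (homMap f a)
  have hproj : (D.M (QuotientGroup.mk g))⁻¹ (D.projRep g a) = ρ (D.rem g) a :=
    (D.M (QuotientGroup.mk g)).symm_apply_apply _
  have hequiv : homMap f (ρ (D.rem g) a) = fibRep E x (D.rem g) (homMap f a) :=
    Representation.IntertwiningMap.isIntertwining _ _ (homMap f) _ _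
  rw [hproj, hequiv, Circle.coe_one, one_smul, D.act_σ_rem]

theorem continuous_homEval [TopologicalSpace G] (hE : E.IsVectorBundle) :
    Continuous fun t : (D.tensorFamily (homFamily D E) hT).Tot =>
      E.pt t.1 (D.homEval E t.1 t.2) := by
  let b := Module.finBasis ℂ V
  have h := hE.continuous_sum_smul
    (x := fun t : (D.tensorFamily (homFamily D E) hT).Tot => t.1)
    (D.continuous_tensorFamily_proj hT) (c := fun _ _ => 1) (fun _ => continuous_const)
    (s := fun k t => homMap (contract (b.coord k) t.2) (b k))
    (fun k => (D.continuous_homFamily_eval E (b k)).comp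
      (D.continuous_tensorFamily_contract hT (b.coord k)))
  refine h.congr fun t => congrArg (E.pt t.1) ?_
  refine Eq.trans ?_ (congrArg (D.homEval E t.1)
    (sum_contract (F := (homFamily D E).fiber t.1) b t.2))
  simp only [map_sum, one_smul, homEval_tmul]

end Evaluation

theorem cls_tensorBundle_homBundle [ContinuousConstSMul (G ⧸ A) X]
    (E : Bundle.{u, v} (rhoKind ρ) X) : (D.tensorBundle (D.homBundle E)).cls = E.cls :=
  let _ : TopologicalSpace G := ⊥
  Bundle.cls_eq (fun x => LinearEquiv.ofBijective _ (E.cond x))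
    (fun g _ _ h t => D.homEval_act E.fam (D.homBundle E).cond g h t)
    (D.continuous_homEval E.fam (D.homBundle E).cond E.isVB)

section Coevaluation

variable (F : Family.{u, v} (TwExt.proj D.α) X) (hF : IsTwisted F)

/-- The coevaluation `F → Hom_A(V, V ⊗ F)` on the fibre at `x`. -/
def homCoev (x : X) : F.fiber x →ₗ[ℂ] (homFamily D (D.tensorFamily F hF)).fiber x :=
  coevMap (D.fibRep_tensorFamily hF x)

theorem homCoev_act (γ : TwExt D.α) {x y : X} (h : TwExt.proj D.α γ • x = y) (f : F.fiber x) :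
    D.homCoev F hF y (F.act γ h f)
      = (homFamily D (D.tensorFamily F hF)).act γ h (D.homCoev F hF x f) := by
  refine Representation.IntertwiningMap.ext (LinearMap.ext fun a => ?_)
  change (a ⊗ₜ[ℂ] F.act γ h f : V ⊗[ℂ] F.fiber y)
    = (γ.z : ℂ) • (D.projRep (D.σ γ.q) ((D.M γ.q)⁻¹ a) ⊗ₜ[ℂ]
        F.act ⟨QuotientGroup.mk (D.σ γ.q), 1⟩ _ f)
  have hproj : D.projRep (D.σ γ.q) ((D.M γ.q)⁻¹ a) = a := by
    rw [D.projRep_σ]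
    exact (D.M γ.q).apply_symm_apply a
  have hq : (⟨QuotientGroup.mk (D.σ γ.q), 1⟩ : TwExt D.α) = ⟨γ.q, 1⟩ :=
    TwExt.ext (D.mk_σ γ.q) rfl
  rw [hproj, ← TensorProduct.tmul_smul]
  refine congrArg _ ((hF.act_eq γ.q γ.z h f).trans (congrArg _ ?_))
  exact F.act_eq_of_eq hq.symm _ _ f

theorem continuous_homCoev (hV : F.IsVectorBundle) :
    Continuous (totMap (E := F) (F := homFamily D (D.tensorFamily F hF)) (D.homCoev F hF)) := by
  refine D.continuous_homFamily _ hV.continuous_proj fun a => ?_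
  refine D.continuous_tensorFamily hF hV.continuous_proj fun φ => ?_
  have h : Continuous fun t : F.Tot => F.pt t.1 (φ a • t.2) :=
    hV.continuous_smul continuous_const continuous_id
  exact h.congr fun t => congrArg (F.pt t.1) (contract_tmul φ a t.2).symm

end Coevaluation

theorem cls_homBundle_tensorBundle [ContinuousConstSMul (G ⧸ A) X]
    (F : Bundle.{u, v} (twistedKind D.α) X) : (D.homBundle (D.tensorBundle F)).cls = F.cls :=
  (Bundle.cls_eq
    (fun x => LinearEquiv.ofBijective (D.homCoev F.fam F.cond x)
      (bijective_coevMap (D.fibRep_tensorFamily F.cond x)))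
    (fun γ _ _ h f => D.homCoev_act F.fam F.cond γ h f)
    (D.continuous_homCoev F.fam F.cond F.isVB)).symm

end Lifts

section Grothendieck

open Algebra

variable {M : Type u} {N : Type v} {P : Type w} [AddCommMonoid M] [AddCommMonoid N]
  [AddCommMonoid P]

theorem groth_hom_ext {H : Type v} [AddCommGroup H] {f g : GrothendieckAddGroup M →+ H}
    (h : ∀ m, f (gOf m) = g (gOf m)) : f = g :=
  GrothendieckAddGroup.lift.symm.injective (AddMonoidHom.ext h)

theorem grothMap_id : grothMap (AddMonoidHom.id M) = AddMonoidHom.id _ :=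
  groth_hom_ext fun m => grothMap_of _ m

theorem grothMap_comp (g : N →+ P) (f : M →+ N) :
    grothMap (g.comp f) = (grothMap g).comp (grothMap f) :=
  groth_hom_ext fun m => by
    rw [AddMonoidHom.comp_apply, grothMap_of, grothMap_of, grothMap_of, AddMonoidHom.comp_apply]

theorem grothMap_leftInverse {f : M →+ N} {g : N →+ M} (h : Function.LeftInverse g f) :
    Function.LeftInverse (grothMap g) (grothMap f) := by
  have hcomp : g.comp f = AddMonoidHom.id M := AddMonoidHom.ext h
  have hgroth := grothMap_comp g f
  rw [hcomp, grothMap_id] at hgroth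
  exact fun x => (DFunLike.congr_fun hgroth x).symm

end Grothendieck

section Congr

variable {Q : Type w} [Group Q] {𝒯 𝒯' : Kind.{v, w, w'} Q}
variable {X Y : Type u} [TopologicalSpace X] [MulAction Q X] [ContinuousConstSMul Q X]
  [TopologicalSpace Y] [MulAction Q Y] [ContinuousConstSMul Q Y]

/-- The isomorphism of `K`-groups induced by an isomorphism of semimodules of classes. -/
def K0.congr (e : Vec.{u, v} 𝒯 X ≃ₗ[RepClass.{v} Q] Vec.{u, v} 𝒯' X) :
    K0.{u, v} 𝒯 X ≃ₗ[RepRing.{v} Q] K0.{u, v} 𝒯' X where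
  toFun := grothMap e.toLinearMap.toAddMonoidHom
  map_add' := map_add (grothMap e.toLinearMap.toAddMonoidHom)
  map_smul' := grothMap_smul e.toLinearMap
  invFun := grothMap e.symm.toLinearMap.toAddMonoidHom
  left_inv := grothMap_leftInverse e.symm_apply_apply
  right_inv := grothMap_leftInverse e.apply_symm_apply

theorem K0.congr_gOf (e : Vec.{u, v} 𝒯 X ≃ₗ[RepClass.{v} Q] Vec.{u, v} 𝒯' X)
    (a : Vec.{u, v} 𝒯 X) : K0.congr e (gOf a) = gOf (e a) :=
  grothMap_of _ _

theorem K0.congr_pull (e : Vec.{u, v} 𝒯 X ≃ₗ[RepClass.{v} Q] Vec.{u, v} 𝒯' X)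
    (e' : Vec.{u, v} 𝒯 Y ≃ₗ[RepClass.{v} Q] Vec.{u, v} 𝒯' Y) (f : EqMap Q X Y)
    (h : ∀ a, e (Vec.pull f a) = Vec.pull f (e' a)) (ξ : K0.{u, v} 𝒯 Y) :
    K0.congr e (K0.pull f ξ) = K0.pull f (K0.congr e' ξ) := by
  have hcomp : e.toLinearMap.toAddMonoidHom.comp (Vec.pullHom (𝒯 := 𝒯) f).toAddMonoidHom =
      (Vec.pullHom (𝒯 := 𝒯') f).toAddMonoidHom.comp e'.toLinearMap.toAddMonoidHom :=
    AddMonoidHom.ext h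
  have hgroth := congrArg grothMap hcomp
  rw [grothMap_comp, grothMap_comp] at hgroth
  exact DFunLike.congr_fun hgroth ξ

/-- A linear equivalence which is compatible with given linear maps restricts to their kernels. -/
def kerCongr {R M N M' N' : Type*} [Ring R] [AddCommGroup M] [AddCommGroup N] [AddCommGroup M']
    [AddCommGroup N'] [Module R M] [Module R N] [Module R M'] [Module R N'] {f : M →ₗ[R] N}
    {f' : M' →ₗ[R] N'} (e : M ≃ₗ[R] M') (e' : N ≃ₗ[R] N') (h : ∀ x, e' (f x) = f' (e x)) :
    LinearMap.ker f ≃ₗ[R] LinearMap.ker f' :=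
  e.ofSubmodules _ _ (by
    ext y
    rw [Submodule.mem_map_equiv, LinearMap.mem_ker, LinearMap.mem_ker,
      ← e'.map_eq_zero_iff, h, e.apply_symm_apply])

end Congr

/-- The isomorphism of spaces of intertwining maps given by composition with an isomorphism of
representations. -/
def intertwiningCongr {k B V F F' : Type*} [CommRing k] [Monoid B] [AddCommGroup V] [Module k V]
    [AddCommGroup F] [Module k F] [AddCommGroup F'] [Module k F'] (τ : Representation k B V)
    {σ : Representation k B F} {σ' : Representation k B F'} (e : σ.Equiv σ') :
    Representation.IntertwiningMap τ σ ≃ₗ[k] Representation.IntertwiningMap τ σ' :=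
  LinearEquiv.ofLinearMap
    (Representation.IntertwiningMap.llcomp τ σ σ' e.toIntertwiningMap)
    (Representation.IntertwiningMap.llcomp τ σ' σ e.symm.toIntertwiningMap)
    (LinearMap.ext fun f => Representation.IntertwiningMap.ext <| LinearMap.ext fun x =>
      e.toLinearEquiv.apply_symm_apply (f x))
    (LinearMap.ext fun f => Representation.IntertwiningMap.ext <| LinearMap.ext fun x =>
      e.toLinearEquiv.symm_apply_apply (f x))

namespace Lifts

open Family

variable {G : Type w} [Group G] {A : Subgroup G} [A.Normal]
variable {V : Type v} [NormedAddCommGroup V] [InnerProductSpace ℂ V] [FiniteDimensional ℂ V]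
variable {ρ : A →* (V ≃ₗᵢ[ℂ] V)} [Representation.IsIrreducible (toRep ρ)] (D : Lifts ρ)
variable {X : Type u} [TopologicalSpace X] [MulAction (G ⧸ A) X] [ContinuousConstSMul (G ⧸ A) X]

theorem iso_tensorBundle {F F' : Bundle.{u, v} (twistedKind D.α) X} (h : F.fam.Iso F'.fam) :
    (D.tensorBundle F).fam.Iso (D.tensorBundle F').fam := by
  obtain ⟨e, he, hc, -⟩ := h
  refine iso_of_continuous (D.tensorBundle F).isVB (D.tensorBundle F').isVB
    (fun x => (e x).lTensor V) (fun g x y hxy t => ?_) ?_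
  · exact tmul_equiv_of_tmul
      (f := ((e y).lTensor V).toLinearMap ∘ₗ
        TensorProduct.map (D.projRep g).toLinearEquiv.toLinearMap
          (F.fam.act ⟨QuotientGroup.mk g, 1⟩ hxy))
      (g := TensorProduct.map (D.projRep g).toLinearEquiv.toLinearMap
          (F'.fam.act ⟨QuotientGroup.mk g, 1⟩ hxy) ∘ₗ ((e x).lTensor V).toLinearMap)
      (fun a b => congrArg (D.projRep g a ⊗ₜ[ℂ] ·) (he _ x y hxy b)) t
  · refine D.continuous_tensorFamily F'.cond (D.continuous_tensorFamily_proj F.cond) fun φ => ?_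
    exact (hc.comp (D.continuous_tensorFamily_contract F.cond φ)).congr fun t =>
      congrArg (F'.fam.pt _) (contract_map φ LinearMap.id (e t.1).toLinearMap t.2).symm

theorem iso_homBundle {E E' : Bundle.{u, v} (rhoKind ρ) X} (h : E.fam.Iso E'.fam) :
    (D.homBundle E).fam.Iso (D.homBundle E').fam := by
  obtain ⟨e, he, hc, -⟩ := h
  refine iso_of_continuous (D.homBundle E).isVB (D.homBundle E').isVB
    (fun x => intertwiningCongr (toRep ρ) (.mk (e x) fun a =>
      LinearMap.ext (he (a : G) x x (mk_coe_smul a x)))) (fun γ x y hxy f => ?_) ?_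
  · refine Representation.IntertwiningMap.ext (LinearMap.ext fun a => ?_)
    refine ((e y).map_smul (γ.z : ℂ) _).trans (congrArg ((γ.z : ℂ) • ·) ?_)
    exact he (D.σ γ.q) x y (D.mk_σ_smul hxy) _
  · refine D.continuous_homFamily E'.fam (D.continuous_homFamily_proj E.fam) fun a => ?_
    exact hc.comp (D.continuous_homFamily_eval E.fam a)

/-- The map `[F] ↦ [V ⊗ F]` on isomorphism classes. -/
def tensorVec : Vec.{u, v} (twistedKind D.α) X → Vec.{u, v} (rhoKind ρ) X :=
  Quotient.map D.tensorBundle fun _ _ => D.iso_tensorBundle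

/-- The map `[E] ↦ [Hom_A(V, E)]` on isomorphism classes. -/
def homVec : Vec.{u, v} (rhoKind ρ) X → Vec.{u, v} (twistedKind D.α) X :=
  Quotient.map D.homBundle fun _ _ => D.iso_homBundle

theorem cls_tensorBundle_sum (E F : Bundle.{u, v} (twistedKind D.α) X) :
    (D.tensorBundle (E.sum F)).cls = ((D.tensorBundle E).sum (D.tensorBundle F)).cls := by
  refine Bundle.cls_eq (E := D.tensorBundle (E.sum F))
    (F := (D.tensorBundle E).sum (D.tensorBundle F))
    (fun x => TensorProduct.prodRight ℂ ℂ V (E.fam.fiber x) (F.fam.fiber x))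
    (fun g x y hxy t => ?_) ?_
  · exact tmul_equiv_of_tmul
      (f := (TensorProduct.prodRight ℂ ℂ V (E.fam.fiber y) (F.fam.fiber y)).toLinearMap ∘ₗ
        TensorProduct.map (D.projRep g).toLinearEquiv.toLinearMap
          ((E.fam.act ⟨QuotientGroup.mk g, 1⟩ hxy).prodMap
            (F.fam.act ⟨QuotientGroup.mk g, 1⟩ hxy)))
      (g := ((TensorProduct.map (D.projRep g).toLinearEquiv.toLinearMap
          (E.fam.act ⟨QuotientGroup.mk g, 1⟩ hxy)).prodMap
        (TensorProduct.map (D.projRep g).toLinearEquiv.toLinearMap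
          (F.fam.act ⟨QuotientGroup.mk g, 1⟩ hxy))) ∘ₗ
        (TensorProduct.prodRight ℂ ℂ V (E.fam.fiber x) (F.fam.fiber x)).toLinearMap)
      (fun _ _ => rfl) t
  · have hproj := D.continuous_tensorFamily_proj (E.sum F).cond
    have hcontract (φ : Module.Dual ℂ V) :=
      D.continuous_tensorFamily_contract (E.sum F).cond φ
    refine (isInducing_sum _ _).continuous_iff.2 (Continuous.prodMk ?_ ?_)
    · refine D.continuous_tensorFamily E.cond hproj fun φ => ?_
      exact ((continuous_sum_fst E.fam F.fam).comp (hcontract φ)).congr fun t =>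
        congrArg (E.fam.pt _) (contract_fst φ t.2)
    · refine D.continuous_tensorFamily F.cond hproj fun φ => ?_
      exact ((continuous_sum_snd E.fam F.fam).comp (hcontract φ)).congr fun t =>
        congrArg (F.fam.pt _) (contract_snd φ t.2)

theorem cls_tensorBundle_tensor (F : Bundle.{u, v} (twistedKind D.α) X)
    (W : FinRep.{v} (G ⧸ A)) :
    (D.tensorBundle (F.tensor W)).cls = ((D.tensorBundle F).tensor W).cls := by
  refine Bundle.cls_eq (E := D.tensorBundle (F.tensor W)) (F := (D.tensorBundle F).tensor W)
    (fun x => TensorProduct.leftComm ℂ V W.carrier (F.fam.fiber x)) (fun g x y hxy t => ?_) ?_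
  · refine DFunLike.congr_fun
      (f := (TensorProduct.leftComm ℂ V W.carrier (F.fam.fiber y)).toLinearMap ∘ₗ
        TensorProduct.map (D.projRep g).toLinearEquiv.toLinearMap
          (TensorProduct.map (W.rep (QuotientGroup.mk g))
            (F.fam.act ⟨QuotientGroup.mk g, 1⟩ hxy)))
      (g := TensorProduct.map (W.rep (QuotientGroup.mk g))
          (TensorProduct.map (D.projRep g).toLinearEquiv.toLinearMap
            (F.fam.act ⟨QuotientGroup.mk g, 1⟩ hxy)) ∘ₗ
        (TensorProduct.leftComm ℂ V W.carrier (F.fam.fiber x)).toLinearMap) ?_ t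
    exact TensorProduct.ext_threefold' fun _ _ _ => rfl
  · have hproj := D.continuous_tensorFamily_proj (F.tensor W).cond
    refine (isInducing_tensor _ _).continuous_iff.2 (hproj.prodMk (continuous_pi fun φ => ?_))
    refine D.continuous_tensorFamily F.cond hproj fun ψ => ?_
    exact ((continuous_tensor_contract W F.fam φ).comp
      (D.continuous_tensorFamily_contract (F.tensor W).cond ψ)).congr fun t =>
        congrArg (F.fam.pt _) (contract_contract_leftComm ψ φ t.2).symm

theorem tensorVec_add (a b : Vec.{u, v} (twistedKind D.α) X) :
    D.tensorVec (a + b) = D.tensorVec a + D.tensorVec b := by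
  induction a, b using Quotient.inductionOn₂ with
  | _ E F => exact D.cls_tensorBundle_sum E F

theorem tensorVec_smul (w : RepClass.{v} (G ⧸ A)) (a : Vec.{u, v} (twistedKind D.α) X) :
    D.tensorVec (w • a) = w • D.tensorVec a := by
  induction w, a using Quotient.inductionOn₂ with
  | _ W F => exact D.cls_tensorBundle_tensor F W

variable (X) in
/-- The isomorphism `[E] ↦ [Hom_A(V, E)]` of semimodules of isomorphism classes. -/
def vecEquiv : Vec.{u, v} (rhoKind ρ) X ≃ₗ[RepClass.{v} (G ⧸ A)]
    Vec.{u, v} (twistedKind D.α) X :=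
  LinearEquiv.symm
    { toFun := D.tensorVec
      map_add' := D.tensorVec_add
      map_smul' := D.tensorVec_smul
      invFun := D.homVec
      left_inv := Quotient.ind D.cls_homBundle_tensorBundle
      right_inv := Quotient.ind D.cls_tensorBundle_homBundle }

variable (X) in
/-- The isomorphism `[E] ↦ [Hom_A(V, E)]` in `K`-theory. -/
def K0Equiv : K0.{u, v} (rhoKind ρ) X ≃ₗ[RepRing.{v} (G ⧸ A)] K0.{u, v} (twistedKind D.α) X :=
  K0.congr (D.vecEquiv X)

theorem K0Equiv_of (E : Bundle.{u, v} (rhoKind ρ) X) :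
    D.K0Equiv X (K0.of E) = K0.of (D.homBundle E) :=
  K0.congr_gOf (D.vecEquiv X) E.cls

section Naturality

variable {Y : Type u} [TopologicalSpace Y] [MulAction (G ⧸ A) Y] [ContinuousConstSMul (G ⧸ A) Y]
  (f : EqMap (G ⧸ A) X Y)

theorem tensorVec_pull (a : Vec.{u, v} (twistedKind D.α) Y) :
    D.tensorVec (Vec.pull f a) = Vec.pull f (D.tensorVec a) := by
  induction a using Quotient.ind with
  | _ F =>
    have hproj := D.continuous_tensorFamily_proj (F.pullback f).cond
    refine Bundle.cls_eq (E := D.tensorBundle (F.pullback f))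
      (F := (D.tensorBundle F).pullback f) (fun x => LinearEquiv.refl _ _)
      (fun _ _ _ _ _ => rfl) ?_
    refine (isInducing_pullback _ _).continuous_iff.2 (hproj.prodMk ?_)
    refine D.continuous_tensorFamily F.cond (f.continuous.comp hproj) fun φ => ?_
    exact (continuous_snd.comp (isInducing_pullback f F.fam).continuous).comp
      (D.continuous_tensorFamily_contract (F.pullback f).cond φ)

theorem vecEquiv_pull (a : Vec.{u, v} (rhoKind ρ) Y) :
    D.vecEquiv X (Vec.pull f a) = Vec.pull f (D.vecEquiv Y a) := by
  rw [← LinearEquiv.eq_symm_apply]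
  refine Eq.trans ?_ (D.tensorVec_pull f (D.vecEquiv Y a)).symm
  exact congrArg (Vec.pull f) ((D.vecEquiv Y).symm_apply_apply a).symm

theorem K0Equiv_pull (ξ : K0.{u, v} (rhoKind ρ) Y) :
    D.K0Equiv X (K0.pull f ξ) = K0.pull f (D.K0Equiv Y ξ) :=
  K0.congr_pull _ _ f (D.vecEquiv_pull f) ξ

end Naturality

variable (X) in
/-- The isomorphism of the groups `Kⁿ` induced by `[E] ↦ [Hom_A(V, E)]`. -/
def KnEquiv (n : ℕ) :
    Kn.{u, v} (rhoKind ρ) n X ≃ₗ[RepRing.{v} (G ⧸ A)] Kn.{u, v} (twistedKind D.α) n X :=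
  kerCongr (D.K0Equiv (SuspPlus n X)) (D.K0Equiv PUnit.{u + 1}) (D.K0Equiv_pull _)

theorem coe_KnEquiv (n : ℕ) (ξ : Kn.{u, v} (rhoKind ρ) n X) :
    (D.KnEquiv X n ξ : K0.{u, v} (twistedKind D.α) (SuspPlus n X))
      = D.K0Equiv (SuspPlus n X) ξ := rfl

end Lifts

end EqK

end

theorem mainTheorem4_general {G : Type w} [Group G] (A : Subgroup G) [A.Normal]
    {V : Type v} [NormedAddCommGroup V] [InnerProductSpace ℂ V] [FiniteDimensional ℂ V]
    (ρ : A →* (V ≃ₗᵢ[ℂ] V)) [Representation.IsIrreducible (EqK.toRep ρ)]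
    (hinv : ∀ g : G,
      Nonempty (Representation.Equiv (EqK.toRep (EqK.conjRep g ρ)) (EqK.toRep ρ))) :
    Nonempty (EqK.Lifts ρ) ∧ ∀ D : EqK.Lifts ρ,
      ∃ (Φ₀ : ∀ (X : Type u) [TopologicalSpace X] [MulAction (G ⧸ A) X]
          [ContinuousConstSMul (G ⧸ A) X],
          EqK.K0 (EqK.rhoKind ρ) X ≃ₗ[EqK.RepRing.{v} (G ⧸ A)] EqK.K0 (EqK.twistedKind D.α) X)
        (Φ : ∀ (X : Type u) [TopologicalSpace X] [MulAction (G ⧸ A) X]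
          [ContinuousConstSMul (G ⧸ A) X] (n : ℕ),
          EqK.Kn (EqK.rhoKind ρ) n X ≃ₗ[EqK.RepRing.{v} (G ⧸ A)]
            EqK.Kn (EqK.twistedKind D.α) n X),
        (∀ (X : Type u) [TopologicalSpace X] [MulAction (G ⧸ A) X]
          [ContinuousConstSMul (G ⧸ A) X] (E : EqK.Bundle (EqK.rhoKind ρ) X),
          ∃ F : EqK.Bundle (EqK.twistedKind D.α) X,
            F.fam = EqK.homFamily D E.fam ∧ Φ₀ X (EqK.K0.of E) = EqK.K0.of F) ∧
        (∀ (X Y : Type u) [TopologicalSpace X] [MulAction (G ⧸ A) X]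
          [ContinuousConstSMul (G ⧸ A) X] [TopologicalSpace Y] [MulAction (G ⧸ A) Y]
          [ContinuousConstSMul (G ⧸ A) Y] (f : EqK.EqMap (G ⧸ A) X Y)
          (ξ : EqK.K0 (EqK.rhoKind ρ) Y),
          Φ₀ X (EqK.K0.pull f ξ) = EqK.K0.pull f (Φ₀ Y ξ)) ∧
        (∀ (X : Type u) [TopologicalSpace X] [MulAction (G ⧸ A) X]
          [ContinuousConstSMul (G ⧸ A) X] (n : ℕ)
          (E E' : EqK.Bundle (EqK.rhoKind ρ) (EqK.SuspPlus n X))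
          (h : EqK.K0.of E - EqK.K0.of E' ∈ EqK.Kn (EqK.rhoKind ρ) n X),
          ∃ F F' : EqK.Bundle (EqK.twistedKind D.α) (EqK.SuspPlus n X),
            F.fam = EqK.homFamily D E.fam ∧ F'.fam = EqK.homFamily D E'.fam ∧
            (Φ X n ⟨EqK.K0.of E - EqK.K0.of E', h⟩ :
              EqK.K0 (EqK.twistedKind D.α) (EqK.SuspPlus n X)) =
              EqK.K0.of F - EqK.K0.of F') ∧
        (∀ (X Y : Type u) [TopologicalSpace X] [CompactSpace X] [MulAction (G ⧸ A) X]
          [ContinuousConstSMul (G ⧸ A) X] [TopologicalSpace Y] [T2Space Y] [MulAction (G ⧸ A) Y]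
          [ContinuousConstSMul (G ⧸ A) Y] (f : EqK.EqMap (G ⧸ A) X Y) (n : ℕ)
          (ξ : EqK.Kn (EqK.rhoKind ρ) n Y),
          Φ X n (EqK.Kn.pull (EqK.rhoKind ρ) n f ξ) =
            EqK.Kn.pull (EqK.twistedKind D.α) n f (Φ Y n ξ)) :=
  ⟨EqK.nonempty_lifts hinv, fun D =>
    ⟨fun X _ _ _ => D.K0Equiv X,
      fun X _ _ _ n => D.KnEquiv X n,
      fun _ _ _ _ E => ⟨D.homBundle E, rfl, D.K0Equiv_of E⟩,
      fun _ _ _ _ _ _ _ _ f ξ => D.K0Equiv_pull f ξ,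
      fun _ _ _ _ n E E' _ => ⟨D.homBundle E, D.homBundle E', rfl, rfl, by
        rw [D.coe_KnEquiv, map_sub, D.K0Equiv_of, D.K0Equiv_of]⟩,
      fun _ _ _ _ _ _ _ _ _ _ f n ξ => Subtype.ext (D.K0Equiv_pull (f.susp n) ξ)⟩⟩

theorem mainTheorem4 {G : Type w} [Group G] [Finite G] (A : Subgroup G) [A.Normal]
    {V : Type v} [NormedAddCommGroup V] [InnerProductSpace ℂ V] [FiniteDimensional ℂ V]
    (ρ : A →* (V ≃ₗᵢ[ℂ] V)) [Representation.IsIrreducible (EqK.toRep ρ)]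
    (hinv : ∀ g : G,
      Nonempty (Representation.Equiv (EqK.toRep (EqK.conjRep g ρ)) (EqK.toRep ρ))) :
    Nonempty (EqK.Lifts ρ) ∧ ∀ D : EqK.Lifts ρ,
      ∃ (Φ₀ : ∀ (X : Type u) [TopologicalSpace X] [CompactSpace X] [T2Space X]
          [MulAction G X] [ContinuousConstSMul G X] [EqK.ActsTrivially A X],
          EqK.K0 (EqK.rhoKind ρ) X ≃ₗ[EqK.RepRing.{v} (G ⧸ A)] EqK.K0 (EqK.twistedKind D.α) X)
        (Φ : ∀ (X : Type u) [TopologicalSpace X] [CompactSpace X] [T2Space X]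
          [MulAction G X] [ContinuousConstSMul G X] [EqK.ActsTrivially A X] (n : ℕ),
          EqK.Kn (EqK.rhoKind ρ) n X ≃ₗ[EqK.RepRing.{v} (G ⧸ A)]
            EqK.Kn (EqK.twistedKind D.α) n X),
        -- on `K⁰` the isomorphism is `[E] ↦ [Hom_A(V, E)]`
        (∀ (X : Type u) [TopologicalSpace X] [CompactSpace X] [T2Space X]
          [MulAction G X] [ContinuousConstSMul G X] [EqK.ActsTrivially A X]
          (E : EqK.Bundle (EqK.rhoKind ρ) X),
          ∃ F : EqK.Bundle (EqK.twistedKind D.α) X,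
            F.fam = EqK.homFamily D E.fam ∧ Φ₀ X (EqK.K0.of E) = EqK.K0.of F) ∧
        -- naturality on `K⁰`
        (∀ (X Y : Type u) [TopologicalSpace X] [CompactSpace X] [T2Space X]
          [MulAction G X] [ContinuousConstSMul G X] [EqK.ActsTrivially A X]
          [TopologicalSpace Y] [CompactSpace Y] [T2Space Y]
          [MulAction G Y] [ContinuousConstSMul G Y] [EqK.ActsTrivially A Y]
          (f : X → Y) (hf : Continuous f) (hG : ∀ (g : G) (x : X), f (g • x) = g • f x)
          (ξ : EqK.K0 (EqK.rhoKind ρ) Y),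
          Φ₀ X (EqK.K0.pull (EqK.EqMap.ofG A f hf hG) ξ) =
            EqK.K0.pull (EqK.EqMap.ofG A f hf hG) (Φ₀ Y ξ)) ∧
        -- on `Kⁿ`, `[E] - [E'] ↦ [Hom_A(V, E)] - [Hom_A(V, E')]` for bundles over `Σⁿ X₊`
        (∀ (X : Type u) [TopologicalSpace X] [CompactSpace X] [T2Space X]
          [MulAction G X] [ContinuousConstSMul G X] [EqK.ActsTrivially A X] (n : ℕ)
          (E E' : EqK.Bundle (EqK.rhoKind ρ) (EqK.SuspPlus n X))
          (h : EqK.K0.of E - EqK.K0.of E' ∈ EqK.Kn (EqK.rhoKind ρ) n X),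
          ∃ F F' : EqK.Bundle (EqK.twistedKind D.α) (EqK.SuspPlus n X),
            F.fam = EqK.homFamily D E.fam ∧ F'.fam = EqK.homFamily D E'.fam ∧
            (Φ X n ⟨EqK.K0.of E - EqK.K0.of E', h⟩ :
              EqK.K0 (EqK.twistedKind D.α) (EqK.SuspPlus n X)) =
              EqK.K0.of F - EqK.K0.of F') ∧
        -- naturality on `Kⁿ`
        (∀ (X Y : Type u) [TopologicalSpace X] [CompactSpace X] [T2Space X]
          [MulAction G X] [ContinuousConstSMul G X] [EqK.ActsTrivially A X]
          [TopologicalSpace Y] [CompactSpace Y] [T2Space Y]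
          [MulAction G Y] [ContinuousConstSMul G Y] [EqK.ActsTrivially A Y]
          (f : X → Y) (hf : Continuous f) (hG : ∀ (g : G) (x : X), f (g • x) = g • f x)
          (n : ℕ) (ξ : EqK.Kn (EqK.rhoKind ρ) n Y),
          Φ X n (EqK.Kn.pull (EqK.rhoKind ρ) n (EqK.EqMap.ofG A f hf hG) ξ) =
            EqK.Kn.pull (EqK.twistedKind D.α) n (EqK.EqMap.ofG A f hf hG) (Φ Y n ξ)) := by
  obtain ⟨hne, h⟩ := mainTheorem4_general A ρ hinv
  refine ⟨hne, fun D => ?_⟩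
  obtain ⟨Φ₀, Φ, hΦ₀, hΦ₀_pull, hΦ, hΦ_pull⟩ := h D
  exact ⟨fun X _ _ _ _ _ _ => Φ₀ X, fun X _ _ _ _ _ _ n => Φ X n,
    fun X _ _ _ _ _ _ => hΦ₀ X,
    fun X Y _ _ _ _ _ _ _ _ _ _ _ _ f hf hG => hΦ₀_pull X Y (EqK.EqMap.ofG A f hf hG),
    fun X _ _ _ _ _ _ => hΦ X,
    fun X Y _ _ _ _ _ _ _ _ _ _ _ _ f hf hG => hΦ_pull X Y (EqK.EqMap.ofG A f hf hG)⟩
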